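/- Let $p$ be a prime and let $q=p^f$ with $f\ge 1$ (the cardinality of the residue field of a non-archimedean local field $F$). For a commutative ring $R$ let $H_R$ be the Iwahori–Hecke algebra of $GL_3(F)$ over $R$, that is, the $R$-algebra generated by $T^{\pm1}, S_1$ with the relations $$(S_1+1)(S_1-q)=0,\quad T^3S_1=S_1T^3,\quad S_1S_2S_1=S_2S_1S_2,\qquad\text{where } S_2=T^{-1}S_1T .$$ Modules are left modules. For $z,y,y'\in\overline{\mathbf F}_p^{\,*}$ define the following $H_{\overline{\mathbf F}_p}$-modules (note that $q=0$ in $\overline{\mathbf F}_p$). Dimension 1: $M_1(0,y)$: $T\mapsto y,\ S_1\mapsto 0$; and $M_1(-1,y)$: $T\mapsto y,\ S_1\mapsto -1$. Dimension 2, with basis $w,Tw$ and $T^2w=-y^2w-yTw$: in $M_2(y)$, $S_1w=-w$, $S_1Tw=0$; in $\tilde M_2(y)$, $S_1w=0$, $S_1Tw=-Tw$. Dimension 3, with basis $v,Tv,T^2v$ and $T^3v=zv$; the images of $(v,Tv,T^2v)$ under $S_1$ are: - $M_3(z,y)$: $(0,\ y^{-1}T^2v,\ -T^2v)$; - $\tilde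 M_3(z,y)$: $(-v,\ -y^{-1}T^2v,\ -T^2v)$; - $N_3(z,y)$: $(-v,\ 0,\ -yTv-T^2v)$; - $\tilde N_3(z,y)$: $(0,\ 0,\ yTv-T^2v)$; - $P_3(z)$: $(0,\ 0,\ -T^2v)$; - $\tilde P_3(z)$: $(-v,\ 0,\ -T^2v)$. Dimension 6, with basis $v,Tv,T^2v,w,Tw,T^2w$, where $T^3$ acts by $z$; the images of this basis under $S_1$ are: - $L_6(z,y)$: $(0,\ T^2w,\ -T^2v,\ -w,\ \tfrac{y}{z}T^2v,\ -T^2w)$; - $\tilde L_6(z,y)$: $(w,\ 0,\ -T^2v,\ -w,\ \tfrac{y}{z}T^2v,\ -T^2w)$; - $K_6(z,y,y')$: $(w,\ \tfrac{y}{y'}T^2w,\ -T^2v,\ -w,\ \tfrac{y'}{z}T^2v,\ -T^2w)$. Consider the list consisting of $M_1(0,y)$, $M_1(-1,y)$, $M_2(y)$, $\tilde M_2(y)$; $K_6(z,y,y')$ with $y^2\ne y'$ and $y'^2\ne zy$; $M_3(z,y)$, $\tilde M_3(z,y)$, $N_3(z,y)$, $\tilde N_3(z,y)$ with $y^3\neq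 z$; $L_6(z,y)$, $\tilde L_6(z,y)$, $P_3(z)$, $\tilde P_3(z)$; where $z,y,y'$ run through $\overline{\mathbf F}_p^{\,*}$. Then: 1. every module of the list is simple; 2. the modules of the list are pairwise non-isomorphic (different names or different parameters give non-isomorphic modules); 3. every simple $H_{\overline{\mathbf F}_p}$-module on which the centre of $H_{\overline{\mathbf F}_p}$ acts by a character with values in $\overline{\mathbf F}_p$ is isomorphic to a module of the list; 4. every simple $H_{\overline{\mathbf F}_p}$-module $V$ is the reduction of an integral simple $H_{\overline{\mathbf Q}_p}$-module. That is, for every reduction map $r$ from the ring of integers of $\overline{\mathbf Q}_p$ to $\overline{\mathbf F}_p$ there are a finite extension $E\subset\overline{\mathbf Q}_p$ of $\mathbf Q_p$ with ring of integers $O_E$, a finite-dimensional $H_E$-module $M$ such that $\overline{\mathbf Q}_p\otimes_E M$ is a simple $H_{\overline{\mathbf Q}_p}$-module, and a free $O_E$-submodule $L\subset M$ that is stable under $H$ and contains an $E$-basis of $M$, such that $V\cong \overline{\mathbf F}_p\otimes_{O_E,r}L$ as $H_{\overline{\mathbf F}_p}$-modules. -/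

import Mathlib

open scoped TensorProduct

noncomputable section

/-! ### The Iwahori-Hecke algebra of type `A₂` by generators and relations -/

/-- The letters `S₁`, `S₂`, `T`, `T⁻¹`. -/
inductive HeckeGen : Type
  | S1 | S2 | T | Tinv

/-- The defining relations of the algebra, for a family of four elements of a ring and a parameter `q`.
The last one determines `S₂ = T⁻¹ S₁ T`. -/
structure HeckeRelations {A : Type*} [Ring A] (q : A) (a : HeckeGen → A) : Prop where
  T_mul_Tinv : a .T * a .Tinv = 1
  Tinv_mul_T : a .Tinv * a .T = 1
  quadratic : (a .S1 + 1) * (a .S1 - q) = 0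
  cube_comm : a .T ^ 3 * a .S1 = a .S1 * a .T ^ 3
  braid : a .S1 * a .S2 * a .S1 = a .S2 * a .S1 * a .S2
  conj : a .T * a .S2 = a .S1 * a .T

theorem HeckeRelations.map {A B : Type*} [Ring A] [Ring B] (f : A →+* B) {q : A}
    {a : HeckeGen → A} (h : HeckeRelations q a) :
    HeckeRelations (f q) (fun g => f (a g)) where
  T_mul_Tinv := by simpa using congrArg f h.T_mul_Tinv
  Tinv_mul_T := by simpa using congrArg f h.Tinv_mul_T
  quadratic := by simpa using congrArg f h.quadratic
  cube_comm := by simpa using congrArg f h.cube_comm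
  braid := by simpa using congrArg f h.braid
  conj := by simpa using congrArg f h.conj

/-- The same relations, between elements of the free algebra on the four letters. -/
inductive HeckeRel (R : Type*) [CommRing R] (q : R) :
    FreeAlgebra R HeckeGen → FreeAlgebra R HeckeGen → Prop
  | T_mul_Tinv : HeckeRel R q (FreeAlgebra.ι R .T * FreeAlgebra.ι R .Tinv) 1
  | Tinv_mul_T : HeckeRel R q (FreeAlgebra.ι R .Tinv * FreeAlgebra.ι R .T) 1
  | quadratic : HeckeRel R q
      ((FreeAlgebra.ι R .S1 + 1) * (FreeAlgebra.ι R .S1 - algebraMap R (FreeAlgebra R HeckeGen) q)) 0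
  | cube_comm : HeckeRel R q
      (FreeAlgebra.ι R .T ^ 3 * FreeAlgebra.ι R .S1) (FreeAlgebra.ι R .S1 * FreeAlgebra.ι R .T ^ 3)
  | braid : HeckeRel R q
      (FreeAlgebra.ι R .S1 * FreeAlgebra.ι R .S2 * FreeAlgebra.ι R .S1)
      (FreeAlgebra.ι R .S2 * FreeAlgebra.ι R .S1 * FreeAlgebra.ι R .S2)
  | conj : HeckeRel R q
      (FreeAlgebra.ι R .T * FreeAlgebra.ι R .S2) (FreeAlgebra.ι R .S1 * FreeAlgebra.ι R .T)

/-- The `R`-algebra `H_R` generated by `T`, `T⁻¹`, `S₁` (and `S₂ = T⁻¹ S₁ T`), with parameter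
`q : R`, subject to `HeckeRelations`. -/
def HeckeAlgebra (R : Type*) [CommRing R] (q : R) : Type _ := RingQuot (HeckeRel R q)

namespace HeckeAlgebra

variable {R : Type*} [CommRing R] {q : R}

instance : Ring (HeckeAlgebra R q) := inferInstanceAs (Ring (RingQuot (HeckeRel R q)))

instance : Algebra R (HeckeAlgebra R q) := inferInstanceAs (Algebra R (RingQuot (HeckeRel R q)))

/-- The generators of `H_R`. -/
def gen (R : Type*) [CommRing R] (q : R) (g : HeckeGen) : HeckeAlgebra R q :=
  RingQuot.mkAlgHom R (HeckeRel R q) (FreeAlgebra.ι R g)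

theorem gen_relations : HeckeRelations (algebraMap R (HeckeAlgebra R q) q) (gen R q) where
  T_mul_Tinv := by
    have h := RingQuot.mkAlgHom_rel R (HeckeRel.T_mul_Tinv (R := R) (q := q))
    rw [map_mul, map_one] at h; exact h
  Tinv_mul_T := by
    have h := RingQuot.mkAlgHom_rel R (HeckeRel.Tinv_mul_T (R := R) (q := q))
    rw [map_mul, map_one] at h; exact h
  quadratic := by
    have h := RingQuot.mkAlgHom_rel R (HeckeRel.quadratic (R := R) (q := q))
    rw [map_mul, map_add, map_sub, map_one, map_zero, AlgHom.commutes] at h; exact h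
  cube_comm := by
    have h := RingQuot.mkAlgHom_rel R (HeckeRel.cube_comm (R := R) (q := q))
    rw [map_mul, map_mul, map_pow] at h; exact h
  braid := by
    have h := RingQuot.mkAlgHom_rel R (HeckeRel.braid (R := R) (q := q))
    rw [map_mul, map_mul, map_mul, map_mul] at h; exact h
  conj := by
    have h := RingQuot.mkAlgHom_rel R (HeckeRel.conj (R := R) (q := q))
    rw [map_mul, map_mul] at h; exact h

/-- The universal property of the presentation. -/
def lift {A : Type*} [Ring A] [Algebra R A] (a : HeckeGen → A)
    (ha : HeckeRelations (algebraMap R A q) a) : HeckeAlgebra R q →ₐ[R] A :=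
  RingQuot.liftAlgHom R (s := HeckeRel R q) ⟨FreeAlgebra.lift R a, by
    intro x y hxy
    induction hxy with
    | T_mul_Tinv => simpa using ha.T_mul_Tinv
    | Tinv_mul_T => simpa using ha.Tinv_mul_T
    | quadratic => simpa using ha.quadratic
    | cube_comm => simpa using ha.cube_comm
    | braid => simpa using ha.braid
    | conj => simpa using ha.conj⟩

theorem lift_gen {A : Type*} [Ring A] [Algebra R A] (a : HeckeGen → A)
    (ha : HeckeRelations (algebraMap R A q) a) (g : HeckeGen) : lift a ha (gen R q g) = a g := by
  unfold lift gen
  erw [RingQuot.liftAlgHom_mkAlgHom_apply]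
  simp

end HeckeAlgebra

/-- The left `H_R`-module whose underlying `R`-module is `M`, where the generators of `H_R` act by
the endomorphisms `a`. -/
def HeckeModule {R : Type*} [CommRing R] {q : R} {M : Type*} [AddCommGroup M] [Module R M]
    (a : HeckeGen → Module.End R M)
    (_ha : HeckeRelations (algebraMap R (Module.End R M) q) a) : Type _ := M

namespace HeckeModule

variable {R : Type*} [CommRing R] {q : R} {M : Type*} [AddCommGroup M] [Module R M]
  (a : HeckeGen → Module.End R M) (ha : HeckeRelations (algebraMap R (Module.End R M) q) a)

instance : AddCommGroup (HeckeModule a ha) := inferInstanceAs (AddCommGroup M)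

instance : Module R (HeckeModule a ha) := inferInstanceAs (Module R M)

instance : Module (HeckeAlgebra R q) (HeckeModule a ha) :=
  Module.compHom M (HeckeAlgebra.lift a ha : HeckeAlgebra R q →+* Module.End R M)

theorem gen_smul (g : HeckeGen) (x : HeckeModule a ha) :
    HeckeAlgebra.gen R q g • x = (a g (x : M) : M) :=
  congrArg (fun φ : Module.End R M => φ x) (HeckeAlgebra.lift_gen a ha g)

instance : IsScalarTower R (HeckeAlgebra R q) (HeckeModule a ha) where
  smul_assoc r h x :=
    congrArg (fun φ : Module.End R M => φ x) (map_smul (HeckeAlgebra.lift a ha) r h)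

end HeckeModule

/-- `M` has a central character: the centre of the `R`-algebra `A` acts on `M` through a character
`ω` with values in `R`. -/
def HasCentralCharacter (R A M : Type*) [CommRing R] [Ring A] [Algebra R A] [AddCommGroup M]
    [Module A M] : Prop :=
  ∃ ω : Subalgebra.center R A →ₐ[R] R,
    ∀ (c : Subalgebra.center R A) (m : M), (c : A) • m = algebraMap R A (ω c) • m

/-! ### Extension of scalars -/

section BaseChange

variable (R' : Type*) {R : Type*} [CommRing R] [CommRing R'] [Algebra R R']

/-- The operators `1 ⊗ a g` on `R' ⊗[R] M`. -/
def baseChangeOps {M : Type*} [AddCommGroup M] [Module R M] (a : HeckeGen → Module.End R M)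
    (g : HeckeGen) : Module.End R' (R' ⊗[R] M) :=
  LinearMap.baseChange R' (a g)

theorem baseChangeOps_relations {M : Type*} [AddCommGroup M] [Module R M]
    {a : HeckeGen → Module.End R M} (n : ℕ)
    (ha : HeckeRelations (algebraMap R (Module.End R M) n) a) :
    HeckeRelations (algebraMap R' (Module.End R' (R' ⊗[R] M)) n) (baseChangeOps R' a) := by
  have h := HeckeRelations.map (B := Module.End R' (R' ⊗[R] M))
    (Module.End.baseChangeHom R R' M).toRingHom ha
  simp only [map_natCast] at h ⊢
  exact h

/-- The operators by which the generators of `H_R` act on an `H_R`-module. -/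
def actionOps {q : R} (M : Type*) [AddCommGroup M] [Module R M] [Module (HeckeAlgebra R q) M]
    [IsScalarTower R (HeckeAlgebra R q) M] (g : HeckeGen) : Module.End R M :=
  Algebra.lsmul R R M (HeckeAlgebra.gen R q g)

theorem actionOps_relations {q : R} (M : Type*) [AddCommGroup M] [Module R M]
    [Module (HeckeAlgebra R q) M] [IsScalarTower R (HeckeAlgebra R q) M] :
    HeckeRelations (algebraMap R (Module.End R M) q) (actionOps (q := q) M) := by
  have h := (HeckeAlgebra.gen_relations (R := R) (q := q)).map
    (Algebra.lsmul R R M : HeckeAlgebra R q →ₐ[R] Module.End R M).toRingHom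
  simp only [AlgHom.toRingHom_eq_coe, RingHom.coe_coe, AlgHom.commutes] at h
  exact h

/-- For an integer parameter `n`: the `H_{R'}`-module `R' ⊗[R] M` deduced from an `H_R`-module `M`
by extension of scalars. -/
abbrev HeckeBaseChange (R R' : Type*) [CommRing R] [CommRing R'] [Algebra R R'] (n : ℕ) (M : Type*) [AddCommGroup M] [Module R M]
    [Module (HeckeAlgebra R (n : R)) M] [IsScalarTower R (HeckeAlgebra R (n : R)) M] : Type _ :=
  HeckeModule (q := (n : R')) (baseChangeOps R' (actionOps (q := (n : R)) M))
    (baseChangeOps_relations R' n (actionOps_relations (q := (n : R)) M))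

end BaseChange

/-! ### Coefficients, integral structures and reduction modulo `p` -/

section Integral

variable (p : ℕ) [Fact p.Prime]

/-- An algebraic closure of `𝔽_p`. -/
abbrev Fbar : Type := AlgebraicClosure (ZMod p)

/-- An algebraic closure of `ℚ_p`. -/
abbrev Qbar : Type := AlgebraicClosure ℚ_[p]

/-- The ring of integers of the algebraic closure of `ℚ_p`. -/
abbrev Zbar : Type := integralClosure ℤ_[p] (Qbar p)

/-- Reduction maps exist. Every ring homomorphism between these two rings is a reduction modulo `p`:
its kernel contains `p`, so it is the maximal ideal. -/
theorem reduction_exists : Nonempty (Zbar p →+* Fbar p) := by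
  have hinj : Function.Injective (algebraMap ℤ_[p] (Zbar p)) := by
    have : Function.Injective (algebraMap ℤ_[p] (Qbar p)) := by
      rw [IsScalarTower.algebraMap_eq ℤ_[p] ℚ_[p] (Qbar p)]
      exact (algebraMap ℚ_[p] (Qbar p)).injective.comp (IsFractionRing.injective ℤ_[p] ℚ_[p])
    intro a b h
    exact this (congrArg (Subtype.val) h)
  obtain ⟨P, hP, hlie⟩ := Ideal.exists_ideal_over_maximal_of_isIntegral (S := Zbar p)
    (IsLocalRing.maximalIdeal ℤ_[p]) (by
      rw [(RingHom.injective_iff_ker_eq_bot _).1 hinj]; exact bot_le)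
  let _ : Field (Zbar p ⧸ P) := Ideal.Quotient.field P
  have : P.LiesOver (IsLocalRing.maximalIdeal ℤ_[p]) := ⟨hlie.symm⟩
  let e : (ℤ_[p] ⧸ IsLocalRing.maximalIdeal ℤ_[p]) →+* Fbar p :=
    (algebraMap (ZMod p) (Fbar p)).comp (PadicInt.residueField (p := p)).toRingHom
  let _ : Field (ℤ_[p] ⧸ IsLocalRing.maximalIdeal ℤ_[p]) := Ideal.Quotient.field _
  let _ : Algebra (ℤ_[p] ⧸ IsLocalRing.maximalIdeal ℤ_[p]) (Fbar p) := e.toAlgebra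
  have : Algebra.IsIntegral (ℤ_[p] ⧸ IsLocalRing.maximalIdeal ℤ_[p]) (Zbar p ⧸ P) := inferInstance
  have : Algebra.IsAlgebraic (ℤ_[p] ⧸ IsLocalRing.maximalIdeal ℤ_[p]) (Zbar p ⧸ P) := inferInstance
  exact ⟨(IsAlgClosed.lift (R := ℤ_[p] ⧸ IsLocalRing.maximalIdeal ℤ_[p]) (S := Zbar p ⧸ P)
    (M := Fbar p)).toRingHom.comp (Ideal.Quotient.mk P)⟩

variable {p}

/-- The ring of integers of an extension `E` of `ℚ_p` contained in the algebraic closure. -/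
abbrev OInt (E : IntermediateField ℚ_[p] (Qbar p)) : Type := integralClosure ℤ_[p] E

/-- Given a reduction map `r` on the integers of the algebraic closure of `ℚ_p`, its restriction to
the ring of integers of `E`. -/
def reductionOn (r : Zbar p →+* Fbar p) (E : IntermediateField ℚ_[p] (Qbar p)) :
    OInt E →+* Fbar p :=
  r.comp ((E.val.restrictScalars ℤ_[p]).mapIntegralClosure : OInt E →+* Zbar p)

end Integral

/-- An integral structure, over a subring `O` of a field `E`, of a module `M` over `H_E`: a free
`O`-submodule of `M` that is stable under `H` and contains an `E`-basis of `M`. -/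
structure IntegralStructure (O E : Type*) [CommRing O] [Field E] [Algebra O E] (q : ℕ) (M : Type*)
    [AddCommGroup M] [Module O M] [Module E M] [IsScalarTower O E M]
    [Module (HeckeAlgebra E (q : E)) M] [IsScalarTower E (HeckeAlgebra E (q : E)) M] where
  lattice : Submodule O M
  free : Module.Free O lattice
  stable : ∀ (g : HeckeGen), ∀ x ∈ lattice, HeckeAlgebra.gen E (q : E) g • x ∈ lattice
  span_eq_top : Submodule.span E (lattice : Set M) = ⊤

namespace IntegralStructure

variable {O E : Type*} [CommRing O] [Field E] [Algebra O E] {q : ℕ} {M : Type*}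
    [AddCommGroup M] [Module O M] [Module E M] [IsScalarTower O E M]
    [Module (HeckeAlgebra E (q : E)) M] [IsScalarTower E (HeckeAlgebra E (q : E)) M]
    (L : IntegralStructure O E q M)

/-- The action of the generators on the lattice. -/
def ops (g : HeckeGen) : Module.End O L.lattice :=
  ((actionOps (q := (q : E)) M g).restrictScalars O).restrict (L.stable g)

theorem coe_ops (g : HeckeGen) (x : L.lattice) :
    ((L.ops g x : L.lattice) : M) = actionOps (q := (q : E)) M g x := rfl

theorem ops_relations :
    HeckeRelations (algebraMap O (Module.End O L.lattice) q) L.ops := by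
  have h := actionOps_relations (q := (q : E)) M
  have e (φ ψ : Module.End E M) (hφ : φ = ψ) (x : L.lattice) : φ (x : M) = ψ x := by rw [hφ]
  constructor
  · ext x; simpa [coe_ops] using e _ _ h.T_mul_Tinv x
  · ext x; simpa [coe_ops] using e _ _ h.Tinv_mul_T x
  · ext x; simpa [coe_ops] using e _ _ h.quadratic x
  · ext x; simpa [coe_ops, pow_succ] using e _ _ h.cube_comm x
  · ext x; simpa [coe_ops] using e _ _ h.braid x
  · ext x; simpa [coe_ops] using e _ _ h.conj x

/-- The lattice as an `H_O`-module. -/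
abbrev asModule : Type _ := HeckeModule (q := (q : O)) L.ops L.ops_relations

end IntegralStructure

section Reduction

variable {p : ℕ} [Fact p.Prime]

/-- `V` is the reduction modulo `p` of an integral simple module over the Hecke algebra with
coefficients in the algebraic closure of `ℚ_p`: there are a finite extension `E` of `ℚ_p`, a
finite-dimensional `H_E`-module `M` that becomes simple over the algebraic closure of `ℚ_p`, and an
integral structure `L` of `M`, such that `V` is isomorphic to `𝔽̄_p ⊗ L`, the tensor product being
taken over `O_E` along the reduction map. -/
def IsReductionOfIntegralSimple (q : ℕ) (r : Zbar p →+* Fbar p) (V : Type*) [AddCommGroup V]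
    [Module (HeckeAlgebra (Fbar p) (q : Fbar p)) V] : Prop :=
  ∃ (E : IntermediateField ℚ_[p] (Qbar p)) (_ : FiniteDimensional ℚ_[p] E)
    (M : Type) (_ : AddCommGroup M) (_ : Module E M) (_ : Module (HeckeAlgebra E (q : E)) M)
    (_ : IsScalarTower E (HeckeAlgebra E (q : E)) M) (_ : FiniteDimensional E M)
    (L : IntegralStructure (OInt E) E q M),
    IsSimpleModule (HeckeAlgebra (Qbar p) (q : Qbar p)) (HeckeBaseChange E (Qbar p) q M) ∧
    letI : Algebra (OInt E) (Fbar p) := (reductionOn r E).toAlgebra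
    Nonempty (V ≃ₗ[HeckeAlgebra (Fbar p) (q : Fbar p)]
      HeckeBaseChange (OInt E) (Fbar p) q L.asModule)

end Reduction

/-! ### The explicit list of modules in characteristic `p` -/

section List

variable {k : Type*} [Field k]

/-- A module of finite dimension `n` given by the matrices of `S₁` and `T` when `q = 0` in `k` and
`T³` acts by a nonzero scalar `z`, so that `T⁻¹ = z⁻¹ T²` and `S₂ = z⁻¹ T² S₁ T`. -/
structure HeckeMatrices (k : Type*) [Field k] where
  n : ℕ
  z : kˣ
  S : Matrix (Fin n) (Fin n) k
  T : Matrix (Fin n) (Fin n) k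
  cube : T * T * T = (z : k) • 1
  quadratic : S * S = -S
  braid : (z : k) • (S * (T * T * S * T) * S) = (T * T * S * T) * S * (T * T * S * T)

namespace HeckeMatrices

/-- The matrices of the four generators. -/
def mat (X : HeckeMatrices k) : HeckeGen → Matrix (Fin X.n) (Fin X.n) k
  | .S1 => X.S
  | .S2 => (X.z : k)⁻¹ • (X.T * X.T * X.S * X.T)
  | .T => X.T
  | .Tinv => (X.z : k)⁻¹ • (X.T * X.T)

theorem mat_relations (X : HeckeMatrices k) :
    HeckeRelations (0 : Matrix (Fin X.n) (Fin X.n) k) X.mat where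
  T_mul_Tinv := by simp [mat, ← mul_assoc, X.cube]
  Tinv_mul_T := by simp [mat, X.cube]
  quadratic := by simp [mat, add_mul, X.quadratic]
  cube_comm := by simp [mat, pow_succ, X.cube]
  braid := by
    simp only [mat, Matrix.mul_smul, Matrix.smul_mul, ← X.braid, smul_smul]
    simp
  conj := by
    simp only [mat, Matrix.mul_smul, ← mul_assoc, X.cube]
    simp

/-- The operators of the four generators on the column space `k ^ n`. -/
def ops (X : HeckeMatrices k) (g : HeckeGen) : Module.End k (Fin X.n → k) :=
  Matrix.toLinAlgEquiv' (X.mat g)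

theorem ops_relations (X : HeckeMatrices k) {q : k} (hq : q = 0) :
    HeckeRelations (algebraMap k (Module.End k (Fin X.n → k)) q) X.ops := by
  have h := HeckeRelations.map (B := Module.End k (Fin X.n → k))
    (Matrix.toLinAlgEquiv' (R := k) (n := Fin X.n)).toAlgHom.toRingHom X.mat_relations
  rw [map_zero] at h
  rw [hq, map_zero]
  exact h

/-- The module over `H_k`, where `q = 0` in `k`. -/
abbrev module (X : HeckeMatrices k) {q : k} (hq : q = 0) : Type _ :=
  HeckeModule X.ops (X.ops_relations hq)

/-- `T` in the basis `(v, Tv, T²v)`, with `T³v = zv`. -/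
def cyc3 (z : kˣ) : Matrix (Fin 3) (Fin 3) k :=
  !![0, 0, (z : k);
     1, 0, 0;
     0, 1, 0]

/-- `T` in the basis `(v, Tv, T²v, w, Tw, T²w)`, with `T³v = zv` and `T³w = zw`. -/
def cyc6 (z : kˣ) : Matrix (Fin 6) (Fin 6) k :=
  !![0, 0, (z : k), 0, 0, 0;
     1, 0, 0, 0, 0, 0;
     0, 1, 0, 0, 0, 0;
     0, 0, 0, 0, 0, (z : k);
     0, 0, 0, 1, 0, 0;
     0, 0, 0, 0, 1, 0]

/-- `T` in the basis `(w, Tw)`, with `T²w = -y²w - yTw`. -/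
def cyc2 (y : kˣ) : Matrix (Fin 2) (Fin 2) k :=
  !![0, -(y : k) ^ 2;
     1, -(y : k)]

theorem cyc3_cube (z : kˣ) : cyc3 z * cyc3 z * cyc3 z = (z : k) • 1 := by
  simp [cyc3, Matrix.vecMul_cons]
  ext a b; fin_cases a <;> fin_cases b <;> simp

theorem cyc6_cube (z : kˣ) : cyc6 z * cyc6 z * cyc6 z = (z : k) • 1 := by
  simp [cyc6, Matrix.vecMul_cons]
  ext a b; fin_cases a <;> fin_cases b <;> simp

theorem cyc2_cube (y : kˣ) : cyc2 y * cyc2 y * cyc2 y = ((y ^ 3 : kˣ) : k) • 1 := by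
  ext a b; fin_cases a <;> fin_cases b <;>
    simp [cyc2, Matrix.mul_apply, Fin.sum_univ_succ] <;> ring

/-- The character `T ↦ y`, `S₁ ↦ 0`. -/
def M1zero (y : kˣ) : HeckeMatrices k where
  n := 1
  z := y ^ 3
  S := 0
  T := (y : k) • 1
  cube := by simp [smul_smul, pow_succ, mul_assoc]
  quadratic := by simp
  braid := by simp

/-- The character `T ↦ y`, `S₁ ↦ -1`. -/
def M1neg (y : kˣ) : HeckeMatrices k where
  n := 1
  z := y ^ 3
  S := -1
  T := (y : k) • 1
  cube := by simp [smul_smul, pow_succ, mul_assoc]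
  quadratic := by simp
  braid := by simp [smul_smul, pow_succ, mul_assoc]

/-- Basis `(w, Tw)`: `S₁w = -w`, `S₁Tw = 0`, `T²w = -y²w - yTw`. -/
def M2 (y : kˣ) : HeckeMatrices k where
  n := 2
  z := y ^ 3
  S := !![-1, 0;
          0, 0]
  T := cyc2 y
  cube := cyc2_cube y
  quadratic := by
    simp [Matrix.vecMul_cons]
    ext i; fin_cases i <;> rfl
  braid := by
    simp [cyc2, Matrix.vecMul_cons]

/-- Basis `(w, Tw)`: `S₁w = 0`, `S₁Tw = -Tw`, `T²w = -y²w - yTw`. -/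
def M2t (y : kˣ) : HeckeMatrices k where
  n := 2
  z := y ^ 3
  S := !![0, 0;
          0, -1]
  T := cyc2 y
  cube := cyc2_cube y
  quadratic := by
    ext a b; fin_cases a <;> fin_cases b <;> simp [Matrix.mul_apply, Fin.sum_univ_succ]
  braid := by
    ext a b; fin_cases a <;> fin_cases b <;>
      simp [cyc2, Matrix.mul_apply, Fin.sum_univ_succ, pow_succ, mul_assoc]

/-- The matrix of `S₁v = a w`, `S₁Tv = b T²w`, `S₁T²v = -T²v`, `S₁w = -w`, `S₁Tw = c T²v`,
`S₁T²w = -T²w`. -/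
def S6 (a b c : k) : Matrix (Fin 6) (Fin 6) k :=
  !![0, 0, 0, 0, 0, 0;
     0, 0, 0, 0, 0, 0;
     0, 0, -1, 0, c, 0;
     a, 0, 0, -1, 0, 0;
     0, 0, 0, 0, 0, 0;
     0, b, 0, 0, 0, -1]

theorem S6_quadratic (a b c : k) : S6 a b c * S6 a b c = -S6 a b c := by
  simp [S6, Matrix.vecMul_cons]
  ext i; fin_cases i <;> rfl

theorem S6_braid (z : kˣ) (a b c : k) :
    (z : k) • (S6 a b c * (cyc6 z * cyc6 z * S6 a b c * cyc6 z) * S6 a b c) =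
      (cyc6 z * cyc6 z * S6 a b c * cyc6 z) * S6 a b c *
        (cyc6 z * cyc6 z * S6 a b c * cyc6 z) := by
  simp [S6, cyc6, Matrix.vecMul_cons, mul_comm, mul_left_comm]

/-- `S₁v = w`, `S₁Tv = (y/y') T²w`, `S₁T²v = -T²v`, `S₁w = -w`, `S₁Tw = (y'/z) T²v`,
`S₁T²w = -T²w`. -/
def K6 (z y y' : kˣ) : HeckeMatrices k where
  n := 6
  z := z
  S := S6 1 ((y : k) / y') ((y' : k) / z)
  T := cyc6 z
  cube := cyc6_cube z
  quadratic := S6_quadratic _ _ _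
  braid := S6_braid z _ _ _

/-- `S₁v = 0`, `S₁Tv = y⁻¹T²v`, `S₁T²v = -T²v`. -/
def M3 (z y : kˣ) : HeckeMatrices k where
  n := 3
  z := z
  S := !![0, 0, 0;
          0, 0, 0;
          0, (y : k)⁻¹, -1]
  T := cyc3 z
  cube := cyc3_cube z
  quadratic := by
    simp [Matrix.vecMul_cons]
    ext i; fin_cases i <;> rfl
  braid := by
    simp [cyc3, Matrix.vecMul_cons]

/-- `S₁v = -v`, `S₁Tv = -y⁻¹T²v`, `S₁T²v = -T²v`. -/
def M3t (z y : kˣ) : HeckeMatrices k where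
  n := 3
  z := z
  S := !![-1, 0, 0;
          0, 0, 0;
          0, -(y : k)⁻¹, -1]
  T := cyc3 z
  cube := cyc3_cube z
  quadratic := by
    simp [Matrix.vecMul_cons]
    ext i; fin_cases i <;> rfl
  braid := by
    simp [cyc3, Matrix.vecMul_cons]
    constructor <;> ring

/-- `S₁v = -v`, `S₁Tv = 0`, `S₁T²v = -yTv - T²v`. -/
def N3 (z y : kˣ) : HeckeMatrices k where
  n := 3
  z := z
  S := !![-1, 0, 0;
          0, 0, -(y : k);
          0, 0, -1]
  T := cyc3 z
  cube := cyc3_cube z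
  quadratic := by
    simp [Matrix.vecMul_cons]
  braid := by
    simp [cyc3, Matrix.vecMul_cons]
    constructor <;> ring

/-- `S₁v = 0`, `S₁Tv = 0`, `S₁T²v = yTv - T²v`. -/
def N3t (z y : kˣ) : HeckeMatrices k where
  n := 3
  z := z
  S := !![0, 0, 0;
          0, 0, (y : k);
          0, 0, -1]
  T := cyc3 z
  cube := cyc3_cube z
  quadratic := by
    simp [Matrix.vecMul_cons]
    ext i; fin_cases i <;> rfl
  braid := by
    simp [cyc3, Matrix.vecMul_cons]

/-- `S₁v = 0`, `S₁Tv = T²w`, `S₁T²v = -T²v`, `S₁w = -w`, `S₁Tw = (y/z) T²v`, `S₁T²w = -T²w`. -/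
def L6 (z y : kˣ) : HeckeMatrices k where
  n := 6
  z := z
  S := S6 0 1 ((y : k) / z)
  T := cyc6 z
  cube := cyc6_cube z
  quadratic := S6_quadratic _ _ _
  braid := S6_braid z _ _ _

/-- `S₁v = w`, `S₁Tv = 0`, `S₁T²v = -T²v`, `S₁w = -w`, `S₁Tw = (y/z) T²v`, `S₁T²w = -T²w`. -/
def L6t (z y : kˣ) : HeckeMatrices k where
  n := 6
  z := z
  S := S6 1 0 ((y : k) / z)
  T := cyc6 z
  cube := cyc6_cube z
  quadratic := S6_quadratic _ _ _
  braid := S6_braid z _ _ _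

/-- `S₁v = 0`, `S₁Tv = 0`, `S₁T²v = -T²v`. -/
def P3 (z : kˣ) : HeckeMatrices k where
  n := 3
  z := z
  S := !![0, 0, 0;
          0, 0, 0;
          0, 0, -1]
  T := cyc3 z
  cube := cyc3_cube z
  quadratic := by
    simp [Matrix.vecMul_cons]
    ext i; fin_cases i <;> rfl
  braid := by
    simp [cyc3, Matrix.vecMul_cons]

/-- `S₁v = -v`, `S₁Tv = 0`, `S₁T²v = -T²v`. -/
def P3t (z : kˣ) : HeckeMatrices k where
  n := 3
  z := z
  S := !![-1, 0, 0;
          0, 0, 0;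
          0, 0, -1]
  T := cyc3 z
  cube := cyc3_cube z
  quadratic := by
    simp [Matrix.vecMul_cons]
    ext i; fin_cases i <;> rfl
  braid := by
    simp [cyc3, Matrix.vecMul_cons]

end HeckeMatrices

variable (k) in
/-- The entries of the list: a name and admissible nonzero parameters. A final `t` stands for a
tilde; `M1zero y` is `M_1(0, y)` and `M1neg y` is `M_1(-1, y)`. -/
inductive HeckeList : Type _
  | M1zero (y : kˣ)
  | M1neg (y : kˣ)
  | M2 (y : kˣ)
  | M2t (y : kˣ)
  | K6 (z y y' : kˣ) (h : (y : k) ^ 2 ≠ y') (h' : (y' : k) ^ 2 ≠ z * y)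
  | M3 (z y : kˣ) (h : (y : k) ^ 3 ≠ z)
  | M3t (z y : kˣ) (h : (y : k) ^ 3 ≠ z)
  | N3 (z y : kˣ) (h : (y : k) ^ 3 ≠ z)
  | N3t (z y : kˣ) (h : (y : k) ^ 3 ≠ z)
  | L6 (z y : kˣ)
  | L6t (z y : kˣ)
  | P3 (z : kˣ)
  | P3t (z : kˣ)

namespace HeckeList

/-- The matrices of an entry of the list. -/
def matrices : HeckeList k → HeckeMatrices k
  | M1zero y => HeckeMatrices.M1zero y
  | M1neg y => HeckeMatrices.M1neg y
  | M2 y => HeckeMatrices.M2 y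
  | M2t y => HeckeMatrices.M2t y
  | K6 z y y' _ _ => HeckeMatrices.K6 z y y'
  | M3 z y _ => HeckeMatrices.M3 z y
  | M3t z y _ => HeckeMatrices.M3t z y
  | N3 z y _ => HeckeMatrices.N3 z y
  | N3t z y _ => HeckeMatrices.N3t z y
  | L6 z y => HeckeMatrices.L6 z y
  | L6t z y => HeckeMatrices.L6t z y
  | P3 z => HeckeMatrices.P3 z
  | P3t z => HeckeMatrices.P3t z

/-- The module of an entry of the list, over `H_k` where `q = 0` in `k`. -/
abbrev module (i : HeckeList k) {q : k} (hq : q = 0) : Type _ := i.matrices.module hq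

end HeckeList

end List

/-- `q = p ^ f` with `f ≠ 0` vanishes in the algebraic closure of `𝔽_p`. -/
theorem Fbar.natCast_prime_pow (p f : ℕ) [Fact p.Prime] (hf : f ≠ 0) :
    ((p ^ f : ℕ) : Fbar p) = 0 := by
  have : CharP (Fbar p) p := inferInstance
  simp [hf]

end

/-! At `q = 0` the elements `s = -S₁` and `1 - s = 1 + S₁` are idempotents. With `r = T⁻¹ s T`, the
braid relation makes `e = s r s` an idempotent whose image is the space of vectors fixed by `s` and
`r`. Let `V` be simple with `e V ≠ 0`. The operators `T³`, `T⁻³` and two further elements preserve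
`e V` and commute there (`sph_comm`). They leave no proper nonzero subspace invariant, because an
invariant subspace generates `V` through an explicit spanning set that `e` sends back into it. By
the Nullstellensatz they act on `e V` by scalars, recorded as `z`, `a`, `b` (`exists_isSph`). These
scalars describe the action of the whole corner `e A e`, hence determine `V` up to isomorphism
(`IsSph.nonempty_linearEquiv`), and `V` determines them (`scalars_unique`). The same holds with `1 -
s` in place of `s`. If both corner idempotents kill `V`, some nonzero vector is fixed by one of `s`,
`r` and killed by the other, and it generates a two-dimensional module with a single parameter
(`exists_isTwo`). Thus a simple module is known from one element of `HeckeInv`.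

It remains to match these invariants with the list. The matrices `S6` realise `(z, a, b)` with the
same scalars for `s` and for `1 - s`, and give simple modules when `(a, b) ≠ (0, 0)` lies off the
two curves `b = a²` and `b² = z a`. On the first curve the modules N take over, on the second the
modules M, at their common points with `a³ = z` the characters, and at `(0, 0)` the modules P. For
non-isomorphism each entry is recorded by a preferred invariant, and the preferred invariants are
distinct.

For reductions, the matrices of every entry are lifted to matrices over the integers of `Qbar p`
that satisfy the relations with parameter `q`. The entries lie in a finite extension, and the
generic module is simple because an integral family with irreducible reduction is irreducible
(`Zbar.eq_top_of_reduction`). -/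

noncomputable section

/-! ### Generators of the algebra at `q = 0` by an idempotent and an invertible element -/

/-- The `k`-algebra `A` is generated by an idempotent `s`, and mutually inverse elements `t`, `u`,
such that `t ^ 3` is central and `s` satisfies a braid relation with its conjugate `u * s * t`. -/
structure IsZeroHecke (k : Type*) {A : Type*} [Field k] [Ring A] [Algebra k A] (s t u : A) :
    Prop where
  mul_inv : t * u = 1
  inv_mul : u * t = 1
  idem : s * s = s
  cube : t ^ 3 * s = s * t ^ 3
  braid : s * (u * s * t) * s = (u * s * t) * s * (u * s * t)
  gen : Algebra.adjoin k {s, t, u} = ⊤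

namespace IsZeroHecke

set_option linter.unusedSectionVars false

variable {k A V : Type*} [Field k] [Ring A] [Algebra k A] [AddCommGroup V] [Module k V]
  [Module A V] [IsScalarTower k A V] {s t u : A}

/-- For idempotents `s` and `r = u * s * t`, replacing both by their complements only changes the
sign of `s r s - r s r`. This symmetry lets every argument about `s` be reused for `1 - s`. -/
theorem compl (h : IsZeroHecke k s t u) : IsZeroHecke k (1 - s) t u where
  mul_inv := h.mul_inv
  inv_mul := h.inv_mul
  idem := by simp [sub_mul, mul_sub, h.idem]
  cube := by simp [sub_mul, mul_sub, h.cube]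
  braid := by
    have e : u * (1 - s) * t = 1 - u * s * t := by
      rw [mul_sub, sub_mul, mul_one, h.inv_mul]
    have e' : (u * s * t) * (u * s * t) = u * s * t := by
      calc (u * s * t) * (u * s * t) = u * s * (t * u) * s * t := by simp only [mul_assoc]
        _ = u * (s * s) * t := by rw [h.mul_inv]; simp only [mul_assoc, mul_one]
        _ = _ := by rw [h.idem]
    rw [e]
    have hb := h.braid
    generalize u * s * t = r at *
    have : (1 - s) * (1 - r) * (1 - s) - (1 - r) * (1 - s) * (1 - r)
        = (s * s - s) - (r * r - r) - (s * r * s - r * s * r) := by noncomm_ring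
    rw [h.idem, e', hb] at this
    simpa [sub_eq_zero] using this
  gen := by
    refine le_antisymm le_top ?_
    rw [← h.gen]
    refine Algebra.adjoin_le ?_
    rintro x (rfl | rfl | rfl)
    · have : x = 1 - (1 - x) := by simp
      rw [this]
      exact sub_mem (one_mem _) (Algebra.subset_adjoin (by simp))
    · exact Algebra.subset_adjoin (by simp)
    · exact Algebra.subset_adjoin (by simp)

section Rules

variable (h : IsZeroHecke k s t u) (x : V)
include h

theorem tu : t • u • x = x := by rw [← mul_smul, h.mul_inv, one_smul]

theorem ut : u • t • x = x := by rw [← mul_smul, h.inv_mul, one_smul]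

theorem ss : s • s • x = s • x := by rw [← mul_smul, h.idem]

theorem st3 : s • t • t • t • x = t • t • t • s • x := by
  have := congrArg (· • x) h.cube
  simpa only [pow_succ, pow_zero, one_mul, mul_smul] using this.symm

theorem su3 : s • u • u • u • x = u • u • u • s • x := by
  have := h.st3 (u • u • u • x)
  simp only [h.tu] at this
  rw [this]
  simp only [h.ut]

theorem brd : s • u • s • t • s • x = u • s • t • s • u • s • t • x := by
  have := congrArg (· • x) h.braid
  simpa only [mul_smul] using this

theorem mem_of_stable (N : Submodule k V) (hs : ∀ x ∈ N, s • x ∈ N) (ht : ∀ x ∈ N, t • x ∈ N)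
    (hu : ∀ x ∈ N, u • x ∈ N) (a : A) : ∀ x ∈ N, a • x ∈ N := by
  have ha : a ∈ Algebra.adjoin k {s, t, u} := by rw [h.gen]; trivial
  induction ha using Algebra.adjoin_induction with
  | mem x hx =>
    rcases hx with rfl | rfl | rfl
    · exact hs
    · exact ht
    · exact hu
  | algebraMap r => intro x hx; rw [algebraMap_smul]; exact N.smul_mem r hx
  | add a b _ _ ha hb => intro x hx; rw [add_smul]; exact N.add_mem (ha x hx) (hb x hx)
  | mul a b _ _ ha hb => intro x hx; rw [mul_smul]; exact ha _ (hb x hx)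

theorem eq_top_of_stable [IsSimpleModule A V] (N : Submodule k V) (hs : ∀ x ∈ N, s • x ∈ N)
    (ht : ∀ x ∈ N, t • x ∈ N) (hu : ∀ x ∈ N, u • x ∈ N) {x : V} (hx : x ∈ N) (hx0 : x ≠ 0) :
    N = ⊤ := by
  let N' : Submodule A V :=
    { N with smul_mem' := fun a y hy => h.mem_of_stable N hs ht hu a y hy }
  have : N' = ⊤ := by
    rcases eq_bot_or_eq_top N' with hN | hN
    · exact absurd ((Submodule.mem_bot A).1 (hN ▸ (show x ∈ N' from hx))) hx0
    · exact hN
  refine eq_top_iff.2 fun y _ => ?_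
  have hy : y ∈ N' := this ▸ Submodule.mem_top
  exact hy

theorem mem_span_of_stable {S : Set V} (hs : ∀ x ∈ S, s • x ∈ Submodule.span k S)
    (ht : ∀ x ∈ S, t • x ∈ Submodule.span k S) (hu : ∀ x ∈ S, u • x ∈ Submodule.span k S) (a : A) :
    ∀ x ∈ Submodule.span k S, a • x ∈ Submodule.span k S := by
  have key (b : A) (hb : ∀ x ∈ S, b • x ∈ Submodule.span k S) :
      ∀ x ∈ Submodule.span k S, b • x ∈ Submodule.span k S := fun y hy =>
    (Submodule.map_span_le (Algebra.lsmul k k V b) S _).2 hb (Submodule.mem_map_of_mem hy)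
  exact h.mem_of_stable _ (key s hs) (key t ht) (key u hu) a

theorem span_eq_top [IsSimpleModule A V] {S : Set V} (hs : ∀ x ∈ S, s • x ∈ Submodule.span k S)
    (ht : ∀ x ∈ S, t • x ∈ Submodule.span k S) (hu : ∀ x ∈ S, u • x ∈ Submodule.span k S) {x : V}
    (hx : x ∈ S) (hx0 : x ≠ 0) : Submodule.span k S = ⊤ :=
  h.eq_top_of_stable _ (h.mem_span_of_stable hs ht hu s) (h.mem_span_of_stable hs ht hu t)
    (h.mem_span_of_stable hs ht hu u) (Submodule.subset_span hx) hx0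

end Rules

end IsZeroHecke

/-- Two simple modules with vectors on which a corner `e A e` acts by the same scalars. -/
theorem nonempty_linearEquiv_of_corner {k A V V' : Type*} [Field k] [Ring A] [Algebra k A]
    [AddCommGroup V] [Module k V] [Module A V] [IsScalarTower k A V]
    [AddCommGroup V'] [Module k V'] [Module A V'] [IsScalarTower k A V']
    [IsSimpleModule A V] [IsSimpleModule A V'] (e : A) {v : V} {v' : V'} (hv : v ≠ 0)
    (hv' : v' ≠ 0) (he : e • v = v) (he' : e • v' = v')
    (hc : ∀ a : A, ∃ c : k, e • a • v = c • v ∧ e • a • v' = c • v') :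
    Nonempty (V ≃ₗ[A] V') := by
  -- `N` is going to be the graph of the isomorphism. Since `e N` lies on the line of `(v, v')`, `N`
  -- contains neither `(0, v')` nor `(v, 0)`, so by simplicity both projections are injective on
  -- `N`.
  let N : Submodule A (V × V') := Submodule.span A {(v, v')}
  have hvN : (v, v') ∈ N := Submodule.mem_span_singleton_self _
  have key {x : V × V'} (hx : x ∈ N) : ∃ c : k, e • x.1 = c • v ∧ e • x.2 = c • v' := by
    obtain ⟨a, rfl⟩ := Submodule.mem_span_singleton.1 hx
    exact hc a
  let f : N →ₗ[A] V := (LinearMap.fst A V V').comp N.subtype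
  let g : N →ₗ[A] V' := (LinearMap.snd A V V').comp N.subtype
  have hf : Function.Bijective f := by
    constructor
    · refine (injective_iff_map_eq_zero f).2 ?_
      rintro ⟨⟨x, y⟩, hxy⟩ (hx : x = 0)
      subst hx
      let K : Submodule A V' := N.comap (LinearMap.inr A V V')
      rcases eq_bot_or_eq_top K with hK | hK
      · have : y ∈ K := hxy
        rw [hK, Submodule.mem_bot] at this
        subst this; rfl
      · have : v' ∈ K := hK ▸ Submodule.mem_top
        obtain ⟨c, h1, h2⟩ := key (x := (0, v')) this
        simp only [smul_zero] at h1
        rcases smul_eq_zero.1 h1.symm with rfl | h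
        · exact absurd (by simpa [he'] using h2) hv'
        · exact absurd h hv
    · refine (LinearMap.surjective_of_ne_zero ?_)
      intro h0
      exact hv (congrArg (fun φ : N →ₗ[A] V => φ ⟨_, hvN⟩) h0)
  have hg : Function.Bijective g := by
    constructor
    · refine (injective_iff_map_eq_zero g).2 ?_
      rintro ⟨⟨x, y⟩, hxy⟩ (hx : y = 0)
      subst hx
      let K : Submodule A V := N.comap (LinearMap.inl A V V')
      rcases eq_bot_or_eq_top K with hK | hK
      · have : x ∈ K := hxy
        rw [hK, Submodule.mem_bot] at this
        subst this; rfl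
      · have : v ∈ K := hK ▸ Submodule.mem_top
        obtain ⟨c, h1, h2⟩ := key (x := (v, 0)) this
        simp only [smul_zero] at h2
        rcases smul_eq_zero.1 h2.symm with rfl | h
        · exact absurd (by simpa [he] using h1) hv
        · exact absurd h hv'
    · refine (LinearMap.surjective_of_ne_zero ?_)
      intro h0
      exact hv' (congrArg (fun φ : N →ₗ[A] V' => φ ⟨_, hvN⟩) h0)
  exact ⟨(LinearEquiv.ofBijective f hf).symm.trans (LinearEquiv.ofBijective g hg)⟩

/-! ### Common eigenvectors -/

/-- A finite family of commuting operators that leaves no proper nonzero subspace invariant acts by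
scalars, over an algebraically closed field. -/
theorem exists_scalars_of_commute {k W ι : Type*} [Field k] [IsAlgClosed k] [AddCommGroup W]
    [Module k W] [Nontrivial W] [Finite ι] (f : ι → Module.End k W)
    (hf : ∀ i j, f i * f j = f j * f i)
    (hs : ∀ N : Submodule k W, (∀ i, ∀ x ∈ N, f i x ∈ N) → N = ⊥ ∨ N = ⊤) :
    ∃ c : ι → k, ∀ i x, f i x = c i • x := by
  classical
  have : IsMulCommutative (Algebra.adjoin k (Set.range f)) := by
    apply Algebra.isMulCommutative_adjoin
    rintro _ ⟨i, rfl⟩ _ ⟨j, rfl⟩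
    exact hf i j
  let _ : CommRing (Algebra.adjoin k (Set.range f)) :=
    { (inferInstance : Ring (Algebra.adjoin k (Set.range f))) with
      mul_comm := this.is_comm.comm }
  -- One variable per operator: the assumption on invariant subspaces says that `W` is a simple
  -- module over the polynomial ring.
  let φ : MvPolynomial ι k →ₐ[k] Module.End k W := (Algebra.adjoin k (Set.range f)).val.comp
    (MvPolynomial.aeval fun i => ⟨f i, Algebra.subset_adjoin ⟨i, rfl⟩⟩)
  have hφ (i : ι) : φ (MvPolynomial.X i) = f i := by simp [φ]
  let _ : Module (MvPolynomial ι k) W := Module.compHom W φ.toRingHom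
  have hsmul (P : MvPolynomial ι k) (x : W) : P • x = φ P x := rfl
  have hC (c : k) (x : W) : (MvPolynomial.C c : MvPolynomial ι k) • x = c • x := by
    rw [hsmul, ← MvPolynomial.algebraMap_eq, φ.commutes]; rfl
  have hsimple : IsSimpleModule (MvPolynomial ι k) W := by
    rw [isSimpleModule_iff]
    refine { eq_bot_or_eq_top := fun N => ?_ }
    let N' : Submodule k W :=
      { N with smul_mem' := fun c x hx => (hC c x) ▸ N.smul_mem _ hx }
    have hN' : ∀ i, ∀ x ∈ N', f i x ∈ N' := fun i x hx => by
      rw [← hφ, ← hsmul]; exact N.smul_mem _ hx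
    have hmem (x : W) : x ∈ N' ↔ x ∈ N := Iff.rfl
    rcases hs N' hN' with h | h
    · left
      refine (Submodule.eq_bot_iff _).2 fun x hx => ?_
      rw [← hmem, h] at hx
      exact hx
    · right
      refine eq_top_iff.2 fun x _ => ?_
      rw [← hmem, h]; trivial
  obtain ⟨I, hI, ⟨e⟩⟩ := isSimpleModule_iff_quot_maximal.1 hsimple
  -- Nullstellensatz: the annihilating maximal ideal is that of a point `c`, whose coordinates are
  -- the scalars. This works without any finiteness of dimension.
  obtain ⟨c, rfl⟩ := MvPolynomial.isMaximal_iff_eq_vanishingIdeal_singleton.1 hI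
  refine ⟨c, fun i x => ?_⟩
  have hmem : (MvPolynomial.X i - MvPolynomial.C (c i) : MvPolynomial ι k) ∈
      MvPolynomial.vanishingIdeal k {c} := by
    simp
  have h0 : (MvPolynomial.X i - MvPolynomial.C (c i) : MvPolynomial ι k) • x = 0 := by
    apply e.injective
    rw [map_smul, map_zero]
    obtain ⟨P, hP⟩ := Ideal.Quotient.mk_surjective (e x)
    rw [← hP]
    change (Ideal.Quotient.mk _ (_ * P) : _ ⧸ _) = 0
    exact Ideal.Quotient.eq_zero_iff_mem.2 (Ideal.mul_mem_right _ _ hmem)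
  rw [sub_smul, hC, hsmul, hφ, sub_eq_zero] at h0
  exact h0

end

noncomputable section

section CommonEigenvector

variable {k A V ι : Type*} [Field k] [Ring A] [Algebra k A] [AddCommGroup V] [Module k V]
  [Module A V] [IsScalarTower k A V]

/-- Commuting elements of `A` acting on a subspace `E` of an `A`-module, with no common invariant
subspace strictly between `0` and `E`, have a common eigenvector in `E`. -/
theorem Submodule.exists_common_eigenvector [IsAlgClosed k] [Finite ι] (E : Submodule k V)
    (c : ι → A) (hE : ∀ i, ∀ x ∈ E, c i • x ∈ E)
    (hc : ∀ i j, ∀ x ∈ E, c i • c j • x = c j • c i • x) {x : V} (hx : x ∈ E) (hx0 : x ≠ 0)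
    (hN : ∀ N ≤ E, (∀ i, ∀ x ∈ N, c i • x ∈ N) → ∀ x ∈ N, x ≠ 0 → E ≤ N) :
    ∃ r : ι → k, ∀ i, c i • x = r i • x := by
  have : Nontrivial E := ⟨⟨⟨x, hx⟩, 0, fun h => hx0 (congrArg Subtype.val h)⟩⟩
  obtain ⟨r, hr⟩ := exists_scalars_of_commute
    (fun i => (Algebra.lsmul k k V (c i)).restrict (hE i)) (fun i j => by
      ext ⟨y, hy⟩; exact hc i j y hy) (fun N hNs => by
      rw [or_iff_not_imp_left]
      intro hne
      obtain ⟨⟨y, hyE⟩, hy, hy0⟩ := N.exists_mem_ne_zero_of_ne_bot hne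
      have := hN (N.map E.subtype) (Submodule.map_subtype_le E N) (fun i z hz => by
        obtain ⟨z, hz, rfl⟩ := hz
        exact ⟨_, hNs i z hz, rfl⟩) y ⟨_, hy, rfl⟩ (fun h => hy0 (Subtype.ext h))
      refine eq_top_iff.2 fun z _ => ?_
      obtain ⟨z', hz', he⟩ := this z.2
      have : z' = z := Subtype.ext he
      exact this ▸ hz')
  exact ⟨r, fun i => congrArg Subtype.val (hr i ⟨x, hx⟩)⟩

end CommonEigenvector

/-! ### Eigendata of a simple module: spherical vectors and generators of two-dimensional modules.
-/

section Eigendata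

variable {k A V : Type*} [Field k] [Ring A] [Algebra k A] [AddCommGroup V] [Module k V]
  [Module A V] [IsScalarTower k A V]

/-- `v` is fixed by `s` and by `t⁻¹ s t`, and it is an eigenvector of the corresponding spherical
algebra; `w` is the image of `v` under `t s t⁻¹`. -/
structure IsSph (s t : A) (z a b : k) (v w : V) : Prop where
  s_v : s • v = v
  s_tv : s • t • v = t • v
  s_ttv : s • t • t • v = t • t • w
  s_tw : s • t • w = a • v
  s_w : z • s • w = b • t • v
  ttt_v : t • t • t • v = z • v
  ttt_w : t • t • t • w = z • w

/-- `v` generates a two-dimensional module. -/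
structure IsTwo (s t : A) (y : k) (v : V) : Prop where
  s_v : s • v = v
  s_tv : s • t • v = 0
  tt_v : t • t • v = -(y ^ 2 • v) - y • t • v

end Eigendata

namespace IsSph

set_option linter.unusedSectionVars false

variable {k A V V' : Type*} [Field k] [Ring A] [Algebra k A] [AddCommGroup V] [Module k V]
  [Module A V] [IsScalarTower k A V] [AddCommGroup V'] [Module k V']
  [Module A V'] [IsScalarTower k A V'] {s t u : A} {z a b : k} {v w : V}

theorem map (f : V →ₗ[A] V') (D : IsSph s t z a b v w) : IsSph s t z a b (f v) (f w) := by
  have hk (c : k) (x : V) : f (c • x) = c • f x := by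
    rw [← algebraMap_smul A c x, map_smul, algebraMap_smul]
  constructor
  · rw [← map_smul, D.s_v]
  · rw [← map_smul, ← map_smul, D.s_tv]
  · simp only [← map_smul, D.s_ttv]
  · rw [← hk, ← map_smul, ← map_smul, D.s_tw]
  · rw [← map_smul f s w, ← hk, D.s_w, hk, map_smul]
  · rw [← hk, ← map_smul, ← map_smul, ← map_smul, D.ttt_v]
  · rw [← hk, ← map_smul, ← map_smul, ← map_smul, D.ttt_w]

theorem prod {v' w' : V'} (D : IsSph s t z a b v w) (D' : IsSph s t z a b v' w') :
    IsSph s t z a b (v, v') (w, w') := by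
  constructor <;> ext <;> simp [D.s_v, D.s_tv, D.s_ttv, D.s_tw, D.s_w, D.ttt_v, D.ttt_w, D'.s_v,
    D'.s_tv, D'.s_ttv, D'.s_tw, D'.s_w, D'.ttt_v, D'.ttt_w]

/-- The orbits of `v` and `w` under `t`. -/
def orbits (t : A) (v w : V) : Set V := {v, t • v, t • t • v, w, t • w, t • t • w}

theorem s_w' (D : IsSph s t z a b v w) (hz : z ≠ 0) : s • w = (z⁻¹ * b) • t • v := by
  rw [mul_smul, ← D.s_w, inv_smul_smul₀ hz]

theorem s_ttw (D : IsSph s t z a b v w) (h : IsZeroHecke k s t u) :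
    s • t • t • w = t • t • w := by
  rw [← D.s_ttv, h.ss]

/-- The formulas of `IsSph` are closed on the six vectors: `u` acts on `v` and `w` as `z⁻¹ t²`, and
elsewhere it steps back along the orbit. -/
theorem smul_mem (D : IsSph s t z a b v w) (h : IsZeroHecke k s t u) (hz : z ≠ 0) (c : A) :
    ∀ x ∈ Submodule.span k (orbits t v w), c • x ∈ Submodule.span k (orbits t v w) := by
  have m0 : v ∈ Submodule.span k (orbits t v w) := Submodule.subset_span (by simp [orbits])
  have m1 : t • v ∈ Submodule.span k (orbits t v w) := Submodule.subset_span (by simp [orbits])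
  have m2 : t • t • v ∈ Submodule.span k (orbits t v w) :=
    Submodule.subset_span (by simp [orbits])
  have m3 : w ∈ Submodule.span k (orbits t v w) := Submodule.subset_span (by simp [orbits])
  have m4 : t • w ∈ Submodule.span k (orbits t v w) := Submodule.subset_span (by simp [orbits])
  have m5 : t • t • w ∈ Submodule.span k (orbits t v w) :=
    Submodule.subset_span (by simp [orbits])
  apply h.mem_span_of_stable
  · rintro x (rfl | rfl | rfl | rfl | rfl | rfl)
    · rwa [D.s_v]
    · rwa [D.s_tv]
    · rwa [D.s_ttv]
    · rw [D.s_w' hz]; exact Submodule.smul_mem _ _ m1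
    · rw [D.s_tw]; exact Submodule.smul_mem _ _ m0
    · rwa [D.s_ttw h]
  · rintro x (rfl | rfl | rfl | rfl | rfl | rfl)
    · exact m1
    · exact m2
    · rw [D.ttt_v]; exact Submodule.smul_mem _ _ m0
    · exact m4
    · exact m5
    · rw [D.ttt_w]; exact Submodule.smul_mem _ _ m3
  · have e {x : V} (hx : t • t • t • x = z • x) : u • x = z⁻¹ • t • t • x := by
      rw [eq_inv_smul_iff₀ hz, smul_comm, ← hx, h.ut]
    rintro x (rfl | rfl | rfl | rfl | rfl | rfl)
    · rw [e D.ttt_v]; exact Submodule.smul_mem _ _ m2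
    · rwa [h.ut]
    · rwa [h.ut]
    · rw [e D.ttt_w]; exact Submodule.smul_mem _ _ m5
    · rwa [h.ut]
    · rwa [h.ut]

theorem span_orbits [IsSimpleModule A V] (D : IsSph s t z a b v w) (h : IsZeroHecke k s t u)
    (hz : z ≠ 0) (hv : v ≠ 0) : Submodule.span k (orbits t v w) = ⊤ :=
  h.eq_top_of_stable _ (D.smul_mem h hz s) (D.smul_mem h hz t) (D.smul_mem h hz u)
    (Submodule.subset_span (by simp [orbits])) hv

/-- With `r = u * s * t`, the element is `s r s`, the idempotent onto the vectors fixed by `s` and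
`r`. -/
theorem corner_smul_self (D : IsSph s t z a b v w) (h : IsZeroHecke k s t u) :
    (s * u * s * t * s) • v = v := by
  simp only [mul_smul, D.s_v, D.s_tv, h.ut]

/-- On `v`, `t v`, `t² v` the corner idempotent gives `v`, `a v`, `b v`. It is unchanged by right
multiplication by `s`, and `s` carries `w`, `t w`, `t² w` to multiples of `t v`, of `v`, and to `s
t² v`, so the other three vectors follow. -/
theorem corner_smul_mem (D : IsSph s t z a b v w) (h : IsZeroHecke k s t u) (hz : z ≠ 0) :
    ∀ x ∈ Submodule.span k (orbits t v w), (s * u * s * t * s) • x ∈ Submodule.span k {v} := by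
  intro x hx
  refine (Submodule.map_span_le (Algebra.lsmul k k V (s * u * s * t * s)) _ _).2 ?_
    (Submodule.mem_map_of_mem hx)
  have hb : (s * u * s * t * s) • t • t • v = b • v := by
    simp only [mul_smul, D.s_ttv, D.ttt_w]
    rw [smul_comm s z, D.s_w, smul_comm u b, h.ut, smul_comm s b, D.s_v]
  have ha : (s * u * s * t * s) • t • v = a • v := by
    simp only [mul_smul, D.s_ttv, D.s_tv, h.ut, D.s_tw]
  rintro x (rfl | rfl | rfl | rfl | rfl | rfl) <;> simp only [Algebra.lsmul_coe]
  · rw [D.corner_smul_self h]; exact Submodule.mem_span_singleton_self _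
  · rw [ha]
    exact Submodule.smul_mem _ _ (Submodule.mem_span_singleton_self _)
  · rw [hb]; exact Submodule.smul_mem _ _ (Submodule.mem_span_singleton_self _)
  · have : (s * u * s * t * s) • x = (s * u * s * t * s) • s • x := by
      simp only [mul_smul, h.ss]
    rw [this, D.s_w' hz, smul_comm, ha]
    exact Submodule.smul_mem _ _ (Submodule.smul_mem _ _ (Submodule.mem_span_singleton_self _))
  · simp only [mul_smul, D.s_tw]
    rw [smul_comm t a, smul_comm s a, smul_comm u a, smul_comm s a, D.s_tv, h.ut, D.s_v]
    exact Submodule.smul_mem _ _ (Submodule.mem_span_singleton_self _)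
  · rw [← D.s_ttv]
    have : (s * u * s * t * s) • s • t • t • v = (s * u * s * t * s) • t • t • v := by
      simp only [mul_smul, h.ss]
    rw [this, hb]
    exact Submodule.smul_mem _ _ (Submodule.mem_span_singleton_self _)

/-- The scalars `z`, `a`, `b` determine a simple module. -/
theorem nonempty_linearEquiv [IsSimpleModule A V] [IsSimpleModule A V'] {v' w' : V'}
    (h : IsZeroHecke k s t u) (D : IsSph s t z a b v w) (D' : IsSph s t z a b v' w') (hz : z ≠ 0)
    (hv : v ≠ 0) (hv' : v' ≠ 0) : Nonempty (V ≃ₗ[A] V') := by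
  refine nonempty_linearEquiv_of_corner (k := k) (s * u * s * t * s) hv hv'
    (D.corner_smul_self h) (D'.corner_smul_self h) fun c => ?_
  -- Computing in `V × V'` makes the corner scalar the same in both factors.
  have := (D.prod D').corner_smul_mem h hz _ ((D.prod D').smul_mem h hz c (v, v')
    (Submodule.subset_span (by simp [orbits])))
  obtain ⟨r, hr⟩ := Submodule.mem_span_singleton.1 this
  exact ⟨r, (congrArg Prod.fst hr).symm, (congrArg Prod.snd hr).symm⟩

/-- The scalars `z`, `a`, `b` are determined by a simple module. -/
theorem scalars_unique [IsSimpleModule A V] {z' a' b' : k} {v' w' : V}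
    (h : IsZeroHecke k s t u) (D : IsSph s t z a b v w) (D' : IsSph s t z' a' b' v' w')
    (hz : z ≠ 0) (hv : v ≠ 0) (hv' : v' ≠ 0) : z = z' ∧ a = a' ∧ b = b' := by
  -- The corner idempotent fixes `v'` and maps all of `V` into the line of `v`, so `v'` is a
  -- multiple of `v`. Then `w'` is the same multiple of `w`.
  have hmem := D.corner_smul_mem h hz v' (D.span_orbits h hz hv ▸ Submodule.mem_top)
  rw [D'.corner_smul_self h] at hmem
  obtain ⟨c, rfl⟩ := Submodule.mem_span_singleton.1 hmem
  have hw : w' = c • w := by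
    have := D'.s_ttv
    rw [smul_comm t c, smul_comm t c, smul_comm s c, D.s_ttv, ← smul_comm t c,
      ← smul_comm t c] at this
    have h2 := congrArg (fun x => u • u • x) this
    simpa only [h.ut] using h2.symm
  subst hw
  have hc : c ≠ 0 := by rintro rfl; simp at hv'
  have ez : z = z' := by
    have := D'.ttt_v
    rw [smul_comm t c, smul_comm t c, smul_comm t c, D.ttt_v, smul_comm] at this
    exact smul_left_injective k hv' this
  subst ez
  have htv : t • c • v ≠ 0 := by
    intro h0
    apply hv'
    rw [← h.ut (c • v), h0, smul_zero]
  refine ⟨rfl, ?_, ?_⟩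
  · have := D'.s_tw
    rw [smul_comm t c, smul_comm s c, D.s_tw, smul_comm] at this
    exact smul_left_injective k hv' this
  · have := D'.s_w
    rw [smul_comm s c, smul_comm z c, D.s_w, smul_comm c b, ← smul_comm t c] at this
    exact smul_left_injective k htv this

end IsSph

namespace IsTwo

set_option linter.unusedSectionVars false

variable {k A V V' : Type*} [Field k] [Ring A] [Algebra k A] [AddCommGroup V] [Module k V]
  [Module A V] [IsScalarTower k A V] [AddCommGroup V'] [Module k V']
  [Module A V'] [IsScalarTower k A V'] {s t u : A} {y : k} {v : V}

theorem map (f : V →ₗ[A] V') (D : IsTwo s t y v) : IsTwo s t y (f v) := by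
  have hk (c : k) (x : V) : f (c • x) = c • f x := by
    rw [← algebraMap_smul A c x, map_smul, algebraMap_smul]
  constructor
  · rw [← map_smul, D.s_v]
  · rw [← map_smul, ← map_smul, D.s_tv, map_zero]
  · rw [← map_smul, ← map_smul, D.tt_v, map_sub, map_neg, hk, hk]

theorem prod {v' : V'} (D : IsTwo s t y v) (D' : IsTwo s t y v') : IsTwo s t y (v, v') := by
  constructor <;> ext <;> simp [D.s_v, D.s_tv, D.tt_v, D'.s_v, D'.s_tv, D'.tt_v]

theorem ttt_v (D : IsTwo s t y v) : t • t • t • v = y ^ 3 • v := by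
  rw [D.tt_v, smul_sub, smul_neg, smul_comm t, smul_comm t, D.tt_v]
  generalize t • v = x
  module

theorem smul_mem (D : IsTwo s t y v) (h : IsZeroHecke k s t u) (hy : y ≠ 0) (c : A) :
    ∀ x ∈ Submodule.span k {v, t • v}, c • x ∈ Submodule.span k {v, t • v} := by
  have m0 : v ∈ Submodule.span k {v, t • v} := Submodule.subset_span (by simp)
  have m1 : t • v ∈ Submodule.span k {v, t • v} := Submodule.subset_span (by simp)
  have m2 : t • t • v ∈ Submodule.span k {v, t • v} := by
    rw [D.tt_v]
    exact sub_mem (neg_mem (Submodule.smul_mem _ _ m0)) (Submodule.smul_mem _ _ m1)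
  apply h.mem_span_of_stable
  · rintro x (rfl | rfl)
    · rwa [D.s_v]
    · rw [D.s_tv]; exact zero_mem _
  · rintro x (rfl | rfl)
    · exact m1
    · exact m2
  · have e : u • v = (y ^ 3)⁻¹ • t • t • v := by
      rw [eq_inv_smul_iff₀ (pow_ne_zero 3 hy), smul_comm, ← D.ttt_v, h.ut]
    rintro x (rfl | rfl)
    · rw [e]; exact Submodule.smul_mem _ _ m2
    · rwa [h.ut]

/-- In the two-dimensional case the idempotent `s` itself serves as the corner idempotent of rank
one. -/
theorem s_smul_mem (D : IsTwo s t y v) :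
    ∀ x ∈ Submodule.span k {v, t • v}, s • x ∈ Submodule.span k {v} := by
  intro x hx
  refine (Submodule.map_span_le (Algebra.lsmul k k V s) _ _).2 ?_
    (Submodule.mem_map_of_mem hx)
  rintro x (rfl | rfl) <;> simp only [Algebra.lsmul_coe]
  · rw [D.s_v]; exact Submodule.mem_span_singleton_self _
  · rw [D.s_tv]; exact zero_mem _

theorem nonempty_linearEquiv [IsSimpleModule A V] [IsSimpleModule A V'] {v' : V'}
    (h : IsZeroHecke k s t u) (D : IsTwo s t y v) (D' : IsTwo s t y v') (hy : y ≠ 0)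
    (hv : v ≠ 0) (hv' : v' ≠ 0) : Nonempty (V ≃ₗ[A] V') := by
  refine nonempty_linearEquiv_of_corner (k := k) s hv hv' D.s_v D'.s_v fun c => ?_
  have := (D.prod D').s_smul_mem _ ((D.prod D').smul_mem h hy c (v, v')
    (Submodule.subset_span (by simp)))
  obtain ⟨r, hr⟩ := Submodule.mem_span_singleton.1 this
  exact ⟨r, (congrArg Prod.fst hr).symm, (congrArg Prod.snd hr).symm⟩

end IsTwo

end

noncomputable section

/-! ### Commuting operators on the fixed vectors, and existence of eigenvectors. -/

namespace IsZeroHecke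

set_option linter.unusedSectionVars false

variable {k A V : Type*} [Field k] [Ring A] [Algebra k A] [AddCommGroup V] [Module k V]
  [Module A V] [IsScalarTower k A V] {s t u : A}

section Identities

variable (h : IsZeroHecke k s t u)
include h

theorem s_tt (x : V) : s • t • t • x = t • t • t • s • u • x := by
  rw [← h.st3, h.tu]

theorem commute_smul {b : A} (hs : ∀ x : V, s • b • x = b • s • x)
    (ht : ∀ x : V, t • b • x = b • t • x) (hu : ∀ x : V, u • b • x = b • u • x) (a : A) :
    ∀ x : V, a • b • x = b • a • x := by
  have ha : a ∈ Algebra.adjoin k {s, t, u} := by rw [h.gen]; trivial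
  induction ha using Algebra.adjoin_induction with
  | mem x hx =>
    rcases hx with rfl | rfl | rfl
    · exact hs
    · exact ht
    · exact hu
  | algebraMap r => intro x; rw [algebraMap_smul, algebraMap_smul, smul_comm]
  | add a c _ _ ha hc => intro x; rw [add_smul, add_smul, ha, hc, smul_add]
  | mul a c _ _ ha hc => intro x; rw [mul_smul, mul_smul, hc, ha]

theorem ttt_comm (a : A) (x : V) : a • t • t • t • x = t • t • t • a • x := by
  have := h.commute_smul (V := V) (b := t * t * t) (fun x => by simp only [mul_smul, h.st3])
    (fun x => by simp only [mul_smul]) (fun x => by simp only [mul_smul, h.ut, h.tu]) a x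
  simpa only [mul_smul] using this

theorem uuu_comm (a : A) (x : V) : a • u • u • u • x = u • u • u • a • x := by
  have := h.commute_smul (V := V) (b := u * u * u) (fun x => by simp only [mul_smul, h.su3])
    (fun x => by simp only [mul_smul, h.ut, h.tu]) (fun x => by simp only [mul_smul]) a x
  simpa only [mul_smul] using this

theorem uuu (x : V) : u • u • u • t • t • t • x = x := by simp only [h.ut]

theorem sph_s_tt (x : V) :
    s • t • t • s • u • x = s • u • s • t • t • x := by
  have : t • t • s • u • x = u • s • t • t • x := by
    rw [h.s_tt, h.ut]
  rw [this]

/-- The braid relation at `t x` exhibits `s t² s u x` as a value of the idempotent `u s t`, hence as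
a vector fixed by it. -/
theorem sph_a_fixed {x : V} (hx : s • t • x = t • x) :
    s • t • s • t • t • s • u • x = t • s • t • t • s • u • x := by
  have e : s • t • t • s • u • x = u • s • t • s • u • s • t • t • x := by
    rw [h.sph_s_tt, ← hx]
    have := h.brd (t • x)
    rw [hx] at this ⊢
    exact this
  rw [e, h.tu, h.ss]

/-- By the braid relation `y = s t s u x` is fixed by `t s u`. Centrality of `t³` gives `s t² = t²
(t s u)`, so `t² y` is fixed by `s`. -/
theorem sph_b_fixed {x : V} (hx : s • x = x) :
    s • t • t • s • t • s • u • x = t • t • s • t • s • u • x := by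
  have e : s • t • s • u • x = t • s • u • s • t • s • u • x := by
    have := congrArg (t • ·) (h.brd (u • x))
    simp only [h.tu, hx] at this
    exact this.symm
  conv_rhs => rw [e]
  rw [h.s_tt]

/-- Both sides equal `t³ s u s t s t s u x`: the left one by one braid move, the right one by moving
`t³` through `s`. -/
theorem sph_comm (x : V) :
    t • t • s • t • s • u • s • t • t • s • u • x =
      s • t • t • s • u • t • t • s • t • s • u • x := by
  have e1 : s • t • t • s • u • x = t • u • s • t • t • s • u • x := by rw [h.tu]
  have e2 : s • t • t • s • u • t • t • s • t • s • u • x =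
      t • t • t • s • u • s • t • s • t • s • u • x := by
    have c1 : s • u • t • t • s • t • s • u • x = s • t • s • t • s • u • x := by rw [h.ut]
    rw [c1, h.s_tt]
  have e3 : s • t • s • u • s • t • t • s • u • x = t • s • u • s • t • s • t • s • u • x := by
    have := congrArg (t • ·) (h.brd (t • s • u • x))
    simp only [h.tu] at this
    exact this.symm
  rw [e2, e3]

end Identities

/-- The vectors fixed by `s` and by `t⁻¹ s t`. -/
def fixed (k : Type*) {A : Type*} (V : Type*) [Field k] [Ring A] [Algebra k A] [AddCommGroup V]
    [Module k V] [Module A V] [IsScalarTower k A V] (s t : A) : Submodule k V where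
  carrier := {x | s • x = x ∧ s • t • x = t • x}
  add_mem' := by
    rintro x y ⟨h1, h2⟩ ⟨h3, h4⟩
    exact ⟨by rw [smul_add, h1, h3], by simp only [smul_add, h2, h4]⟩
  zero_mem' := by simp
  smul_mem' := by
    rintro c x ⟨h1, h2⟩
    exact ⟨by rw [smul_comm, h1], by rw [smul_comm t c, smul_comm s c, h2]⟩

/-- Elements that act on the vectors fixed by `s` and `t⁻¹ s t`. -/
def sphOps (s t u : A) : Fin 4 → A :=
  ![s * t * t * s * u, t * t * s * t * s * u, t * t * t, u * u * u]

/-- A simple module with a nonzero vector fixed by `s` and `t⁻¹ s t`. -/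
theorem exists_isSph [IsAlgClosed k] [IsSimpleModule A V] (h : IsZeroHecke k s t u) {v : V}
    (hv : v ∈ fixed k V s t) (hv0 : v ≠ 0) :
    ∃ (z a b : k) (w : V), z ≠ 0 ∧ IsSph s t z a b v w := by
  have key := (fixed k V s t).exists_common_eigenvector (sphOps s t u) ?_ ?_ hv hv0 ?_
  · obtain ⟨r, hr⟩ := key
    have ha := hr 0
    have hb := hr 1
    have hz := hr 2
    simp only [sphOps, Matrix.cons_val_zero, Matrix.cons_val_one, Matrix.cons_val, mul_smul]
      at ha hb hz
    have hz0 : r 2 ≠ 0 := by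
      intro h0
      rw [h0, zero_smul] at hz
      apply hv0
      rw [← h.uuu v, hz]
      simp
    have P (c : A) (x : V) : r 2 • c • x = c • r 2 • x := smul_comm _ _ _
    refine ⟨r 2, r 0, r 1, t • s • u • v, hz0, hv.1, hv.2, h.s_tt v, ha, ?_, hz, ?_⟩
    · rw [smul_comm (r 1) t, ← hb, P s, P t, P s, P u, ← hz]
      simp only [h.ttt_comm s, h.ttt_comm u]
    · rw [P t, P s, P u, ← hz, h.ttt_comm u, h.ttt_comm s]
  · intro i x hx
    fin_cases i <;> simp [sphOps, mul_smul]
    · exact ⟨by rw [h.ss], h.sph_a_fixed hx.2⟩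
    · exact ⟨(h.sph_b_fixed hx.1), by rw [h.st3, h.ss]⟩
    · exact ⟨by rw [h.st3, hx.1], by rw [h.ttt_comm t, h.ttt_comm s, hx.2]⟩
    · exact ⟨by rw [h.su3, hx.1], by rw [h.uuu_comm t, h.uuu_comm s, hx.2]⟩
  · intro i j x hx
    have h1 (a : A) (x : V) : a • (t * t * t) • x = (t * t * t) • a • x := by
      simpa only [mul_smul] using h.ttt_comm a x
    have h2 (a : A) (x : V) : a • (u * u * u) • x = (u * u * u) • a • x := by
      simpa only [mul_smul] using h.uuu_comm a x
    have h3 : (t * t * s * t * s * u) • (s * t * t * s * u) • x =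
        (s * t * t * s * u) • (t * t * s * t * s * u) • x := by
      simpa only [mul_smul] using h.sph_comm x
    fin_cases i <;> fin_cases j <;>
      simp only [sphOps, Fin.zero_eta, Fin.mk_one, Fin.reduceFinMk, Matrix.cons_val_zero,
        Matrix.cons_val_one, Matrix.cons_val]
    all_goals first
      | rfl
      | exact h3
      | exact h3.symm
      | exact h1 _ _
      | exact (h1 _ _).symm
      | exact h2 _ _
      | exact (h2 _ _).symm
  · intro N hNE hN x₀ hx₀ hx0
    have na : ∀ x ∈ N, s • t • t • s • u • x ∈ N := fun x hx => by
      simpa [sphOps, mul_smul] using hN 0 x hx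
    have nb : ∀ x ∈ N, t • t • s • t • s • u • x ∈ N := fun x hx => by
      simpa [sphOps, mul_smul] using hN 1 x hx
    have nt : ∀ x ∈ N, t • t • t • x ∈ N := fun x hx => by
      simpa [sphOps, mul_smul] using hN 2 x hx
    -- The inverse of `t³` is one of the operators because stability of the span below needs it.
    have nu : ∀ x ∈ N, u • u • u • x ∈ N := fun x hx => by
      simpa [sphOps, mul_smul] using hN 3 x hx
    -- The vectors reached from `N` are the first three steps of the `t`-orbits of `x` and of `t s u
    -- x`. Their span is a submodule, so it is `V`, and the corner idempotent maps each of them back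
    -- into `N`. A vector fixed by that idempotent therefore lies in `N`.
    let S : Set V := {y | ∃ x ∈ N, y = x ∨ y = t • x ∨ y = t • t • x ∨ y = t • s • u • x ∨
      y = t • t • s • u • x ∨ y = t • t • t • s • u • x}
    have hS : Submodule.span k S = ⊤ := by
      refine h.span_eq_top (S := S) ?_ ?_ ?_ ⟨x₀, hx₀, Or.inl rfl⟩ hx0
      · rintro x ⟨x, hx, rfl | rfl | rfl | rfl | rfl | rfl⟩ <;> refine Submodule.subset_span ?_
        · exact ⟨x, hx, Or.inl (hNE hx).1⟩
        · exact ⟨x, hx, Or.inr (Or.inl (hNE hx).2)⟩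
        · exact ⟨x, hx, by rw [h.s_tt]; simp⟩
        · refine ⟨_, nu _ (nb x hx), Or.inr (Or.inl ?_)⟩
          simp only [h.ut, h.tu]
        · exact ⟨_, na x hx, Or.inl rfl⟩
        · exact ⟨x, hx, by rw [h.st3, h.ss]; simp⟩
      · rintro x ⟨x, hx, rfl | rfl | rfl | rfl | rfl | rfl⟩ <;> refine Submodule.subset_span ?_
        · exact ⟨x, hx, by simp⟩
        · exact ⟨x, hx, by simp⟩
        · exact ⟨_, nt x hx, by simp⟩
        · exact ⟨x, hx, by simp⟩
        · exact ⟨x, hx, by simp⟩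
        · refine ⟨_, nt x hx, ?_⟩
          rw [h.ttt_comm u, h.ttt_comm s]; simp
      · rintro x ⟨x, hx, rfl | rfl | rfl | rfl | rfl | rfl⟩ <;> refine Submodule.subset_span ?_
        · refine ⟨_, nu x hx, Or.inr (Or.inr (Or.inl ?_))⟩
          rw [h.tu, h.tu]
        · exact ⟨x, hx, by simp [h.ut]⟩
        · exact ⟨x, hx, by simp [h.ut]⟩
        · refine ⟨_, nu x hx, Or.inr (Or.inr (Or.inr (Or.inr (Or.inr ?_))))⟩
          rw [h.uuu_comm u, h.su3]; simp only [h.ut, h.tu]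
        · exact ⟨x, hx, by simp [h.ut]⟩
        · exact ⟨x, hx, by simp [h.ut]⟩
    intro y hy
    have hyS : y ∈ Submodule.span k S := hS ▸ Submodule.mem_top
    have hey : (s * u * s * t * s) • y = y := by
      simp only [mul_smul, hy.1, hy.2, h.ut]
    rw [← hey]
    refine (Submodule.map_span_le (Algebra.lsmul k k V (s * u * s * t * s)) S N).2 ?_
      (Submodule.mem_map_of_mem hyS)
    rintro x ⟨x, hx, rfl | rfl | rfl | rfl | rfl | rfl⟩ <;>
      simp only [Algebra.lsmul_coe, mul_smul]
    · rw [(hNE hx).1, (hNE hx).2, h.ut, (hNE hx).1]; exact hx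
    · rw [(hNE hx).2, ← h.sph_s_tt]; exact na x hx
    · rw [h.s_tt x, h.ttt_comm t, h.st3, h.ttt_comm u, h.st3, ← h.s_tt,
        h.sph_b_fixed (hNE hx).1]
      exact nb x hx
    · have : s • t • s • u • x = t • u • u • u • t • t • s • t • s • u • x := by
        simp only [h.ut, h.tu]
      rw [this, ← h.sph_s_tt]
      exact na _ (nu _ (nb x hx))
    · have hm := na x hx
      rw [(hNE hm).2, h.ut, (hNE hm).1]
      exact hm
    · rw [← h.s_tt x, h.ss, h.s_tt x, h.ttt_comm t, h.st3, h.ttt_comm u, h.st3, ← h.s_tt,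
        h.sph_b_fixed (hNE hx).1]
      exact nb x hx

/-! ### Simple modules killed by both corner idempotents. -/

section TwoDimensional

variable (h : IsZeroHecke k s t u)

/-- The vectors fixed by `s` and killed by `t⁻¹ s t`. -/
def fixedKilled (k : Type*) {A : Type*} (V : Type*) [Field k] [Ring A] [Algebra k A]
    [AddCommGroup V] [Module k V] [Module A V] [IsScalarTower k A V] (s t : A) :
    Submodule k V where
  carrier := {x | s • x = x ∧ s • t • x = 0}
  add_mem' := by
    rintro x y ⟨h1, h2⟩ ⟨h3, h4⟩
    exact ⟨by rw [smul_add, h1, h3], by simp only [smul_add, h2, h4, add_zero]⟩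
  zero_mem' := by simp
  smul_mem' := by
    rintro c x ⟨h1, h2⟩
    exact ⟨by rw [smul_comm, h1], by rw [smul_comm t c, smul_comm s c, h2, smul_zero]⟩

-- The hypothesis `H` is the vanishing of `(1 - s)(1 - r)(1 - s)` once `s r s` acts by zero, with `r
-- = u s t`. Put `ψ = s u`. On the vectors fixed by `s` and killed by `r`, it yields that `ψ`
-- preserves this space, that `t² ψ² = t ψ - 1`, and hence that `t³ ψ³ = -1`. So `ψ` has a nonzero
-- eigenvalue `c`, and `y = -c⁻¹` turns the quadratic relation into the required one.
include h in
theorem exists_isTwo [IsAlgClosed k] [IsSimpleModule A V]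
    (H : ∀ x : V, x - s • x - u • s • t • x + s • u • s • t • x + u • s • t • s • x = 0) {v : V}
    (hv : v ∈ fixedKilled k V s t) (hv0 : v ≠ 0) : ∃ y : k, y ≠ 0 ∧ IsTwo s t y v := by
  have f0 {x : V} (hx : x ∈ fixedKilled k V s t) : s • t • s • u • x = 0 := by
    have := congrArg (t • ·) (H (u • x))
    simp only [smul_add, smul_sub, smul_zero, h.tu, hx.1] at this
    simpa using this
  have f1 {x : V} (hx : x ∈ fixedKilled k V s t) : t • t • s • u • s • u • x = t • s • u • x - x := by
    have := congrArg (u • ·) (H (t • x))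
    simp only [smul_add, smul_sub, smul_zero, h.ut, hx.2, h.s_tt] at this
    rw [← sub_eq_zero, ← this]
    abel
  have fψ {x : V} (hx : x ∈ fixedKilled k V s t) : s • u • x ∈ fixedKilled k V s t :=
    ⟨h.ss _, f0 hx⟩
  have f3 {x : V} (hx : x ∈ fixedKilled k V s t) :
      t • t • t • s • u • s • u • s • u • x = -x := by
    rw [f1 (fψ hx), smul_sub, f1 hx]
    abel
  have key := (fixedKilled k V s t).exists_common_eigenvector ![s * u, t * t * t, u * u * u]
    ?_ ?_ hv hv0 ?_
  · obtain ⟨r, hr⟩ := key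
    have hψ := hr 0
    simp only [Matrix.cons_val_zero, mul_smul] at hψ
    have hr0 : r 0 ≠ 0 := by
      intro h0
      have := f3 hv
      rw [hψ, h0] at this
      simp only [zero_smul, smul_zero] at this
      exact hv0 (neg_eq_zero.1 this.symm)
    refine ⟨-(r 0)⁻¹, neg_ne_zero.2 (inv_ne_zero hr0), hv.1, hv.2, ?_⟩
    have := f1 hv
    have Q (a : A) (x : V) : a • r 0 • x = r 0 • a • x := smul_comm _ _ _
    rw [hψ] at this
    simp only [Q] at this
    rw [hψ] at this
    simp only [Q] at this
    refine smul_right_injective V (mul_ne_zero hr0 hr0) ?_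
    simp only
    rw [mul_smul, this]
    have hc2 : r 0 * r 0 * (r 0)⁻¹ ^ 2 = 1 := by field_simp
    have hc1 : r 0 * r 0 * (r 0)⁻¹ = r 0 := by field_simp
    rw [neg_sq, smul_sub, smul_neg, smul_smul, hc2, one_smul, neg_smul, smul_neg, smul_smul, hc1]
    abel
  · intro i x hx
    fin_cases i <;> simp [mul_smul]
    · exact fψ hx
    · exact ⟨by rw [h.st3, hx.1], by rw [h.ttt_comm t, h.ttt_comm s, hx.2]; simp⟩
    · exact ⟨by rw [h.su3, hx.1], by rw [h.uuu_comm t, h.uuu_comm s, hx.2]; simp⟩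
  · intro i j x hx
    have h1 (a : A) (x : V) : a • (t * t * t) • x = (t * t * t) • a • x := by
      simpa only [mul_smul] using h.ttt_comm a x
    have h2 (a : A) (x : V) : a • (u * u * u) • x = (u * u * u) • a • x := by
      simpa only [mul_smul] using h.uuu_comm a x
    fin_cases i <;> fin_cases j <;>
      simp only [Fin.zero_eta, Fin.mk_one, Fin.reduceFinMk, Matrix.cons_val_zero,
        Matrix.cons_val_one, Matrix.cons_val]
    all_goals first
      | rfl
      | exact h1 _ _
      | exact (h1 _ _).symm
      | exact h2 _ _
      | exact (h2 _ _).symm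
  · intro N hNE hN x₀ hx₀ hx0
    have na : ∀ x ∈ N, s • u • x ∈ N := fun x hx => by simpa [mul_smul] using hN 0 x hx
    have nt : ∀ x ∈ N, t • t • t • x ∈ N := fun x hx => by simpa [mul_smul] using hN 1 x hx
    have nu : ∀ x ∈ N, u • u • u • x ∈ N := fun x hx => by simpa [mul_smul] using hN 2 x hx
    let S : Set V := {y | ∃ x ∈ N, y = x ∨ y = t • x}
    have ntt : ∀ x ∈ N, t • t • x ∈ Submodule.span k S := by
      intro x hx
      -- From `t³ ψ³ = -1`, the vector `x` is `ψ²` of this element of `N`, so the quadratic relation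
      -- there expresses `t² x` through `N` and `t N`.
      have hy : t • t • t • s • u • (-x) ∈ N := nt _ (na _ (N.neg_mem hx))
      have e : x = s • u • s • u • t • t • t • s • u • (-x) := by
        simp only [h.ttt_comm u, h.ttt_comm s]
        rw [f3 (Submodule.neg_mem _ (hNE hx)), neg_neg]
      rw [e, f1 (hNE hy)]
      exact sub_mem (Submodule.subset_span ⟨_, na _ hy, Or.inr rfl⟩)
        (Submodule.subset_span ⟨_, hy, Or.inl rfl⟩)
    have hS : Submodule.span k S = ⊤ := by
      refine h.span_eq_top (S := S) ?_ ?_ ?_ ⟨x₀, hx₀, Or.inl rfl⟩ hx0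
      · rintro x ⟨x, hx, rfl | rfl⟩
        · exact Submodule.subset_span ⟨x, hx, Or.inl (hNE hx).1⟩
        · rw [(hNE hx).2]; exact zero_mem _
      · rintro x ⟨x, hx, rfl | rfl⟩
        · exact Submodule.subset_span ⟨x, hx, by simp⟩
        · exact ntt x hx
      · rintro x ⟨x, hx, rfl | rfl⟩
        · have := ntt _ (nu x hx)
          rwa [h.tu, h.tu] at this
        · exact Submodule.subset_span ⟨x, hx, by simp [h.ut]⟩
    intro y hy
    have hyS : y ∈ Submodule.span k S := hS ▸ Submodule.mem_top
    rw [← hy.1]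
    refine (Submodule.map_span_le (Algebra.lsmul k k V s) S N).2 ?_
      (Submodule.mem_map_of_mem hyS)
    rintro x ⟨x, hx, rfl | rfl⟩ <;> simp only [Algebra.lsmul_coe]
    · rw [(hNE hx).1]; exact hx
    · rw [(hNE hx).2]; exact N.zero_mem

end TwoDimensional

/-- The possible eigenvectors in a simple module. -/
theorem exists_isSph_or_isTwo [IsAlgClosed k] [IsSimpleModule A V] (h : IsZeroHecke k s t u) :
    (∃ (z a b : k) (v w : V), z ≠ 0 ∧ v ≠ 0 ∧ IsSph s t z a b v w) ∨
    (∃ (z a b : k) (v w : V), z ≠ 0 ∧ v ≠ 0 ∧ IsSph (1 - s) t z a b v w) ∨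
    (∃ (y : k) (v : V), y ≠ 0 ∧ v ≠ 0 ∧ IsTwo s t y v) ∨
    (∃ (y : k) (v : V), y ≠ 0 ∧ v ≠ 0 ∧ IsTwo (1 - s) t y v) := by
  by_cases h1 : ∃ v ∈ fixed k V s t, v ≠ 0
  · obtain ⟨v, hv, hv0⟩ := h1
    obtain ⟨z, a, b, w, hz, D⟩ := h.exists_isSph hv hv0
    exact Or.inl ⟨z, a, b, v, w, hz, hv0, D⟩
  by_cases h2 : ∃ v ∈ fixed k V (1 - s) t, v ≠ 0
  · obtain ⟨v, hv, hv0⟩ := h2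
    obtain ⟨z, a, b, w, hz, D⟩ := h.compl.exists_isSph hv hv0
    exact Or.inr (Or.inl ⟨z, a, b, v, w, hz, hv0, D⟩)
  push Not at h1 h2
  -- Every value of `s r s`, where `r = u s t`, is fixed by `s` and `r`, so it vanishes in the
  -- remaining case. The next step is the same for the complements, expanded.
  have e1 (x : V) : s • u • s • t • s • x = 0 := by
    refine h1 _ ⟨by rw [h.ss], ?_⟩
    rw [h.brd, h.tu, h.ss]
  have e2 (x : V) : x - s • x - u • s • t • x + s • u • s • t • x + u • s • t • s • x = 0 := by
    have e : (1 - s) • u • (1 - s) • t • (1 - s) • x = 0 := by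
      refine h2 _ ⟨by rw [h.compl.ss], ?_⟩
      rw [h.compl.brd, h.tu, h.compl.ss]
    simp only [sub_smul, one_smul, smul_sub, h.ut, h.ss, e1] at e
    rw [← e]
    abel
  have := IsSimpleModule.nontrivial A V
  obtain ⟨v, hv⟩ := exists_ne (0 : V)
  by_cases h0 : ∃ y : V, s • y ≠ 0
  · right; right
    obtain ⟨y, hy⟩ := h0
    -- Either `r` kills `s y`, which `s` fixes, or `r s y` is a nonzero vector fixed by `r` and
    -- killed by `s`, because `s r s = 0`.
    by_cases hx : s • t • s • y = 0
    · left
      obtain ⟨c, hc, D⟩ := h.exists_isTwo e2 (v := s • y) ⟨h.ss y, hx⟩ hy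
      exact ⟨c, _, hc, hy, D⟩
    · right
      have hx' : u • s • t • s • y ≠ 0 := fun h0 => hx (by rw [← h.tu (s • t • s • y), h0,
        smul_zero])
      obtain ⟨c, hc, D⟩ := h.compl.exists_isTwo (fun x => by
        rw [← e2 x]
        simp only [sub_smul, one_smul, smul_sub, h.ut]
        abel) (v := u • s • t • s • y) ⟨by rw [sub_smul, one_smul, e1, sub_zero], by
          rw [h.tu, sub_smul, one_smul, h.ss, sub_self]⟩ hx'
      exact ⟨c, _, hc, hx', D⟩
  -- If `s` acts by zero, then `1 - s` fixes every vector, against the absence of spherical vectors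
  -- for `1 - s`.
  · push Not at h0
    refine absurd (h2 v ⟨?_, ?_⟩) hv
    · rw [sub_smul, one_smul, h0, sub_zero]
    · rw [sub_smul, one_smul, h0, sub_zero]

end IsZeroHecke

end

noncomputable section

open Matrix

/-! ### The algebra at `q = 0` -/

namespace HeckeAlgebra

section

variable {R : Type*} [CommRing R] {q : R}

theorem gen_S2 : gen R q .S2 = gen R q .Tinv * gen R q .S1 * gen R q .T := by
  have h := gen_relations (R := R) (q := q)
  rw [mul_assoc, ← h.conj, ← mul_assoc, h.Tinv_mul_T, one_mul]

theorem adjoin_gen : Algebra.adjoin R {gen R q .S1, gen R q .T, gen R q .Tinv} = ⊤ := by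
  have h1 : Algebra.adjoin R (Set.range (gen R q)) = ⊤ := by
    have h := congrArg (Subalgebra.map (RingQuot.mkAlgHom R (HeckeRel R q)))
      (FreeAlgebra.adjoin_range_ι R HeckeGen)
    rw [AlgHom.map_adjoin, ← Set.range_comp, Algebra.map_top,
      (AlgHom.range_eq_top _).2 (RingQuot.mkAlgHom_surjective R (HeckeRel R q))] at h
    exact h
  refine le_antisymm le_top ?_
  rw [← h1]
  refine Algebra.adjoin_le ?_
  have m1 : gen R q .S1 ∈ Algebra.adjoin R {gen R q .S1, gen R q .T, gen R q .Tinv} :=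
    Algebra.subset_adjoin (by simp)
  have m2 : gen R q .T ∈ Algebra.adjoin R {gen R q .S1, gen R q .T, gen R q .Tinv} :=
    Algebra.subset_adjoin (by simp)
  have m3 : gen R q .Tinv ∈ Algebra.adjoin R {gen R q .S1, gen R q .T, gen R q .Tinv} :=
    Algebra.subset_adjoin (by simp)
  rintro _ ⟨g, rfl⟩
  cases g with
  | S1 => exact m1
  | T => exact m2
  | Tinv => exact m3
  | S2 => rw [gen_S2]; exact mul_mem (mul_mem m3 m1) m2

end

variable {k : Type*} [Field k] {q : k}

/-- The two idempotents `-S₁` and `1 + S₁` of the algebra at `q = 0`. -/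
def idem (k : Type*) [Field k] (q : k) (ε : Bool) : HeckeAlgebra k q :=
  bif ε then -gen k q .S1 else 1 + gen k q .S1

theorem one_sub_idem (ε : Bool) : 1 - idem k q ε = idem k q !ε := by
  cases ε <;> simp [idem]

theorem isZeroHecke (hq : q = 0) (ε : Bool) :
    IsZeroHecke k (idem k q ε) (gen k q .T) (gen k q .Tinv) := by
  suffices h : IsZeroHecke k (-gen k q .S1) (gen k q .T) (gen k q .Tinv) by
    cases ε
    · have := h.compl
      rwa [sub_neg_eq_add] at this
    · exact h
  have h := gen_relations (R := k) (q := q)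
  refine ⟨h.T_mul_Tinv, h.Tinv_mul_T, ?_, ?_, ?_, ?_⟩
  · have := h.quadratic
    rw [hq, map_zero, sub_zero, add_mul, one_mul] at this
    subst hq
    simpa using eq_neg_of_add_eq_zero_left this
  · simpa using h.cube_comm
  · have := h.braid
    rw [gen_S2] at this
    simpa using this
  · rw [← adjoin_gen]
    refine le_antisymm (Algebra.adjoin_le ?_) (Algebra.adjoin_le ?_)
    · rintro x (rfl | rfl | rfl)
      · exact neg_mem (Algebra.subset_adjoin (by simp))
      · exact Algebra.subset_adjoin (by simp)
      · exact Algebra.subset_adjoin (by simp)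
    · rintro x (rfl | rfl | rfl)
      · rw [← neg_neg (gen k q .S1)]
        exact neg_mem (Algebra.subset_adjoin (by simp))
      · exact Algebra.subset_adjoin (by simp)
      · exact Algebra.subset_adjoin (by simp)

end HeckeAlgebra

open HeckeAlgebra

namespace HeckeMatrices

variable {k : Type*} [Field k]

/-- The matrices of the idempotents `-S₁` and `1 + S₁`. -/
def idem (X : HeckeMatrices k) (ε : Bool) : Matrix (Fin X.n) (Fin X.n) k :=
  bif ε then -X.S else 1 + X.S

section Action

variable (X : HeckeMatrices k) {q : k} (hq : q = 0)

/-- The column space, as the underlying space of the module. -/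
def toModule : (Fin X.n → k) ≃ₗ[k] X.module hq := LinearEquiv.refl k (Fin X.n → k)

theorem T_smul (x : Fin X.n → k) :
    gen k q .T • X.toModule hq x = X.toModule hq (X.T *ᵥ x) :=
  HeckeModule.gen_smul X.ops (X.ops_relations hq) .T x

theorem S_smul (x : Fin X.n → k) :
    gen k q .S1 • X.toModule hq x = X.toModule hq (X.S *ᵥ x) :=
  HeckeModule.gen_smul X.ops (X.ops_relations hq) .S1 x

theorem idem_smul (ε : Bool) (x : Fin X.n → k) :
    HeckeAlgebra.idem k q ε • X.toModule hq x = X.toModule hq (X.idem ε *ᵥ x) := by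
  cases ε
  · simp only [HeckeAlgebra.idem, HeckeMatrices.idem, cond_false, add_smul, one_smul, S_smul,
      add_mulVec, one_mulVec, map_add]
  · simp only [HeckeAlgebra.idem, HeckeMatrices.idem, cond_true, neg_smul, S_smul, neg_mulVec,
      map_neg]

/-- The vectors `v`, `w` satisfy the conditions of `IsSph` for the matrices `S` and `T`. -/
structure IsSphVec {n : ℕ} (S T : Matrix (Fin n) (Fin n) k) (z a b : k) (v w : Fin n → k) :
    Prop where
  s_v : S *ᵥ v = v
  s_tv : S *ᵥ (T *ᵥ v) = T *ᵥ v
  s_ttv : S *ᵥ (T *ᵥ (T *ᵥ v)) = T *ᵥ (T *ᵥ w)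
  s_tw : S *ᵥ (T *ᵥ w) = a • v
  s_w : z • (S *ᵥ w) = b • (T *ᵥ v)
  ttt : ∀ x, T *ᵥ (T *ᵥ (T *ᵥ x)) = z • x

theorem isSph {ε : Bool} {z a b : k} {v w : Fin X.n → k}
    (h : IsSphVec (X.idem ε) X.T z a b v w) :
    IsSph (HeckeAlgebra.idem k q ε) (gen k q .T) z a b (X.toModule hq v) (X.toModule hq w) := by
  constructor <;> simp only [T_smul, idem_smul, ← map_smul, h.s_v, h.s_tv, h.s_ttv, h.s_tw, h.s_w,
    h.ttt]

theorem isSimpleModule (h0 : X.n ≠ 0) (H : ∀ N : Submodule k (Fin X.n → k),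
      (∀ x ∈ N, X.S *ᵥ x ∈ N) → (∀ x ∈ N, X.T *ᵥ x ∈ N) → ∀ x ∈ N, x ≠ 0 → N = ⊤) :
    IsSimpleModule (HeckeAlgebra k q) (X.module hq) := by
  have : NeZero X.n := ⟨h0⟩
  have : Nontrivial (X.module hq) := inferInstanceAs (Nontrivial (Fin X.n → k))
  rw [isSimpleModule_iff]
  refine { eq_bot_or_eq_top := fun N => ?_ }
  rw [or_iff_not_imp_left]
  intro hN
  obtain ⟨x, hx, hx0⟩ := N.exists_mem_ne_zero_of_ne_bot hN
  have := H ((N.restrictScalars k).comap (X.toModule hq).toLinearMap) (fun x hx => by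
    have : gen k q .S1 • X.toModule hq x ∈ N := N.smul_mem (gen k q .S1) hx
    rwa [S_smul] at this) (fun x hx => by
    have : gen k q .T • X.toModule hq x ∈ N := N.smul_mem (gen k q .T) hx
    rwa [T_smul] at this) ((X.toModule hq).symm x) (by simpa using hx) (by simpa using hx0)
  refine eq_top_iff.2 fun y _ => ?_
  have hy : (X.toModule hq).symm y ∈ (N.restrictScalars k).comap (X.toModule hq).toLinearMap :=
    this ▸ Submodule.mem_top
  simpa using hy

end Action

/-! ### Explicit matrices -/

set_option linter.unusedSectionVars false

theorem cyc2_mulVec (y : kˣ) (a b : k) :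
    cyc2 y *ᵥ ![a, b] = ![-((y : k) ^ 2 * b), a - y * b] := by
  ext i; fin_cases i <;> simp [cyc2, Matrix.mulVec, dotProduct, Fin.sum_univ_succ] <;> ring

theorem cyc3_mulVec (z : kˣ) (a b c : k) : cyc3 z *ᵥ ![a, b, c] = ![z * c, a, b] := by
  ext i; fin_cases i <;> simp [cyc3, Matrix.mulVec, dotProduct, Fin.sum_univ_succ]

theorem cyc6_mulVec (z : kˣ) (a b c d e f : k) :
    cyc6 z *ᵥ ![a, b, c, d, e, f] = ![z * c, a, b, z * f, d, e] := by
  ext i; fin_cases i <;> simp [cyc6, Matrix.mulVec, dotProduct, Fin.sum_univ_succ]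

theorem S6_mulVec (a b c x0 x1 x2 x3 x4 x5 : k) : S6 a b c *ᵥ ![x0, x1, x2, x3, x4, x5] =
    ![0, 0, c * x4 - x2, a * x0 - x3, 0, b * x1 - x5] := by
  ext i; fin_cases i <;>
    simp [S6, Matrix.mulVec, dotProduct, Fin.sum_univ_succ] <;> ring

theorem exists_vec2 (x : Fin 2 → k) : ∃ a b, x = ![a, b] :=
  ⟨x 0, x 1, by ext i; fin_cases i <;> rfl⟩

theorem exists_vec3 (x : Fin 3 → k) : ∃ a b c, x = ![a, b, c] :=
  ⟨x 0, x 1, x 2, by ext i; fin_cases i <;> rfl⟩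

theorem exists_vec6 (x : Fin 6 → k) : ∃ a b c d e f, x = ![a, b, c, d, e, f] :=
  ⟨x 0, x 1, x 2, x 3, x 4, x 5, by ext i; fin_cases i <;> rfl⟩

/-- Being fixed by `-S6 a b c` and by its conjugate forces every coordinate but the last to vanish.
The second vector is the image of the first under `T (-S) T⁻¹`. -/
theorem isSphVec_S6_true (z : kˣ) (a b c : k) : IsSphVec (-S6 a b c) (cyc6 z) z (z * b * c)
    (z * a * c) ![0, 0, 0, 0, 0, 1] ![-(z * c), 0, 0, 0, 0, 0] := by
  constructor
  case ttt =>
    intro x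
    obtain ⟨_, _, _, _, _, _, rfl⟩ := exists_vec6 x
    simp [cyc6_mulVec]
  all_goals simp [neg_mulVec, cyc6_mulVec, S6_mulVec, mul_comm, mul_left_comm]

/-- The conditions `S x = 0` and `S T x = 0` leave only the first coordinate free, and setting it to
`1` gives the vector. The scalars agree with those of `isSphVec_S6_true`, so a single family in the
list covers both idempotents. -/
theorem isSphVec_S6_false (z : kˣ) (a b c : k) :
    IsSphVec (1 + S6 a b c) (cyc6 z) z (z * b * c) (z * a * c)
    ![1, a * c, b * c, a, b, a * b * c] ![z * a * b * c ^ 2, a * c, b * c, z * b ^ 2 * c,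
      a ^ 2 * c, a * b * c] := by
  constructor
  case ttt =>
    intro x
    obtain ⟨_, _, _, _, _, _, rfl⟩ := exists_vec6 x
    simp [cyc6_mulVec]
  all_goals simp [add_mulVec, cyc6_mulVec, S6_mulVec]
  all_goals ring_nf
  all_goals simp

end HeckeMatrices

end

noncomputable section

open Matrix HeckeAlgebra

namespace HeckeMatrices

variable {k : Type*} [Field k]

theorem mulVec2 (a b c d x y : k) : !![a, b; c, d] *ᵥ ![x, y] =
    ![a * x + b * y, c * x + d * y] := by
  ext i; fin_cases i <;> simp [Matrix.mulVec, dotProduct, Fin.sum_univ_succ]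

theorem mulVec3 (a b c d e f g h i x y z : k) :
    !![a, b, c; d, e, f; g, h, i] *ᵥ ![x, y, z] =
      ![a * x + b * y + c * z, d * x + e * y + f * z, g * x + h * y + i * z] := by
  ext i; fin_cases i <;> simp [Matrix.mulVec, dotProduct, Fin.sum_univ_succ, add_assoc]

theorem cyc3_ttt (z : kˣ) (x : Fin 3 → k) :
    cyc3 z *ᵥ (cyc3 z *ᵥ (cyc3 z *ᵥ x)) = (z : k) • x := by
  obtain ⟨_, _, _, rfl⟩ := exists_vec3 x
  simp [cyc3_mulVec]

/-! ### Spherical vectors in the three- and one-dimensional modules. -/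

section Spherical

variable (z y : kˣ)

theorem isSphVec_M3 : IsSphVec (1 + !![0, 0, 0; 0, 0, 0; 0, (y : k)⁻¹, -1]) (cyc3 z) z ((z : k) / y ^ 2) ((z : k) / y)
    ![1, (y : k)⁻¹, (y : k)⁻¹ ^ 2] ![z * (y : k)⁻¹ ^ 3, (y : k)⁻¹, (y : k)⁻¹ ^ 2] := by
  have hy : (y : k) ≠ 0 := y.ne_zero
  constructor
  case ttt => exact cyc3_ttt z
  all_goals simp only [add_mulVec, one_mulVec, cyc3_mulVec, mulVec3]
  all_goals (ext i; fin_cases i <;> simp <;> field_simp)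

theorem isSphVec_M3t : IsSphVec (-!![-1, 0, 0; 0, 0, 0; 0, -(y : k)⁻¹, -1]) (cyc3 z) z ((z : k) / y ^ 2) ((z : k) / y)
    ![0, 0, 1] ![z * (y : k)⁻¹, 0, 0] := by
  have hy : (y : k) ≠ 0 := y.ne_zero
  constructor
  case ttt => exact cyc3_ttt z
  all_goals simp only [neg_mulVec, cyc3_mulVec, mulVec3]
  all_goals (ext i; fin_cases i <;> simp <;> field_simp)

theorem isSphVec_N3 : IsSphVec (-!![-1, 0, 0; 0, 0, -(y : k); 0, 0, -1]) (cyc3 z) z (y : k) ((y : k) ^ 2)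
    ![(y : k) ^ 2, y, 1] ![(y : k) ^ 2, y, y ^ 3 * (z : k)⁻¹] := by
  have hz : (z : k) ≠ 0 := z.ne_zero
  constructor
  case ttt => exact cyc3_ttt z
  all_goals simp only [neg_mulVec, cyc3_mulVec, mulVec3]
  all_goals (ext i; fin_cases i <;> simp <;> field_simp)

theorem isSphVec_N3t : IsSphVec (1 + !![0, 0, 0; 0, 0, (y : k); 0, 0, -1]) (cyc3 z) z (y : k) ((y : k) ^ 2)
    ![1, 0, 0] ![0, 0, y * (z : k)⁻¹] := by
  have hz : (z : k) ≠ 0 := z.ne_zero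
  constructor
  case ttt => exact cyc3_ttt z
  all_goals simp only [add_mulVec, one_mulVec, cyc3_mulVec, mulVec3]
  all_goals (ext i; fin_cases i <;> simp <;> field_simp)

theorem isSphVec_P3 : IsSphVec (1 + !![0, 0, 0; 0, 0, 0; 0, 0, -1]) (cyc3 z) z (0 : k) 0 ![1, 0, 0] 0 := by
  constructor
  case ttt => exact cyc3_ttt z
  all_goals simp only [add_mulVec, one_mulVec, cyc3_mulVec, mulVec3]
  all_goals (ext i; fin_cases i <;> simp [cyc3, Matrix.mulVec, dotProduct])

theorem isSphVec_P3t : IsSphVec (-!![-1, 0, 0; 0, 0, 0; 0, 0, -1]) (cyc3 z) z (0 : k) 0 ![0, 0, 1] 0 := by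
  constructor
  case ttt => exact cyc3_ttt z
  all_goals simp only [neg_mulVec, cyc3_mulVec, mulVec3]
  all_goals (ext i; fin_cases i <;> simp [cyc3, Matrix.mulVec, dotProduct])

theorem isSphVec_M1zero : IsSphVec (1 + (0 : Matrix (Fin 1) (Fin 1) k)) ((y : k) • 1) ((y : k) ^ 3) (y : k) (y ^ 2)
    (fun _ => 1) (fun _ => 1) := by
  constructor <;> simp [smul_mulVec, smul_smul, pow_succ, mul_assoc]

theorem isSphVec_M1neg : IsSphVec (-(-1 : Matrix (Fin 1) (Fin 1) k)) ((y : k) • 1) ((y : k) ^ 3) (y : k) (y ^ 2)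
    (fun _ => 1) (fun _ => 1) := by
  constructor <;> simp [smul_mulVec, smul_smul, pow_succ, mul_assoc]

end Spherical

/-! ### Irreducibility of the explicit matrices. -/

section Simple

theorem eq_top_of_e0 {z : kˣ} {N : Submodule k (Fin 3 → k)} (hT : ∀ x ∈ N, cyc3 z *ᵥ x ∈ N)
    (h : ![1, 0, 0] ∈ N) : N = ⊤ := by
  have h1 := hT _ h
  have h2 := hT _ h1
  simp only [cyc3_mulVec, mul_zero] at h1 h2
  refine eq_top_iff.2 fun x _ => ?_
  obtain ⟨a, b, c, rfl⟩ := exists_vec3 x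
  have := N.add_mem (N.add_mem (N.smul_mem a h) (N.smul_mem b h1)) (N.smul_mem c h2)
  simpa using this

theorem eq_top_of_e2 {z : kˣ} {N : Submodule k (Fin 3 → k)} (hT : ∀ x ∈ N, cyc3 z *ᵥ x ∈ N)
    {c : k} (hc : c ≠ 0) (h : ![0, 0, c] ∈ N) : N = ⊤ := by
  have h1 := N.smul_mem ((z : k) * c)⁻¹ (hT _ h)
  refine eq_top_of_e0 hT ?_
  have e : c⁻¹ * (z : k)⁻¹ * (z * c) = 1 := by
    have := z.ne_zero
    field_simp
  simpa [cyc3_mulVec, hc, e] using h1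

theorem eq_top_of_e1 {z : kˣ} {N : Submodule k (Fin 3 → k)} (hT : ∀ x ∈ N, cyc3 z *ᵥ x ∈ N)
    {c : k} (hc : c ≠ 0) (h : ![0, c, 0] ∈ N) : N = ⊤ := by
  have h1 := hT _ h
  rw [cyc3_mulVec, mul_zero] at h1
  exact eq_top_of_e2 hT hc h1

/-- A subspace stable under an invertible-or-not operator `T` and a rank one operator
`x ↦ l x • v₀`, where `l` vanishes on no `T`-orbit, contains `v₀`. -/
theorem mem_of_rank_one {n : ℕ} {T R : Matrix (Fin n) (Fin n) k} {N : Submodule k (Fin n → k)}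
    (hT : ∀ x ∈ N, T *ᵥ x ∈ N) (hR : ∀ x ∈ N, R *ᵥ x ∈ N) (l : (Fin n → k) → k) {v₀ : Fin n → k}
    (hl : ∀ x, R *ᵥ x = l x • v₀)
    (h0 : ∀ x, l x = 0 → l (T *ᵥ x) = 0 → l (T *ᵥ (T *ᵥ x)) = 0 → x = 0) {x : Fin n → k}
    (hx : x ∈ N) (hx0 : x ≠ 0) : v₀ ∈ N := by
  have key {y : Fin n → k} (hy : y ∈ N) (hly : l y ≠ 0) : v₀ ∈ N := by
    have := N.smul_mem (l y)⁻¹ (hR y hy)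
    rwa [hl, inv_smul_smul₀ hly] at this
  by_contra hv
  exact hx0 (h0 x (by_contra fun h => hv (key hx h)) (by_contra fun h => hv (key (hT x hx) h))
    (by_contra fun h => hv (key (hT _ (hT x hx)) h)))

/-- The only subspaces stable under `S` and `T` are `0` and the whole space. -/
def IsIrred {n : ℕ} (S T : Matrix (Fin n) (Fin n) k) : Prop :=
  ∀ N : Submodule k (Fin n → k), (∀ x ∈ N, S *ᵥ x ∈ N) → (∀ x ∈ N, T *ᵥ x ∈ N) →
    ∀ x ∈ N, x ≠ 0 → N = ⊤

theorem one_add_mulVec_mem {n : ℕ} {S : Matrix (Fin n) (Fin n) k} {N : Submodule k (Fin n → k)}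
    (hS : ∀ x ∈ N, S *ᵥ x ∈ N) : ∀ x ∈ N, (1 + S) *ᵥ x ∈ N := fun x hx => by
  rw [add_mulVec, one_mulVec]
  exact N.add_mem hx (hS x hx)

theorem isIrred_one (S T : Matrix (Fin 1) (Fin 1) k) : IsIrred S T := by
  intro N _ _ x hx hx0
  have h0 : x 0 ≠ 0 := fun h => hx0 (by ext i; fin_cases i; exact h)
  refine eq_top_iff.2 fun w _ => ?_
  have := N.smul_mem (w 0 * (x 0)⁻¹) hx
  have e : w = (w 0 * (x 0)⁻¹) • x := by ext i; fin_cases i; simp [h0]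
  rw [e]; exact this

theorem isIrred_M2 (y : kˣ) :
    IsIrred !![-1, 0; 0, 0] (cyc2 y) := by
  have hy : (y : k) ≠ 0 := y.ne_zero
  intro N hS hT x hx hx0
  have h0 : (![-1, 0] : Fin 2 → k) ∈ N := by
    refine mem_of_rank_one hT hS (fun x : Fin 2 → k => x 0) ?_ ?_ hx hx0
    · intro x
      obtain ⟨a, b, rfl⟩ := exists_vec2 x
      simp only [mulVec2]
      ext i; fin_cases i <;> simp
    · intro x h1 h2 _
      obtain ⟨a, b, rfl⟩ := exists_vec2 x
      change (cyc2 y *ᵥ _) 0 = _ at h2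
      simp only [cyc2_mulVec] at h2
      simp [hy] at h1 h2
      simp [h1, h2]
  have h1 : cyc2 y *ᵥ ![-1, 0] ∈ N := hT _ h0
  rw [cyc2_mulVec] at h1
  refine eq_top_iff.2 fun (x : Fin 2 → k) _ => ?_
  obtain ⟨a, b, rfl⟩ := exists_vec2 x
  simpa using N.add_mem (N.smul_mem (-a) h0) (N.smul_mem (-b) h1)

theorem isIrred_M2t (y : kˣ) :
    IsIrred !![0, 0; 0, -1] (cyc2 y) := by
  have hy : (y : k) ≠ 0 := y.ne_zero
  intro N hS hT x hx hx0
  have hR := one_add_mulVec_mem hS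
  have h0 : (![1, 0] : Fin 2 → k) ∈ N := by
    refine mem_of_rank_one hT hR (fun x : Fin 2 → k => x 0) ?_ ?_ hx hx0
    · intro x
      obtain ⟨a, b, rfl⟩ := exists_vec2 x
      simp only [add_mulVec, one_mulVec, mulVec2]
      ext i; fin_cases i <;> simp
    · intro x h1 h2 _
      obtain ⟨a, b, rfl⟩ := exists_vec2 x
      change (cyc2 y *ᵥ _) 0 = _ at h2
      simp only [cyc2_mulVec] at h2
      simp [hy] at h1 h2
      simp [h1, h2]
  have h1 : cyc2 y *ᵥ ![1, 0] ∈ N := hT _ h0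
  rw [cyc2_mulVec] at h1
  refine eq_top_iff.2 fun (x : Fin 2 → k) _ => ?_
  obtain ⟨a, b, rfl⟩ := exists_vec2 x
  simpa using N.add_mem (N.smul_mem a h0) (N.smul_mem b h1)

theorem isIrred_P3 (z : kˣ) :
    IsIrred !![0, 0, 0; 0, 0, 0; 0, 0, -1] (cyc3 z) := by
  intro N hS hT x hx hx0
  refine eq_top_of_e2 hT (neg_ne_zero.2 one_ne_zero) ?_
  refine mem_of_rank_one hT hS (fun x : Fin 3 → k => x 2) ?_ ?_ hx hx0
  · intro x
    obtain ⟨a, b, c, rfl⟩ := exists_vec3 x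
    simp only [mulVec3]
    ext i; fin_cases i <;> simp
  · intro x h1 h2 h3
    obtain ⟨a, b, c, rfl⟩ := exists_vec3 x
    change (cyc3 z *ᵥ _) 2 = _ at h2
    change (cyc3 z *ᵥ (cyc3 z *ᵥ _)) 2 = _ at h3
    simp [cyc3_mulVec] at h1 h2 h3
    simp [h1, h2, h3]

theorem isIrred_P3t (z : kˣ) :
    IsIrred !![-1, 0, 0; 0, 0, 0; 0, 0, -1] (cyc3 z) := by
  intro N hS hT x hx hx0
  have hR := one_add_mulVec_mem hS
  refine eq_top_of_e1 hT one_ne_zero ?_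
  refine mem_of_rank_one hT hR (fun x : Fin 3 → k => x 1) ?_ ?_ hx hx0
  · intro x
    obtain ⟨a, b, c, rfl⟩ := exists_vec3 x
    simp only [add_mulVec, one_mulVec, mulVec3]
    ext i; fin_cases i <;> simp
  · intro x h1 h2 h3
    obtain ⟨a, b, c, rfl⟩ := exists_vec3 x
    change (cyc3 z *ᵥ _) 1 = _ at h2
    change (cyc3 z *ᵥ (cyc3 z *ᵥ _)) 1 = _ at h3
    simp [cyc3_mulVec] at h1 h2 h3
    simp [h1, h2, h3]

/-- The matrix `S` has rank one. Its functional, pulled back by `1`, `T`, `T²`, gives three linear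
equations whose only solution is zero as soon as `y³ ≠ z`. The argument for `isIrred_N3` is the same
with `1 + S`. -/
theorem isIrred_M3 (z y : kˣ) (h : (y : k) ^ 3 ≠ z) :
    IsIrred !![0, 0, 0; 0, 0, 0; 0, (y : k)⁻¹, -1] (cyc3 z) := by
  have hy : (y : k) ≠ 0 := y.ne_zero
  intro N hS hT x hx hx0
  refine eq_top_of_e2 hT one_ne_zero ?_
  refine mem_of_rank_one hT hS (fun x : Fin 3 → k => (y : k)⁻¹ * x 1 - x 2) ?_ ?_ hx hx0
  · intro x
    obtain ⟨a, b, c, rfl⟩ := exists_vec3 x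
    simp only [mulVec3]
    ext i; fin_cases i <;> simp <;> ring
  · intro x h1 h2 h3
    obtain ⟨a, b, c, rfl⟩ := exists_vec3 x
    change (y : k)⁻¹ * (cyc3 z *ᵥ _) 1 - (cyc3 z *ᵥ _) 2 = _ at h2
    change (y : k)⁻¹ * (cyc3 z *ᵥ (cyc3 z *ᵥ _)) 1 - (cyc3 z *ᵥ (cyc3 z *ᵥ _)) 2 = _ at h3
    simp only [cyc3_mulVec] at h2 h3
    simp [sub_eq_zero] at h1 h2 h3
    field_simp at h1 h2 h3
    have hc : c = 0 := by
      have : ((y : k) ^ 3 - z) * c = 0 := by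
        linear_combination (-(y : k) ^ 2) * h1 - (y : k) * h2 - h3
      exact (mul_eq_zero.1 this).resolve_left (sub_ne_zero.2 h)
    simp [hc] at h1
    simp [h1] at h2
    simp [hc, h1, h2]

/-- Here the functional of the rank-one matrix `1 + S` is a coordinate, so its pullbacks by `T`
separate vectors for every `y`. The condition `y³ ≠ z` serves to show that the image vector `v₀`
generates: `(y² + y T + T²) v₀` is a multiple of one basis vector, nonzero exactly when `y³ ≠ z`.
`isIrred_N3t` is parallel. -/
theorem isIrred_M3t (z y : kˣ) (h : (y : k) ^ 3 ≠ z) :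
    IsIrred !![-1, 0, 0; 0, 0, 0; 0, -(y : k)⁻¹, -1] (cyc3 z) := by
  have hy : (y : k) ≠ 0 := y.ne_zero
  intro N hS hT x hx hx0
  have hR := one_add_mulVec_mem hS
  have h0 : (![0, 1, -(y : k)⁻¹] : Fin 3 → k) ∈ N := by
    refine mem_of_rank_one hT hR (fun x : Fin 3 → k => x 1) ?_ ?_ hx hx0
    · intro x
      obtain ⟨a, b, c, rfl⟩ := exists_vec3 x
      simp only [add_mulVec, one_mulVec, mulVec3]
      ext i; fin_cases i <;> simp <;> ring
    · intro x h1 h2 h3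
      obtain ⟨a, b, c, rfl⟩ := exists_vec3 x
      change (cyc3 z *ᵥ _) 1 = _ at h2
      change (cyc3 z *ᵥ (cyc3 z *ᵥ _)) 1 = _ at h3
      simp [cyc3_mulVec] at h1 h2 h3
      simp [h1, h2, h3]
  have h1 : cyc3 z *ᵥ ![0, 1, -(y : k)⁻¹] ∈ N := hT _ h0
  have h2 : cyc3 z *ᵥ (cyc3 z *ᵥ ![0, 1, -(y : k)⁻¹]) ∈ N := hT _ h1
  simp only [cyc3_mulVec] at h1 h2
  have := N.add_mem (N.add_mem (N.smul_mem ((y : k) ^ 2) h0) (N.smul_mem (y : k) h1)) h2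
  refine eq_top_of_e1 hT (c := (y : k) ^ 2 - z * (y : k)⁻¹) ?_ ?_
  · intro h0
    apply h
    field_simp at h0
    linear_combination h0
  · convert this using 1
    ext i; fin_cases i <;> simp <;> field_simp <;> ring

theorem isIrred_N3 (z y : kˣ) (h : (y : k) ^ 3 ≠ z) :
    IsIrred !![-1, 0, 0; 0, 0, -(y : k); 0, 0, -1] (cyc3 z) := by
  have hy : (y : k) ≠ 0 := y.ne_zero
  intro N hS hT x hx hx0
  have hR := one_add_mulVec_mem hS
  refine eq_top_of_e1 hT one_ne_zero ?_
  refine mem_of_rank_one hT hR (fun x : Fin 3 → k => x 1 - y * x 2) ?_ ?_ hx hx0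
  · intro x
    obtain ⟨a, b, c, rfl⟩ := exists_vec3 x
    simp only [add_mulVec, one_mulVec, mulVec3]
    ext i; fin_cases i <;> simp <;> ring
  · intro x h1 h2 h3
    obtain ⟨a, b, c, rfl⟩ := exists_vec3 x
    change (cyc3 z *ᵥ _) 1 - (y : k) * (cyc3 z *ᵥ _) 2 = _ at h2
    change (cyc3 z *ᵥ (cyc3 z *ᵥ _)) 1 - (y : k) * (cyc3 z *ᵥ (cyc3 z *ᵥ _)) 2 = _ at h3
    simp only [cyc3_mulVec] at h2 h3
    simp [sub_eq_zero] at h1 h2 h3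
    have hc : c = 0 := by
      have : ((y : k) ^ 3 - z) * c = 0 := by
        linear_combination (-(y : k) ^ 2) * h1 - (y : k) * h2 - h3
      exact (mul_eq_zero.1 this).resolve_left (sub_ne_zero.2 h)
    simp [hc] at h1
    simp [h1] at h2
    simp [hc, h1, h2]

theorem isIrred_N3t (z y : kˣ) (h : (y : k) ^ 3 ≠ z) :
    IsIrred !![0, 0, 0; 0, 0, (y : k); 0, 0, -1] (cyc3 z) := by
  have hy : (y : k) ≠ 0 := y.ne_zero
  intro N hS hT x hx hx0
  have h0 : (![0, (y : k), -1] : Fin 3 → k) ∈ N := by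
    refine mem_of_rank_one hT hS (fun x : Fin 3 → k => x 2) ?_ ?_ hx hx0
    · intro x
      obtain ⟨a, b, c, rfl⟩ := exists_vec3 x
      simp only [mulVec3]
      ext i; fin_cases i <;> simp <;> ring
    · intro x h1 h2 h3
      obtain ⟨a, b, c, rfl⟩ := exists_vec3 x
      change (cyc3 z *ᵥ _) 2 = _ at h2
      change (cyc3 z *ᵥ (cyc3 z *ᵥ _)) 2 = _ at h3
      simp [cyc3_mulVec] at h1 h2 h3
      simp [h1, h2, h3]
  have h1 : cyc3 z *ᵥ ![0, (y : k), -1] ∈ N := hT _ h0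
  have h2 : cyc3 z *ᵥ (cyc3 z *ᵥ ![0, (y : k), -1]) ∈ N := hT _ h1
  simp only [cyc3_mulVec] at h1 h2
  have := N.add_mem (N.add_mem (N.smul_mem ((y : k) ^ 2) h0) (N.smul_mem (y : k) h1)) h2
  refine eq_top_of_e1 hT (c := (y : k) ^ 3 - z) (sub_ne_zero.2 h) ?_
  convert this using 1
  ext i; fin_cases i <;> simp <;> ring

/-- Up to the factor `-z`, the product `S T² S T S` is the corner idempotent of `-S`; it has rank
one with image the line of the last basis vector. If `N` misses that vector, the functional `l`
vanishes on `N`. At `x`, `T S x`, `T² S x` this gives a linear system in the three nonzero rows of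
`S x`, and the inequalities force `S x = 0` on `N`. Then `S x = S T x = S T² x = 0` forces `x = 0`.
-/
theorem isIrred_S6 (z : kˣ) (a b c : k) (hc : c ≠ 0) (h1 : b - a ^ 2 * c ≠ 0)
    (h2 : b ^ 2 * c * z - a ≠ 0) : IsIrred (S6 a b c) (cyc6 z) := by
  intro N hS hT x hx hx0
  have hz : (z : k) ≠ 0 := z.ne_zero
  let l : (Fin 6 → k) → k := fun x => b * c * (a * x 0 - x 3) - a * (c * x 4 - x 2) +
    (b * x 1 - x 5)
  have he (x : Fin 6 → k) : S6 a b c *ᵥ (cyc6 z *ᵥ (cyc6 z *ᵥ (S6 a b c *ᵥ (cyc6 z *ᵥ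
      (S6 a b c *ᵥ x))))) = (z * l x) • ![0, 0, 0, 0, 0, 1] := by
    obtain ⟨x0, x1, x2, x3, x4, x5, rfl⟩ := exists_vec6 x
    simp [cyc6_mulVec, S6_mulVec, l]
    ring
  have key : ![0, 0, 0, 0, 0, 1] ∈ N := by
    by_contra hv
    have hl {x : Fin 6 → k} (hx : x ∈ N) : l x = 0 := by
      by_contra h0
      apply hv
      have := N.smul_mem (z * l x)⁻¹ (hS _ (hT _ (hT _ (hS _ (hT _ (hS _ hx))))))
      rwa [he, inv_smul_smul₀ (mul_ne_zero hz h0)] at this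
    have habc {x0 x1 x2 x3 x4 x5 : k} (hx : ![x0, x1, x2, x3, x4, x5] ∈ N) :
        a * x0 - x3 = 0 ∧ c * x4 - x2 = 0 ∧ b * x1 - x5 = 0 := by
      have e0 := hl hx
      have e1 := hl (hT _ (hS _ hx))
      have e2 := hl (hT _ (hT _ (hS _ hx)))
      simp [cyc6_mulVec, S6_mulVec, l] at e0 e1 e2
      have hA : a * x0 - x3 = 0 := by
        have : c * (b ^ 2 * c * z - a) * (a * x0 - x3) = 0 := by
          linear_combination b * c * z * e0 + e1
        exact (mul_eq_zero.1 this).resolve_left (mul_ne_zero hc h2)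
      have hB : c * x4 - x2 = 0 := by
        have : z * (b - a ^ 2 * c) * (c * x4 - x2) = 0 := by
          linear_combination a * c * z * e0 + e2 - (a * c * z * b * c - 1) * hA
        exact (mul_eq_zero.1 this).resolve_left (mul_ne_zero hz h1)
      refine ⟨hA, hB, ?_⟩
      linear_combination e0 - b * c * hA + a * hB
    obtain ⟨x0, x1, x2, x3, x4, x5, rfl⟩ := exists_vec6 x
    have e1 := hT _ hx
    have e2 := hT _ e1
    simp only [cyc6_mulVec] at e1 e2
    obtain ⟨p1, p2, p3⟩ := habc hx
    obtain ⟨p4, p5, p6⟩ := habc e1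
    obtain ⟨p7, p8, p9⟩ := habc e2
    have p7' : a * x1 - x4 = 0 :=
      (mul_eq_zero.1 (show (z : k) * (a * x1 - x4) = 0 by linear_combination p7)).resolve_left hz
    have q0 : x0 = 0 := by
      have : (b - a ^ 2 * c) * x0 = 0 := by
        linear_combination p6 - p7' - a * p5 - a * c * p1
      exact (mul_eq_zero.1 this).resolve_left h1
    have q3 : x3 = 0 := by linear_combination a * q0 - p1
    have q1 : x1 = 0 := by linear_combination c * q3 - p5
    have q4 : x4 = 0 := by linear_combination a * q1 - p7'
    have q2 : x2 = 0 := by linear_combination c * q4 - p2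
    have q5 : x5 = 0 := by linear_combination b * q1 - p3
    subst q0 q1 q2 q3 q4 q5
    exact hx0 (by ext i; fin_cases i <;> rfl)
  -- The last vector generates: `T` moves it through the second block, and `S` then reaches the
  -- first block because `c ≠ 0`.
  have m2 := hT _ key
  have m3 := hT _ m2
  have m4 := hS _ m3
  have m5 := hT _ m4
  have m6 := hT _ m5
  simp only [cyc6_mulVec, S6_mulVec, mul_zero, mul_one, sub_zero] at m2 m3 m4 m5 m6
  refine eq_top_iff.2 fun x _ => ?_
  obtain ⟨x0, x1, x2, x3, x4, x5, rfl⟩ := exists_vec6 x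
  have := N.add_mem (N.add_mem (N.add_mem (N.add_mem (N.add_mem (N.smul_mem x5 key)
    (N.smul_mem (x3 * (z : k)⁻¹) m2)) (N.smul_mem (x4 * (z : k)⁻¹) m3))
    (N.smul_mem (x2 * (c * z)⁻¹) m4)) (N.smul_mem (x0 * (c * z * z)⁻¹) m5))
    (N.smul_mem (x1 * (c * z * z)⁻¹) m6)
  convert this using 1
  ext i; fin_cases i <;> simp <;> field_simp

end Simple

end HeckeMatrices

end

/-! ### Invariants of simple modules. -/

noncomputable section

open Matrix HeckeAlgebra

/-- The invariants of a simple module at `q = 0`. -/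
inductive HeckeInv (k : Type*) : Type _
  | sph (ε : Bool) (z a b : k)
  | two (ε : Bool) (y : k)

namespace HeckeInv

variable {k V V' : Type*} [Field k] {q : k} [AddCommGroup V] [Module k V]
  [Module (HeckeAlgebra k q) V] [IsScalarTower k (HeckeAlgebra k q) V] [AddCommGroup V']
  [Module k V'] [Module (HeckeAlgebra k q) V'] [IsScalarTower k (HeckeAlgebra k q) V']

/-- The module `V` has a vector with the prescribed invariants. -/
def Realizes (q : k) (V : Type*) [AddCommGroup V] [Module k V] [Module (HeckeAlgebra k q) V] :
    HeckeInv k → Prop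
  | sph ε z a b => z ≠ 0 ∧ ∃ v w : V, v ≠ 0 ∧ IsSph (idem k q ε) (gen k q .T) z a b v w
  | two ε y => y ≠ 0 ∧ ∃ v : V, v ≠ 0 ∧ IsTwo (idem k q ε) (gen k q .T) y v

theorem Realizes.congr {I : HeckeInv k} (h : Realizes q V I) (f : V ≃ₗ[HeckeAlgebra k q] V') :
    Realizes q V' I := by
  cases I with
  | sph ε z a b =>
    obtain ⟨hz, v, w, hv, D⟩ := h
    exact ⟨hz, f v, f w, by simpa using hv, D.map f.toLinearMap⟩
  | two ε y =>
    obtain ⟨hz, v, hv, D⟩ := h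
    exact ⟨hz, f v, by simpa using hv, D.map f.toLinearMap⟩

theorem exists_realizes [IsAlgClosed k] (hq : q = 0) [IsSimpleModule (HeckeAlgebra k q) V] :
    ∃ I, Realizes q V I := by
  rcases (isZeroHecke hq true).exists_isSph_or_isTwo (V := V) with
    ⟨z, a, b, v, w, hz, hv, D⟩ | ⟨z, a, b, v, w, hz, hv, D⟩ | ⟨y, v, hy, hv, D⟩ |
    ⟨y, v, hy, hv, D⟩
  · exact ⟨sph true z a b, hz, v, w, hv, D⟩
  · rw [one_sub_idem] at D
    exact ⟨sph false z a b, hz, v, w, hv, D⟩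
  · exact ⟨two true y, hy, v, hv, D⟩
  · rw [one_sub_idem] at D
    exact ⟨two false y, hy, v, hv, D⟩

theorem Realizes.nonempty_linearEquiv (hq : q = 0) [IsSimpleModule (HeckeAlgebra k q) V]
    [IsSimpleModule (HeckeAlgebra k q) V'] {I : HeckeInv k} (h : Realizes q V I)
    (h' : Realizes q V' I) : Nonempty (V ≃ₗ[HeckeAlgebra k q] V') := by
  cases I with
  | sph ε z a b =>
    obtain ⟨hz, v, w, hv, D⟩ := h
    obtain ⟨_, v', w', hv', D'⟩ := h'
    exact D.nonempty_linearEquiv (isZeroHecke hq ε) D' hz hv hv'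
  | two ε y =>
    obtain ⟨hz, v, hv, D⟩ := h
    obtain ⟨_, v', hv', D'⟩ := h'
    exact D.nonempty_linearEquiv (isZeroHecke hq ε) D' hz hv hv'

end HeckeInv

/-! ### Which invariants the explicit modules do not have. -/

namespace HeckeMatrices

variable {k : Type*} [Field k]

/-- There is no nonzero vector fixed by `S` and `T⁻¹ S T`. -/
def NoFixed {n : ℕ} (S T : Matrix (Fin n) (Fin n) k) : Prop :=
  ∀ x, S *ᵥ x = x → S *ᵥ (T *ᵥ x) = T *ᵥ x → x = 0

theorem noFixed_M1zero (T : Matrix (Fin 1) (Fin 1) k) :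
    NoFixed (-(0 : Matrix (Fin 1) (Fin 1) k)) T := by
  intro x h _
  simpa using h.symm

theorem noFixed_M2_true (y : kˣ) : NoFixed (-!![-1, 0; 0, 0]) (cyc2 y) := by
  intro x h1 h2
  obtain ⟨a, b, rfl⟩ := exists_vec2 x
  simp only [cyc2_mulVec, neg_mulVec, mulVec2] at h1 h2
  simp at h1 h2
  subst h1
  simp at h2
  simp [h2]

theorem noFixed_M2_false (y : kˣ) : NoFixed (1 + !![-1, 0; 0, 0]) (cyc2 y) := by
  intro x h1 h2
  obtain ⟨a, b, rfl⟩ := exists_vec2 x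
  simp only [cyc2_mulVec, add_mulVec, one_mulVec, mulVec2] at h1 h2
  simp at h1 h2
  simp [h1, h2]

theorem noFixed_M2t_true (y : kˣ) : NoFixed (-!![0, 0; 0, -1]) (cyc2 y) := by
  intro x h1 h2
  obtain ⟨a, b, rfl⟩ := exists_vec2 x
  simp only [cyc2_mulVec, neg_mulVec, mulVec2] at h1 h2
  simp at h1 h2
  simp [h1, h2]

theorem noFixed_M2t_false (y : kˣ) : NoFixed (1 + !![0, 0; 0, -1]) (cyc2 y) := by
  intro x h1 h2
  obtain ⟨a, b, rfl⟩ := exists_vec2 x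
  simp only [cyc2_mulVec, add_mulVec, one_mulVec, mulVec2] at h1 h2
  simp at h1 h2
  obtain rfl := h1
  simp at h2
  simp [h2]

theorem noFixed_M3 (z y : kˣ) : NoFixed (-!![0, 0, 0; 0, 0, 0; 0, (y : k)⁻¹, -1]) (cyc3 z) := by
  intro x h1 h2
  obtain ⟨a, b, c, rfl⟩ := exists_vec3 x
  simp only [cyc3_mulVec, neg_mulVec, mulVec3] at h1 h2
  have e0 := congrFun h1 0
  have e1 := congrFun h1 1
  have e2 := congrFun h2 0
  simp at e0 e1 e2
  simp [← e0, ← e1, e2]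

theorem noFixed_N3t (z y : kˣ) :
    NoFixed (-!![0, 0, 0; 0, 0, (y : k); 0, 0, -1]) (cyc3 z) := by
  intro x h1 h2
  obtain ⟨a, b, c, rfl⟩ := exists_vec3 x
  simp only [cyc3_mulVec, neg_mulVec, mulVec3] at h1 h2
  have e0 := congrFun h1 0
  have e1 := congrFun h1 1
  have e2 := congrFun h2 0
  simp at e0 e1 e2
  subst e2
  simp at e1
  simp [← e0, ← e1]

theorem noFixed_P3 (z : kˣ) : NoFixed (-!![0, 0, 0; 0, 0, 0; 0, 0, (-1 : k)]) (cyc3 z) := by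
  intro x h1 h2
  obtain ⟨a, b, c, rfl⟩ := exists_vec3 x
  simp only [cyc3_mulVec, neg_mulVec, mulVec3] at h1 h2
  simp at h1 h2
  simp [← h1.1, ← h1.2, h2.1]

variable {q : k} (hq : q = 0)

theorem not_isSph (X : HeckeMatrices k) (ε : Bool) (h : NoFixed (X.idem ε) X.T) {z a b : k}
    {v w : X.module hq} (hv : v ≠ 0)
    (D : IsSph (HeckeAlgebra.idem k q ε) (gen k q .T) z a b v w) : False := by
  obtain ⟨x, rfl⟩ := (X.toModule hq).surjective v
  apply hv
  rw [h x, map_zero]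
  · apply (X.toModule hq).injective
    rw [← idem_smul, D.s_v]
  · apply (X.toModule hq).injective
    rw [← idem_smul, ← T_smul, D.s_tv]

/-- The vector `v` satisfies the conditions of `IsTwo` for the matrices `S` and `T`. -/
structure IsTwoVec {n : ℕ} (S T : Matrix (Fin n) (Fin n) k) (y : k) (v : Fin n → k) : Prop where
  s_v : S *ᵥ v = v
  s_tv : S *ᵥ (T *ᵥ v) = 0
  tt_v : T *ᵥ (T *ᵥ v) = -(y ^ 2 • v) - y • (T *ᵥ v)

theorem isTwo_iff (X : HeckeMatrices k) {ε : Bool} {y : k} {v : Fin X.n → k} :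
    IsTwo (HeckeAlgebra.idem k q ε) (gen k q .T) y (X.toModule hq v) ↔
      IsTwoVec (X.idem ε) X.T y v := by
  constructor
  · rintro ⟨h1, h2, h3⟩
    simp only [T_smul, idem_smul, ← map_smul, ← map_neg, ← map_sub, EmbeddingLike.apply_eq_iff_eq,
      EmbeddingLike.map_eq_zero_iff] at h1 h2 h3
    exact ⟨h1, h2, h3⟩
  · rintro ⟨h1, h2, h3⟩
    constructor
    · rw [idem_smul, h1]
    · rw [T_smul, idem_smul, h2, map_zero]
    · simp only [T_smul, ← map_smul, ← map_neg, ← map_sub, h3]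

section Two

variable {S : Matrix (Fin 2) (Fin 2) k} {y : kˣ}

theorem isTwoVec_cyc2 (hS : ∀ a b, S *ᵥ ![a, b] = ![a, 0]) :
    IsTwoVec S (cyc2 y) (y : k) ![1, 0] := by
  constructor
  · rw [hS]
  · rw [cyc2_mulVec, hS]; simp
  · rw [cyc2_mulVec, cyc2_mulVec]
    ext i; fin_cases i <;> simp

theorem isTwoVec_cyc2_unique (hS : ∀ a b, S *ᵥ ![a, b] = ![a, 0]) {y' : k} {v : Fin 2 → k}
    (hv : v ≠ 0) (h : IsTwoVec S (cyc2 y) y' v) : y' = y := by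
  obtain ⟨h1, -, h3⟩ := h
  obtain ⟨a, b, rfl⟩ := exists_vec2 v
  rw [hS] at h1
  obtain rfl : 0 = b := congrFun h1 1
  have ha : a ≠ 0 := by rintro rfl; simp at hv
  rw [cyc2_mulVec, cyc2_mulVec] at h3
  have := congrFun h3 1
  simp at this
  exact (this.resolve_right ha).symm

theorem isTwoVec_cyc2_false (hS : ∀ a b, S *ᵥ ![a, b] = ![0, b]) {y' : k} {v : Fin 2 → k}
    (hv : v ≠ 0) (h : IsTwoVec S (cyc2 y) y' v) : False := by
  obtain ⟨h1, h2, -⟩ := h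
  obtain ⟨a, b, rfl⟩ := exists_vec2 v
  rw [hS] at h1
  obtain rfl : 0 = a := congrFun h1 0
  rw [cyc2_mulVec, hS] at h2
  have := congrFun h2 1
  simp at this
  simp [this] at hv

theorem M2_true_mulVec (a b : k) : (-!![-1, 0; 0, 0]) *ᵥ ![a, b] = ![a, 0] := by
  simp only [neg_mulVec, mulVec2]
  simp

theorem M2_false_mulVec (a b : k) : (1 + !![-1, 0; 0, 0]) *ᵥ ![a, b] = ![0, b] := by
  simp only [add_mulVec, one_mulVec, mulVec2]
  simp

theorem M2t_true_mulVec (a b : k) : (-!![0, 0; 0, -1]) *ᵥ ![a, b] = ![0, b] := by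
  simp only [neg_mulVec, mulVec2]
  simp

theorem M2t_false_mulVec (a b : k) : (1 + !![0, 0; 0, -1]) *ᵥ ![a, b] = ![a, 0] := by
  simp only [add_mulVec, one_mulVec, mulVec2]
  simp

end Two

end HeckeMatrices

/-! ### Matching the invariants with the list. -/

namespace HeckeList

variable {k : Type*} [Field k]

/-- The invariants of the entries of the list. -/
def inv : HeckeList k → HeckeInv k
  | M1zero y => .sph false (y ^ 3) y (y ^ 2)
  | M1neg y => .sph true (y ^ 3) y (y ^ 2)
  | M2 y => .two true y
  | M2t y => .two false y
  | K6 z y y' _ _ => .sph true z y y'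
  | M3 z y _ => .sph false z (z / y ^ 2) (z / y)
  | M3t z y _ => .sph true z (z / y ^ 2) (z / y)
  | N3 z y _ => .sph true z y (y ^ 2)
  | N3t z y _ => .sph false z y (y ^ 2)
  | L6 z y => .sph true z y 0
  | L6t z y => .sph true z 0 y
  | P3 z => .sph false z 0 0
  | P3t z => .sph true z 0 0

/-- The admissibility conditions are what separates the names: K lies off the curves `b = a²` and
`b² = z a`, N and M lie on one each, and `y³ ≠ z` removes the common points with `a ≠ 0`, which
belong to the characters. -/
theorem inv_injective : Function.Injective (inv (k := k)) := by
  intro i j h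
  have hu (u : kˣ) : (u : k) ≠ 0 := u.ne_zero
  have hu2 (u : kˣ) : (u : k) ^ 2 ≠ 0 := pow_ne_zero 2 u.ne_zero
  cases i <;> cases j <;> simp [inv, Units.ext_iff] at h ⊢ <;>
    (try simp only [eq_div_iff, div_eq_iff, div_mul_eq_mul_div, hu, hu2, ne_eq, not_false_eq_true] at h) <;> grind

theorem isIrred (i : HeckeList k) : HeckeMatrices.IsIrred i.matrices.S i.matrices.T := by
  have hu (u : kˣ) : (u : k) ≠ 0 := u.ne_zero
  cases i with
  | M1zero y => exact HeckeMatrices.isIrred_one _ _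
  | M1neg y => exact HeckeMatrices.isIrred_one _ _
  | M2 y => exact HeckeMatrices.isIrred_M2 y
  | M2t y => exact HeckeMatrices.isIrred_M2t y
  | K6 z y y' h h' =>
    -- For these entries the two inequalities of `isIrred_S6` are `y'² ≠ z y` and `y² ≠ y'`, in this
    -- order.
    refine HeckeMatrices.isIrred_S6 z 1 _ _ (div_ne_zero (hu y') (hu z)) ?_ ?_
    · have hz := hu z
      have hy' := hu y'
      intro h0
      field_simp at h0
      apply h'
      linear_combination -h0
    · have hz := hu z
      have hy' := hu y'
      intro h0
      field_simp at h0
      apply h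
      linear_combination h0
  | M3 z y h => exact HeckeMatrices.isIrred_M3 z y h
  | M3t z y h => exact HeckeMatrices.isIrred_M3t z y h
  | N3 z y h => exact HeckeMatrices.isIrred_N3 z y h
  | N3t z y h => exact HeckeMatrices.isIrred_N3t z y h
  | L6 z y =>
    refine HeckeMatrices.isIrred_S6 z 0 1 _ (div_ne_zero (hu y) (hu z)) ?_ ?_
    · simp
    · simp [hu]
  | L6t z y =>
    refine HeckeMatrices.isIrred_S6 z 1 0 _ (div_ne_zero (hu y) (hu z)) ?_ ?_
    · simp [hu]
    · simp
  | P3 z => exact HeckeMatrices.isIrred_P3 z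
  | P3t z => exact HeckeMatrices.isIrred_P3t z

theorem matrices_n_ne_zero (i : HeckeList k) : i.matrices.n ≠ 0 := by
  cases i <;> exact Nat.succ_ne_zero _

variable {q : k} (hq : q = 0)

theorem isSimpleModule (i : HeckeList k) : IsSimpleModule (HeckeAlgebra k q) (i.module hq) :=
  i.matrices.isSimpleModule hq i.matrices_n_ne_zero i.isIrred

theorem realizes_of_isSphVec (X : HeckeMatrices k) {ε : Bool} {z a b : k} {v w : Fin X.n → k}
    (h : HeckeMatrices.IsSphVec (X.idem ε) X.T z a b v w) (hz : z ≠ 0) (hv : v ≠ 0) :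
    HeckeInv.Realizes q (X.module hq) (.sph ε z a b) :=
  ⟨hz, _, _, by simpa using hv, X.isSph hq h⟩

theorem realizes_of_isTwoVec (X : HeckeMatrices k) {ε : Bool} {y : k} {v : Fin X.n → k}
    (h : HeckeMatrices.IsTwoVec (X.idem ε) X.T y v) (hy : y ≠ 0) (hv : v ≠ 0) :
    HeckeInv.Realizes q (X.module hq) (.two ε y) :=
  ⟨hy, _, by simpa using hv, (X.isTwo_iff hq).2 h⟩

theorem realizes_S6 {z : kˣ} {a b c : k} (X : HeckeMatrices k) (hX : X = ⟨6, z, HeckeMatrices.S6 a b c, HeckeMatrices.cyc6 z, HeckeMatrices.cyc6_cube z, HeckeMatrices.S6_quadratic _ _ _, HeckeMatrices.S6_braid z _ _ _⟩) (ε : Bool) :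
    HeckeInv.Realizes q (X.module hq) (.sph ε z (z * b * c) (z * a * c)) := by
  subst hX
  cases ε
  · exact realizes_of_isSphVec hq _ (HeckeMatrices.isSphVec_S6_false z a b c) z.ne_zero
      fun h => one_ne_zero (congrFun h (0 : Fin 6))
  · exact realizes_of_isSphVec hq _ (HeckeMatrices.isSphVec_S6_true z a b c) z.ne_zero
      fun h => one_ne_zero (congrFun h (5 : Fin 6))

theorem realizes_K6 (z y y' : kˣ) (h h') (ε : Bool) :
    HeckeInv.Realizes q ((K6 z y y' h h').module hq) (.sph ε z y y') := by
  have := realizes_S6 hq _ (z := z) (a := 1) (b := (y : k) / y') (c := (y' : k) / z) rfl ε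
  have e1 : (z : k) * (y / y') * (y' / z) = y := by
    have := z.ne_zero; have := y'.ne_zero; field_simp
  have e2 : (z : k) * 1 * (y' / z) = y' := by
    have := z.ne_zero; field_simp
  rw [e1, e2] at this
  exact this

theorem realizes_L6 (z y : kˣ) (ε : Bool) :
    HeckeInv.Realizes q ((L6 z y).module hq) (.sph ε z y 0) := by
  have := realizes_S6 hq _ (z := z) (a := 0) (b := 1) (c := (y : k) / z) rfl ε
  have e1 : (z : k) * 1 * (y / z) = y := by
    have := z.ne_zero; field_simp
  rw [e1, mul_zero, zero_mul] at this
  exact this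

theorem realizes_L6t (z y : kˣ) (ε : Bool) :
    HeckeInv.Realizes q ((L6t z y).module hq) (.sph ε z 0 y) := by
  have := realizes_S6 hq _ (z := z) (a := 1) (b := 0) (c := (y : k) / z) rfl ε
  have e1 : (z : k) * 1 * (y / z) = y := by
    have := z.ne_zero; field_simp
  rw [e1, mul_zero, zero_mul] at this
  exact this

theorem realizes_inv (i : HeckeList k) : HeckeInv.Realizes q (i.module hq) i.inv := by
  have hu (u : kˣ) : (u : k) ≠ 0 := u.ne_zero
  cases i with
  | M1zero y =>
    exact realizes_of_isSphVec hq (HeckeMatrices.M1zero y) (ε := false) (HeckeMatrices.isSphVec_M1zero y)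
      (pow_ne_zero 3 (hu y)) fun h => one_ne_zero (congrFun h (0 : Fin 1))
  | M1neg y =>
    exact realizes_of_isSphVec hq (HeckeMatrices.M1neg y) (ε := true) (HeckeMatrices.isSphVec_M1neg y)
      (pow_ne_zero 3 (hu y)) fun h => one_ne_zero (congrFun h (0 : Fin 1))
  | M2 y =>
    exact realizes_of_isTwoVec hq (HeckeMatrices.M2 y) (ε := true) (HeckeMatrices.isTwoVec_cyc2
      HeckeMatrices.M2_true_mulVec) (hu y) fun h => one_ne_zero (congrFun h (0 : Fin 2))
  | M2t y =>
    exact realizes_of_isTwoVec hq (HeckeMatrices.M2t y) (ε := false) (HeckeMatrices.isTwoVec_cyc2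
      HeckeMatrices.M2t_false_mulVec) (hu y) fun h => one_ne_zero (congrFun h (0 : Fin 2))
  | K6 z y y' h h' => exact realizes_K6 hq z y y' h h' true
  | M3 z y h =>
    exact realizes_of_isSphVec hq (HeckeMatrices.M3 z y) (ε := false) (HeckeMatrices.isSphVec_M3 z y) (hu z)
      fun h => one_ne_zero (congrFun h (0 : Fin 3))
  | M3t z y h =>
    exact realizes_of_isSphVec hq (HeckeMatrices.M3t z y) (ε := true) (HeckeMatrices.isSphVec_M3t z y) (hu z)
      fun h => one_ne_zero (congrFun h (2 : Fin 3))
  | N3 z y h =>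
    exact realizes_of_isSphVec hq (HeckeMatrices.N3 z y) (ε := true) (HeckeMatrices.isSphVec_N3 z y) (hu z)
      fun h => one_ne_zero (congrFun h (2 : Fin 3))
  | N3t z y h =>
    exact realizes_of_isSphVec hq (HeckeMatrices.N3t z y) (ε := false) (HeckeMatrices.isSphVec_N3t z y) (hu z)
      fun h => one_ne_zero (congrFun h (0 : Fin 3))
  | L6 z y => exact realizes_L6 hq z y true
  | L6t z y => exact realizes_L6t hq z y true
  | P3 z =>
    exact realizes_of_isSphVec hq (HeckeMatrices.P3 z) (ε := false) (HeckeMatrices.isSphVec_P3 z) (hu z)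
      fun h => one_ne_zero (congrFun h (0 : Fin 3))
  | P3t z =>
    exact realizes_of_isSphVec hq (HeckeMatrices.P3t z) (ε := true) (HeckeMatrices.isSphVec_P3t z) (hu z)
      fun h => one_ne_zero (congrFun h (2 : Fin 3))

/-- Every possible invariant occurs in the list. -/
theorem exists_realizes {V : Type*} [AddCommGroup V] [Module k V] [Module (HeckeAlgebra k q) V]
    {I : HeckeInv k} (h : HeckeInv.Realizes q V I) :
    ∃ i : HeckeList k, HeckeInv.Realizes q (i.module hq) I := by
  cases I with
  | two ε y =>
    obtain ⟨y, rfl⟩ : ∃ u : kˣ, (u : k) = y := ⟨Units.mk0 y h.1, rfl⟩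
    cases ε
    · exact ⟨M2t y, realizes_inv hq _⟩
    · exact ⟨M2 y, realizes_inv hq _⟩
  | sph ε z a b =>
    obtain ⟨z, rfl⟩ : ∃ u : kˣ, (u : k) = z := ⟨Units.mk0 z h.1, rfl⟩
    clear h
    by_cases ha : a = 0
    · subst ha
      by_cases hb : b = 0
      · subst hb
        cases ε
        · exact ⟨P3 z, realizes_inv hq _⟩
        · exact ⟨P3t z, realizes_inv hq _⟩
      · obtain ⟨b, rfl⟩ : ∃ u : kˣ, (u : k) = b := ⟨Units.mk0 b hb, rfl⟩
        exact ⟨L6t z b, realizes_L6t hq z b ε⟩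
    obtain ⟨a, rfl⟩ : ∃ u : kˣ, (u : k) = a := ⟨Units.mk0 a ha, rfl⟩
    by_cases hb : b = 0
    · subst hb
      exact ⟨L6 z a, realizes_L6 hq z a ε⟩
    obtain ⟨b, rfl⟩ : ∃ u : kˣ, (u : k) = b := ⟨Units.mk0 b hb, rfl⟩
    have hz : (z : k) ≠ 0 := z.ne_zero
    -- The two curves on which the six-dimensional module is replaced: `b = a²` here, `b² = z a`
    -- below.
    by_cases h1 : (a : k) ^ 2 = b
    · rw [← h1]
      by_cases h2 : (a : k) ^ 3 = z
      · rw [← h2]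
        cases ε
        · exact ⟨M1zero a, realizes_inv hq _⟩
        · exact ⟨M1neg a, realizes_inv hq _⟩
      · cases ε
        · exact ⟨N3t z a h2, realizes_inv hq _⟩
        · exact ⟨N3 z a h2, realizes_inv hq _⟩
    · by_cases h2 : (b : k) ^ 2 = z * a
      · have e1 : (z : k) / ((z / b : kˣ) : k) = b := by
          rw [Units.val_div_eq_div_val]; field_simp
        have e2 : (z : k) / ((z / b : kˣ) : k) ^ 2 = a := by
          rw [Units.val_div_eq_div_val]; field_simp; exact h2
        -- Equality would mean `b³ = z²`, and together with `b² = z a` this puts the point on the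
        -- curve `b = a²`, already treated.
        have h3 : ((z / b : kˣ) : k) ^ 3 ≠ z := by
          rw [Units.val_div_eq_div_val]
          intro h
          field_simp at h
          apply h1
          have : (z : k) ^ 2 * (a ^ 2 - b) = 0 := by
            linear_combination (-(z : k) * a - b ^ 2) * h2 - b * h
          exact sub_eq_zero.1 ((mul_eq_zero.1 this).resolve_left (pow_ne_zero 2 hz))
        cases ε
        · have := realizes_inv hq (M3 z (z / b) h3)
          rw [inv, e1, e2] at this
          exact ⟨_, this⟩
        · have := realizes_inv hq (M3t z (z / b) h3)
          rw [inv, e1, e2] at this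
          exact ⟨_, this⟩
      · exact ⟨K6 z a b h1 h2, realizes_K6 hq z a b h1 h2 ε⟩

/-- A simple module is isomorphic to an entry of the list. -/
theorem exists_nonempty_linearEquiv [IsAlgClosed k] (V : Type*) [AddCommGroup V]
    [Module (HeckeAlgebra k q) V] [IsSimpleModule (HeckeAlgebra k q) V] :
    ∃ i : HeckeList k, Nonempty (V ≃ₗ[HeckeAlgebra k q] i.module hq) := by
  let _ : Module k V := Module.compHom V (algebraMap k (HeckeAlgebra k q))
  have : IsScalarTower k (HeckeAlgebra k q) V := ⟨fun c h x => by
    rw [Algebra.smul_def, mul_smul]; rfl⟩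
  obtain ⟨I, hI⟩ := HeckeInv.exists_realizes (V := V) hq
  obtain ⟨i, hi⟩ := exists_realizes hq hI
  have := isSimpleModule hq i
  exact ⟨i, hI.nonempty_linearEquiv hq hi⟩

/-- An order of priority between the kinds of invariants. -/
def _root_.HeckeInv.rank : HeckeInv k → ℕ
  | .sph true _ _ _ => 2
  | .sph false _ _ _ => 1
  | .two _ _ => 0

theorem sph_unique (i : HeckeList k) {ε : Bool} {z a b z' a' b' : k}
    (h : HeckeInv.Realizes q (i.module hq) (.sph ε z a b))
    (h' : HeckeInv.Realizes q (i.module hq) (.sph ε z' a' b')) :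
    HeckeInv.sph ε z' a' b' = .sph ε z a b := by
  obtain ⟨hz, v, w, hv, D⟩ := h
  obtain ⟨_, v', w', hv', D'⟩ := h'
  have := isSimpleModule hq i
  obtain ⟨rfl, rfl, rfl⟩ := D.scalars_unique (isZeroHecke hq ε) D' hz hv hv'
  rfl

/-- A module can have several invariants, for instance one for each idempotent, and `inv` records
one of highest rank. An invariant of strictly higher rank is excluded by the absence of fixed
vectors; one of equal rank is excluded by `sph_unique` or, in dimension two, by direct computation.
-/
theorem eq_inv_of_realizes (i : HeckeList k) {I : HeckeInv k}
    (h : HeckeInv.Realizes q (i.module hq) I) (hr : i.inv.rank ≤ I.rank) : I = i.inv := by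
  have hi := realizes_inv hq i
  cases I with
  | two ε y =>
    obtain ⟨_, v, hv, D⟩ := h
    cases i <;> simp [inv, HeckeInv.rank] at hr
    case M2 y' =>
      obtain ⟨v, rfl⟩ := ((HeckeMatrices.M2 y').toModule hq).surjective v
      have D' := ((HeckeMatrices.M2 y').isTwo_iff hq).1 D
      have hv' : v ≠ 0 := by rintro rfl; exact hv (map_zero _)
      cases ε
      · exact (HeckeMatrices.isTwoVec_cyc2_false HeckeMatrices.M2_false_mulVec hv' D').elim
      · rw [HeckeMatrices.isTwoVec_cyc2_unique HeckeMatrices.M2_true_mulVec hv' D']; rfl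
    case M2t y' =>
      obtain ⟨v, rfl⟩ := ((HeckeMatrices.M2t y').toModule hq).surjective v
      have D' := ((HeckeMatrices.M2t y').isTwo_iff hq).1 D
      have hv' : v ≠ 0 := by rintro rfl; exact hv (map_zero _)
      cases ε
      · rw [HeckeMatrices.isTwoVec_cyc2_unique HeckeMatrices.M2t_false_mulVec hv' D']; rfl
      · exact (HeckeMatrices.isTwoVec_cyc2_false HeckeMatrices.M2t_true_mulVec hv' D').elim
  | sph ε z a b =>
    have hD := h
    obtain ⟨_, v, w, hv, D⟩ := hD
    cases ε
    · cases i <;> simp [inv, HeckeInv.rank] at hr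
      case M2 y => exact (HeckeMatrices.not_isSph hq (HeckeMatrices.M2 y) false (HeckeMatrices.noFixed_M2_false y) hv D).elim
      case M2t y => exact (HeckeMatrices.not_isSph hq (HeckeMatrices.M2t y) false (HeckeMatrices.noFixed_M2t_false y) hv D).elim
      all_goals exact sph_unique hq _ hi h
    · cases i
      case M1zero y => exact (HeckeMatrices.not_isSph hq (HeckeMatrices.M1zero y) true (HeckeMatrices.noFixed_M1zero _) hv D).elim
      case M2 y => exact (HeckeMatrices.not_isSph hq (HeckeMatrices.M2 y) true (HeckeMatrices.noFixed_M2_true y) hv D).elim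
      case M2t y => exact (HeckeMatrices.not_isSph hq (HeckeMatrices.M2t y) true (HeckeMatrices.noFixed_M2t_true y) hv D).elim
      case M3 z y _ => exact (HeckeMatrices.not_isSph hq (HeckeMatrices.M3 z y) true (HeckeMatrices.noFixed_M3 z y) hv D).elim
      case N3t z y _ => exact (HeckeMatrices.not_isSph hq (HeckeMatrices.N3t z y) true (HeckeMatrices.noFixed_N3t z y) hv D).elim
      case P3 z => exact (HeckeMatrices.not_isSph hq (HeckeMatrices.P3 z) true (HeckeMatrices.noFixed_P3 z) hv D).elim
      all_goals exact sph_unique hq _ hi h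

/-- The modules of the list are pairwise non-isomorphic. -/
theorem eq_of_linearEquiv {i j : HeckeList k}
    (f : i.module hq ≃ₗ[HeckeAlgebra k q] j.module hq) : i = j := by
  apply inv_injective
  have hi := (realizes_inv hq i).congr f
  have hj := (realizes_inv hq j).congr f.symm
  -- The comparison takes place in the module whose own invariant has the lower rank.
  rcases le_total i.inv.rank j.inv.rank with h | h
  · exact (eq_inv_of_realizes hq i hj h).symm
  · exact eq_inv_of_realizes hq j hi h

end HeckeList

end

noncomputable section

/-! ### The ring of integers of the algebraic closure of `ℚ_p` and its reduction -/

namespace Zbar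

open Polynomial

variable {p : ℕ} [Fact p.Prime]

/-- The norm is the spectral value of the minimal polynomial; it is at most `1` only if all
coefficients are `p`-adic integers. -/
theorem isIntegral_of_norm_le_one {x : Qbar p} (hx : ‖x‖ ≤ 1) : IsIntegral ℤ_[p] x := by
  have hx' : IsIntegral ℚ_[p] x := Algebra.IsIntegral.isIntegral x
  have hm := minpoly.monic hx'
  have h1 : spectralValue (minpoly ℚ_[p] x) ≤ 1 := hx
  rw [spectralValue_le_one_iff hm] at h1
  have hl : minpoly ℚ_[p] x ∈ Polynomial.lifts (algebraMap ℤ_[p] ℚ_[p]) := by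
    rw [Polynomial.lifts_iff_coeff_lifts]
    exact fun n => ⟨⟨_, h1 n⟩, rfl⟩
  obtain ⟨P, hP, -, hPm⟩ := Polynomial.lifts_and_degree_eq_and_monic hl hm
  refine ⟨P, hPm, ?_⟩
  rw [IsScalarTower.algebraMap_eq ℤ_[p] ℚ_[p] (Qbar p), ← Polynomial.eval₂_map, hP]
  exact minpoly.aeval ℚ_[p] x

/-- A nonzero vector is a multiple of an integral vector that has a coordinate `1`. -/
theorem exists_smul_integral {n : ℕ} {x : Fin n → Qbar p} (hx : x ≠ 0) :
    ∃ (c : Qbar p) (y : Fin n → Zbar p) (j : Fin n), (∀ i, (y i : Qbar p) = c * x i) ∧ y j = 1 := by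
  obtain ⟨i₀, hi₀⟩ := Function.ne_iff.1 hx
  -- Dividing by a coordinate of largest norm makes all coordinates integral and that one equal to
  -- `1`.
  obtain ⟨j, -, hj⟩ := Finset.univ.exists_max_image (fun i => ‖x i‖) ⟨i₀, Finset.mem_univ _⟩
  have hj0 : x j ≠ 0 := by
    intro h
    have := hj i₀ (Finset.mem_univ _)
    rw [h, norm_zero] at this
    exact hi₀ (norm_le_zero_iff.1 this)
  refine ⟨(x j)⁻¹, fun i => ⟨(x j)⁻¹ * x i, isIntegral_of_norm_le_one ?_⟩, j, fun i => rfl, ?_⟩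
  · rw [norm_mul, norm_inv, inv_mul_le_iff₀ (norm_pos_iff.2 hj0), mul_one]
    exact hj i (Finset.mem_univ _)
  · exact Subtype.ext (inv_mul_cancel₀ hj0)

variable (r : Zbar p →+* Fbar p)

/-- The minimal polynomial of `y` over `ZMod p` lifts to a monic integer polynomial. That polynomial
splits over `Qbar p` with integral roots, so its reduction is the product of the `X - r a`, and `y`
is one of the `r a`. -/
theorem reduction_surjective : Function.Surjective r := by
  intro y
  have hy : IsIntegral (ZMod p) y := Algebra.IsIntegral.isIntegral y
  have hl : minpoly (ZMod p) y ∈ Polynomial.lifts (Int.castRingHom (ZMod p)) := by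
    rw [Polynomial.lifts_iff_coeff_lifts]
    exact fun n => ZMod.intCast_surjective _
  obtain ⟨P, hP, -, hPm⟩ := Polynomial.lifts_and_degree_eq_and_monic hl (minpoly.monic hy)
  have hs := IsAlgClosed.splits (P.map (Int.castRingHom (Qbar p)))
  have hroot : ∀ x ∈ (P.map (Int.castRingHom (Qbar p))).roots, IsIntegral ℤ_[p] x := by
    intro x hx
    have h0 := (mem_roots'.1 hx).2
    rw [IsRoot.def, eval_map] at h0
    refine ⟨P.map (Int.castRingHom ℤ_[p]), hPm.map _, ?_⟩
    rw [eval₂_map, Subsingleton.elim ((algebraMap ℤ_[p] (Qbar p)).comp _) (Int.castRingHom (Qbar p))]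
    exact h0
  obtain ⟨s, hs'⟩ : ∃ s : Multiset (Zbar p),
      s.map Subtype.val = (P.map (Int.castRingHom (Qbar p))).roots :=
    ⟨_, (Multiset.map_pmap _ (fun x h => (⟨x, h⟩ : Zbar p)) _ hroot).trans <| by
      exact (Multiset.pmap_eq_map _ _ _ hroot).trans (Multiset.map_id' _)⟩
  have hPs : P.map (Int.castRingHom (Zbar p)) = (s.map fun a => X - C a).prod := by
    have hinj : Function.Injective (algebraMap (Zbar p) (Qbar p)) := Subtype.val_injective
    apply Polynomial.map_injective _ hinj
    rw [Polynomial.map_map, Subsingleton.elim ((algebraMap (Zbar p) (Qbar p)).comp _)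
      (Int.castRingHom (Qbar p)), hs.eq_prod_roots_of_monic (hPm.map _), ← hs',
      Polynomial.map_multiset_prod, Multiset.map_map, Multiset.map_map]
    congr 1
    refine Multiset.map_congr rfl fun a _ => ?_
    simp
  have h1 : eval y (P.map (Int.castRingHom (Fbar p))) = 0 := by
    have := minpoly.aeval (ZMod p) y
    rw [← hP, aeval_def, eval₂_map] at this
    rw [eval_map, ← this]
    congr 1
  rw [← Subsingleton.elim (r.comp (Int.castRingHom (Zbar p))) (Int.castRingHom (Fbar p)),
    ← Polynomial.map_map, hPs, Polynomial.map_multiset_prod, Multiset.map_map,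
    eval_multiset_prod, Multiset.map_map, Multiset.prod_eq_zero_iff, Multiset.mem_map] at h1
  obtain ⟨a, -, ha⟩ := h1
  refine ⟨a, ?_⟩
  simp [sub_eq_zero] at ha
  exact ha.symm

/-- If `x` had norm less than `1`, some power of it would be divisible by `p`, and `r x` would be
nilpotent in a field. So the inverse of `x` is integral. -/
theorem isUnit_of_reduction_ne_zero {x : Zbar p} (hx : r x ≠ 0) : IsUnit x := by
  have hx0 : (x : Qbar p) ≠ 0 := by
    intro h
    apply hx
    rw [show x = 0 from Subtype.ext h, map_zero]
  rcases lt_or_ge ‖(x : Qbar p)‖ 1 with h | h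
  · exfalso
    have hp0 : (p : Qbar p) ≠ 0 := Nat.cast_ne_zero.2 (Fact.out : p.Prime).ne_zero
    obtain ⟨n, hn⟩ := exists_pow_lt_of_lt_one (norm_pos_iff.2 hp0) h
    have hw : ‖(x : Qbar p) ^ n / p‖ ≤ 1 := by
      rw [norm_div, norm_pow]
      exact div_le_one_of_le₀ hn.le (norm_nonneg _)
    have : x ^ n = p * ⟨_, isIntegral_of_norm_le_one hw⟩ := by
      apply Subtype.ext
      simp
      field_simp
    apply pow_ne_zero n hx
    rw [← map_pow, this, map_mul, map_natCast, CharP.cast_eq_zero, zero_mul]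
  · have hw : ‖(x : Qbar p)⁻¹‖ ≤ 1 := by
      rw [norm_inv]
      exact inv_le_one_of_one_le₀ h
    exact IsUnit.of_mul_eq_one ⟨_, isIntegral_of_norm_le_one hw⟩ (Subtype.ext (mul_inv_cancel₀ hx0))

theorem exists_unit_lift (y : (Fbar p)ˣ) : ∃ u : (Zbar p)ˣ, Units.map r.toMonoidHom u = y := by
  obtain ⟨x, hx⟩ := reduction_surjective r y
  obtain ⟨u, rfl⟩ := isUnit_of_reduction_ne_zero r (x := x) (by rw [hx]; exact y.ne_zero)
  exact ⟨u, Units.ext hx⟩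

/-- Needed for the modules P, whose lifts contain two entries with product `q` up to a unit, both of
which must reduce to zero. -/
theorem exists_sqrt (m : ℕ) (hm : (m : Fbar p) = 0) : ∃ c : Zbar p, c * c = m ∧ r c = 0 := by
  obtain ⟨c, hc⟩ := IsAlgClosed.exists_pow_nat_eq (m : Qbar p) (n := 2) two_pos
  have hi : IsIntegral ℤ_[p] c := IsIntegral.of_pow two_pos (by
    rw [hc, ← map_natCast (algebraMap ℤ_[p] (Qbar p))]
    exact isIntegral_algebraMap)
  have h : (⟨c, hi⟩ : Zbar p) * ⟨c, hi⟩ = m := by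
    apply Subtype.ext
    simp [← hc, pow_two]
  refine ⟨⟨c, hi⟩, h, mul_self_eq_zero.1 ?_⟩
  rw [← map_mul, h, map_natCast, hm]

end Zbar

end

noncomputable section

open Matrix HeckeAlgebra

/-! ### Modules given by matrices, over any coefficient ring -/

namespace HeckeModule

section

variable {R M M' : Type*} [CommRing R] {q : R} [AddCommGroup M] [Module R M] [AddCommGroup M']
  [Module R M'] {a : HeckeGen → Module.End R M} {a' : HeckeGen → Module.End R M'}

theorem adjoin_range_gen : Algebra.adjoin R (Set.range (gen R q)) = ⊤ := by
  rw [eq_top_iff, ← adjoin_gen]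
  refine Algebra.adjoin_mono ?_
  rintro x (rfl | rfl | rfl) <;> exact ⟨_, rfl⟩

/-- An isomorphism of `R`-modules that commutes with the generators is an isomorphism of modules
over the Hecke algebra. -/
def linearEquivOfCommute (ha : HeckeRelations (algebraMap R (Module.End R M) q) a)
    (ha' : HeckeRelations (algebraMap R (Module.End R M') q) a') (e : M ≃ₗ[R] M')
    (he : ∀ g x, e (a g x) = a' g (e x)) :
    HeckeModule a ha ≃ₗ[HeckeAlgebra R q] HeckeModule a' ha' :=
  let e' : HeckeModule a ha ≃ₗ[R] HeckeModule a' ha' := e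
  { e' with
    map_smul' := fun h x => by
      change e' (h • x) = h • e' x
      have hh : h ∈ Algebra.adjoin R (Set.range (gen R q)) := by
        rw [adjoin_range_gen]; trivial
      induction hh using Algebra.adjoin_induction generalizing x with
      | mem _ hg =>
        obtain ⟨g, rfl⟩ := hg
        exact (congrArg e (gen_smul a ha g x)).trans
          ((he g x).trans (gen_smul a' ha' g (e x)).symm)
      | algebraMap c => rw [algebraMap_smul, algebraMap_smul, map_smul]
      | add _ _ _ _ h₁ h₂ => rw [add_smul, map_add, h₁, h₂, add_smul]
      | mul _ _ _ _ h₁ h₂ => rw [mul_smul, h₁, h₂, mul_smul] }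

theorem nonempty_linearEquiv_of_toMatrix_eq {ι : Type*} [Fintype ι] [DecidableEq ι]
    (ha : HeckeRelations (algebraMap R (Module.End R M) q) a)
    (ha' : HeckeRelations (algebraMap R (Module.End R M') q) a') (b : Module.Basis ι R M)
    (b' : Module.Basis ι R M')
    (h : ∀ g, LinearMap.toMatrix b b (a g) = LinearMap.toMatrix b' b' (a' g)) :
    Nonempty (HeckeModule a ha ≃ₗ[HeckeAlgebra R q] HeckeModule a' ha') := by
  refine ⟨linearEquivOfCommute ha ha' (b.equiv b' (Equiv.refl ι)) fun g x => ?_⟩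
  have : (b.equiv b' (Equiv.refl ι)).toLinearMap ∘ₗ a g =
      a' g ∘ₗ (b.equiv b' (Equiv.refl ι)).toLinearMap := by
    refine b.ext fun i => ?_
    have e1 : a g (b i) = ∑ j, LinearMap.toMatrix b b (a g) j i • b j := by
      simp [LinearMap.toMatrix_apply, b.sum_repr]
    have e2 : a' g (b' i) = ∑ j, LinearMap.toMatrix b' b' (a' g) j i • b' j := by
      simp [LinearMap.toMatrix_apply, b'.sum_repr]
    simp [e1, e2, h]
  exact LinearMap.congr_fun this x

end

section

variable {R : Type*} [CommRing R] {q : R} {n : ℕ}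

/-- The operators on column vectors given by matrices. -/
def matrixOps (A : HeckeGen → Matrix (Fin n) (Fin n) R) (g : HeckeGen) :
    Module.End R (Fin n → R) :=
  Matrix.toLinAlgEquiv' (A g)

theorem matrixOps_relations {A : HeckeGen → Matrix (Fin n) (Fin n) R}
    (h : HeckeRelations (algebraMap R _ q) A) :
    HeckeRelations (algebraMap R (Module.End R (Fin n → R)) q) (matrixOps A) := by
  have h' := HeckeRelations.map (B := Module.End R (Fin n → R))
    (Matrix.toLinAlgEquiv' (R := R) (n := Fin n)).toAlgHom.toRingHom h
  rwa [show (Matrix.toLinAlgEquiv' (R := R) (n := Fin n)).toAlgHom.toRingHom (algebraMap R _ q) =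
    algebraMap R _ q from AlgHom.commutes _ q] at h'

theorem toMatrix_matrixOps (A : HeckeGen → Matrix (Fin n) (Fin n) R) (g : HeckeGen) :
    LinearMap.toMatrix (Pi.basisFun R (Fin n)) (Pi.basisFun R (Fin n)) (matrixOps A g) = A g := by
  rw [LinearMap.toMatrix_eq_toMatrix']
  exact LinearMap.toMatrix'_toLin' (A g)

end

end HeckeModule

/-- The relations between matrices do not change under an injective change of coefficients. -/
theorem HeckeRelations.matrix_of_map {R R' : Type*} [CommRing R] [CommRing R'] (φ : R →+* R')
    (hφ : Function.Injective φ) {n m : ℕ} {A : HeckeGen → Matrix (Fin n) (Fin n) R}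
    (h : HeckeRelations (m : Matrix (Fin n) (Fin n) R') fun g => (A g).map φ) :
    HeckeRelations (m : Matrix (Fin n) (Fin n) R) A := by
  have hinj : Function.Injective (φ.mapMatrix (m := Fin n)) := Matrix.map_injective hφ
  constructor <;> apply hinj <;>
    simp only [map_mul, map_add, map_sub, map_one, map_zero, map_pow, map_natCast]
  exacts [h.T_mul_Tinv, h.Tinv_mul_T, h.quadratic, h.cube_comm, h.braid, h.conj]

/-! ### Simplicity of a module with simple reduction -/

namespace Zbar

variable {p : ℕ} [Fact p.Prime]

/-- A family of integral matrices whose reduction is irreducible is irreducible. -/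
theorem eq_top_of_reduction {n : ℕ} {ι : Type*} (r : Zbar p →+* Fbar p)
    (A : ι → Matrix (Fin n) (Fin n) (Zbar p))
    (hA : ∀ N : Submodule (Fbar p) (Fin n → Fbar p),
      (∀ g, ∀ x ∈ N, (A g).map r *ᵥ x ∈ N) → ∀ x ∈ N, x ≠ 0 → N = ⊤)
    (N : Submodule (Qbar p) (Fin n → Qbar p))
    (hN : ∀ g, ∀ x ∈ N, (A g).map (algebraMap (Zbar p) (Qbar p)) *ᵥ x ∈ N)
    {x : Fin n → Qbar p} (hx : x ∈ N) (hx0 : x ≠ 0) : N = ⊤ := by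
  set i : Zbar p →+* Qbar p := algebraMap (Zbar p) (Qbar p) with hi
  -- The reductions of the integral vectors of `N` span a stable subspace. It is nonzero because a
  -- multiple of `x` is integral with a coordinate `1`, so it is the whole space.
  let Y : Set (Fin n → Zbar p) := {y | i ∘ y ∈ N}
  let s : Set (Fin n → Fbar p) := (fun y => r ∘ y) '' Y
  have hs : Submodule.span (Fbar p) s = ⊤ := by
    obtain ⟨c, y, j, hy, hj⟩ := exists_smul_integral hx0
    refine hA _ ?_ (r ∘ y) (Submodule.subset_span ⟨y, ?_, rfl⟩) ?_
    · intro g z hz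
      induction hz using Submodule.span_induction with
      | mem _ h =>
        obtain ⟨w, hw, rfl⟩ := h
        refine Submodule.subset_span ⟨A g *ᵥ w, ?_, ?_⟩
        · have := hN g _ hw
          change i ∘ (A g *ᵥ w) ∈ N
          convert this using 1
          ext j
          exact RingHom.map_mulVec i _ _ _
        · ext j
          exact RingHom.map_mulVec r _ _ _
      | zero => simp
      | add _ _ _ _ h₁ h₂ => rw [mulVec_add]; exact add_mem h₁ h₂
      | smul c _ _ h => rw [mulVec_smul]; exact Submodule.smul_mem _ c h
    · change i ∘ y ∈ N
      have : i ∘ y = c • x := funext hy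
      rw [this]
      exact N.smul_mem c hx
    · intro h
      have := congrFun h j
      simp [hj] at this
  -- Choose `n` integral vectors of `N` whose reductions form a basis. Their determinant has nonzero
  -- reduction, so it is nonzero and they already span over `Qbar p`.
  obtain ⟨f, hf, -, hli⟩ := Submodule.exists_fun_fin_finrank_span_eq (Fbar p) s
  have hfr : Module.finrank (Fbar p) (Submodule.span (Fbar p) s) = n := by
    rw [hs, finrank_top, Module.finrank_fin_fun]
  choose w hw hwf using hf
  let e : Fin n ≃ Fin (Module.finrank (Fbar p) (Submodule.span (Fbar p) s)) := finCongr hfr.symm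
  let W : Matrix (Fin n) (Fin n) (Zbar p) := Matrix.of fun a => w (e a)
  have hdet : r W.det ≠ 0 := by
    rw [RingHom.map_det]
    have : (r.mapMatrix W).row = f ∘ e := by
      funext a
      exact hwf (e a)
    have h2 := Matrix.linearIndependent_rows_iff_isUnit.1 (this ▸ hli.comp _ e.injective)
    exact ((Matrix.isUnit_iff_isUnit_det _).1 h2).ne_zero
  have hdet' : (i.mapMatrix W).det ≠ 0 := by
    rw [← RingHom.map_det]
    intro h
    apply hdet
    rw [show W.det = 0 from Subtype.val_injective h, map_zero]
  have h3 := Matrix.linearIndependent_rows_iff_isUnit.2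
    ((Matrix.isUnit_iff_isUnit_det _).2 hdet'.isUnit)
  have h4 := h3.span_eq_top_of_card_eq_finrank' (by simp)
  rw [eq_top_iff, ← h4, Submodule.span_le]
  rintro _ ⟨a, rfl⟩
  exact hw (e a)

end Zbar

end

noncomputable section

open Matrix HeckeAlgebra HeckeModule

/-! ### Integral structures given by matrices -/

theorem HeckeRelations.matrix_map {R R' : Type*} [CommRing R] [CommRing R'] (φ : R →+* R')
    {n m : ℕ} {A : HeckeGen → Matrix (Fin n) (Fin n) R}
    (h : HeckeRelations (m : Matrix (Fin n) (Fin n) R) A) :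
    HeckeRelations (algebraMap R' (Matrix (Fin n) (Fin n) R') m) fun g => (A g).map φ := by
  have := h.map (φ.mapMatrix (m := Fin n))
  rw [map_natCast] at this
  rw [map_natCast]
  exact this

namespace IntegralStructure

variable {O E : Type*} [CommRing O] [Field E] [Algebra O E] {q : ℕ} {M : Type*}
    [AddCommGroup M] [Module O M] [Module E M] [IsScalarTower O E M]
    [Module (HeckeAlgebra E (q : E)) M] [IsScalarTower E (HeckeAlgebra E (q : E)) M]
    {n : ℕ} (b : Module.Basis (Fin n) E M) (B : HeckeGen → Matrix (Fin n) (Fin n) O)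
    (hB : ∀ g j, gen E (q : E) g • b j = ∑ i, B g i j • b i)
    [IsDomain O] [Module.IsTorsionFree O E]

/-- The lattice spanned by a basis in which the generators have integral matrices. -/
def ofBasis : IntegralStructure O E q M where
  lattice := Submodule.span O (Set.range b)
  free := Module.Free.of_basis (b.restrictScalars O)
  stable g x hx := by
    change actionOps (q := (q : E)) M g x ∈ _
    induction hx using Submodule.span_induction with
    | mem _ h =>
      obtain ⟨j, rfl⟩ := h
      change gen E (q : E) g • b j ∈ _
      rw [hB]
      exact Submodule.sum_mem _ fun i _ => Submodule.smul_mem _ _ (Submodule.subset_span ⟨i, rfl⟩)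
    | zero => rw [map_zero]; exact Submodule.zero_mem _
    | add _ _ _ _ h₁ h₂ => rw [map_add]; exact Submodule.add_mem _ h₁ h₂
    | smul c _ _ h => rw [LinearMap.map_smul_of_tower]; exact Submodule.smul_mem _ c h
  span_eq_top := by
    rw [eq_top_iff, ← b.span_eq]
    exact Submodule.span_mono Submodule.subset_span

/-- The basis, as a basis of the lattice. -/
def latticeBasis : Module.Basis (Fin n) O (ofBasis b B hB).lattice := b.restrictScalars O

theorem coe_latticeBasis (j : Fin n) : (latticeBasis b B hB j : M) = b j :=
  b.restrictScalars_apply O j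

theorem toMatrix_ofBasis_ops (g : HeckeGen) :
    LinearMap.toMatrix (latticeBasis b B hB) (latticeBasis b B hB) ((ofBasis b B hB).ops g) =
      B g := by
  have key (j : Fin n) : (ofBasis b B hB).ops g (latticeBasis b B hB j) =
      ∑ i, B g i j • latticeBasis b B hB i := by
    apply Subtype.ext
    rw [coe_ops, coe_latticeBasis, Submodule.coe_sum]
    simp only [Submodule.coe_smul, coe_latticeBasis]
    exact hB g j
  ext i j
  rw [LinearMap.toMatrix_apply, key, map_sum]
  simp [Finsupp.single_apply]

end IntegralStructure

theorem HeckeBaseChange.nonempty_linearEquiv {R R' M : Type*} [CommRing R] [CommRing R']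
    [Algebra R R'] [AddCommGroup M] [Module R M] {n q : ℕ} {a : HeckeGen → Module.End R M}
    (ha : HeckeRelations (algebraMap R (Module.End R M) q) a) (b : Module.Basis (Fin n) R M)
    {A : HeckeGen → Matrix (Fin n) (Fin n) R}
    (hA : ∀ g, LinearMap.toMatrix b b (a g) = A g)
    (h : HeckeRelations (algebraMap R' _ (q : R')) fun g => (A g).map (algebraMap R R')) :
    Nonempty (HeckeModule (matrixOps fun g => (A g).map (algebraMap R R')) (matrixOps_relations h)
      ≃ₗ[HeckeAlgebra R' (q : R')] HeckeBaseChange R R' q (HeckeModule a ha)) := by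
  refine nonempty_linearEquiv_of_toMatrix_eq _ _ (Pi.basisFun R' (Fin n))
    (Algebra.TensorProduct.basis R' (M := HeckeModule a ha) b) fun g => ?_
  rw [toMatrix_matrixOps, ← hA]
  have : actionOps (q := (q : R)) (HeckeModule a ha) g = a g :=
    LinearMap.ext fun x => gen_smul a ha g x
  unfold baseChangeOps
  rw [this]
  exact (LinearMap.toMatrix_baseChange (A := R') (a g) b b).symm

theorem IntegralStructure.nonempty_linearEquiv_ofBasis {O E : Type*} [CommRing O] [Field E]
    [Algebra O E] {q : ℕ} {M : Type*} [AddCommGroup M] [Module O M] [Module E M]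
    [IsScalarTower O E M] [Module (HeckeAlgebra E (q : E)) M]
    [IsScalarTower E (HeckeAlgebra E (q : E)) M] {n : ℕ} (b : Module.Basis (Fin n) E M)
    (B : HeckeGen → Matrix (Fin n) (Fin n) O)
    (hB : ∀ g j, gen E (q : E) g • b j = ∑ i, B g i j • b i) [IsDomain O]
    [Module.IsTorsionFree O E] {R' : Type*} [CommRing R'] [Algebra O R']
    (h : HeckeRelations (algebraMap R' _ (q : R')) fun g => (B g).map (algebraMap O R')) :
    Nonempty (HeckeModule (matrixOps fun g => (B g).map (algebraMap O R')) (matrixOps_relations h)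
      ≃ₗ[HeckeAlgebra R' (q : R')] HeckeBaseChange O R' q (ofBasis b B hB).asModule) :=
  HeckeBaseChange.nonempty_linearEquiv (ofBasis b B hB).ops_relations (latticeBasis b B hB)
    (toMatrix_ofBasis_ops b B hB) h

theorem HeckeModule.isSimpleModule_matrixOps {k : Type*} [Field k] {q : k} {n : ℕ} (hn : n ≠ 0)
    {A : HeckeGen → Matrix (Fin n) (Fin n) k} (h : HeckeRelations (algebraMap k _ q) A)
    (H : ∀ N : Submodule k (Fin n → k), (∀ g, ∀ x ∈ N, A g *ᵥ x ∈ N) → ∀ x ∈ N, x ≠ 0 → N = ⊤) :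
    IsSimpleModule (HeckeAlgebra k q) (HeckeModule (matrixOps A) (matrixOps_relations h)) := by
  have : NeZero n := ⟨hn⟩
  have : Nontrivial (HeckeModule (matrixOps A) (matrixOps_relations h)) :=
    inferInstanceAs (Nontrivial (Fin n → k))
  rw [isSimpleModule_iff]
  refine { eq_bot_or_eq_top := fun N => ?_ }
  rw [or_iff_not_imp_left]
  intro hN
  obtain ⟨x, hx, hx0⟩ := N.exists_mem_ne_zero_of_ne_bot hN
  have hg (g : HeckeGen) (x : Fin n → k) (hx : x ∈ N.restrictScalars k) :
      A g *ᵥ x ∈ N.restrictScalars k := by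
    have := N.smul_mem (gen k q g) hx
    exact (congrArg (· ∈ N) (gen_smul (matrixOps A) (matrixOps_relations h) g x)).mp this
  have hT := H (N.restrictScalars k) hg x hx hx0
  exact Submodule.restrictScalars_eq_top_iff k _ _ |>.1 hT

section Reduction

variable {p : ℕ} [Fact p.Prime]

instance : Finite HeckeGen :=
  Finite.of_injective (fun g : HeckeGen => (HeckeGen.rec 0 1 2 3 g : Fin 4)) (by
    intro g g' h
    cases g <;> cases g' <;> first | rfl | simp at h)

theorem isReductionOfIntegralSimple_of_basis (r : Zbar p →+* Fbar p)
    (E : IntermediateField ℚ_[p] (Qbar p)) [FiniteDimensional ℚ_[p] E] {q n : ℕ} {M : Type}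
    [AddCommGroup M] [Module E M] [Module (HeckeAlgebra E (q : E)) M]
    [IsScalarTower E (HeckeAlgebra E (q : E)) M] (b : Module.Basis (Fin n) E M)
    (B : HeckeGen → Matrix (Fin n) (Fin n) (OInt E))
    (hb : ∀ g j, gen E (q : E) g • b j = ∑ i, B g i j • b i)
    (hB : HeckeRelations (algebraMap (Fbar p) (Matrix (Fin n) (Fin n) (Fbar p)) q)
      fun g => (B g).map (reductionOn r E))
    [IsSimpleModule (HeckeAlgebra (Qbar p) (q : Qbar p)) (HeckeBaseChange E (Qbar p) q M)]
    {V : Type*} [AddCommGroup V] [Module (HeckeAlgebra (Fbar p) (q : Fbar p)) V]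
    (e : V ≃ₗ[HeckeAlgebra (Fbar p) (q : Fbar p)]
      HeckeModule (matrixOps fun g => (B g).map (reductionOn r E)) (matrixOps_relations hB)) :
    IsReductionOfIntegralSimple q r V := by
  refine ⟨E, inferInstance, M, inferInstance, inferInstance, inferInstance, inferInstance,
    Module.Finite.of_basis b, .ofBasis b B hb, inferInstance, ?_⟩
  let _ : Algebra (OInt E) (Fbar p) := (reductionOn r E).toAlgebra
  obtain ⟨f⟩ := IntegralStructure.nonempty_linearEquiv_ofBasis b B hb (R' := Fbar p) hB
  exact ⟨e.trans f⟩

/-- A module given by matrices that are the reductions of integral matrices satisfying the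
relations is, if it is irreducible, the reduction of an integral simple module. -/
theorem isReductionOfIntegralSimple_of_matrices (r : Zbar p →+* Fbar p) {q n : ℕ} (hn : n ≠ 0)
    {A : HeckeGen → Matrix (Fin n) (Fin n) (Zbar p)}
    (hA : HeckeRelations (q : Matrix (Fin n) (Fin n) (Zbar p)) A)
    (hirr : ∀ N : Submodule (Fbar p) (Fin n → Fbar p),
      (∀ g, ∀ x ∈ N, (A g).map r *ᵥ x ∈ N) → ∀ x ∈ N, x ≠ 0 → N = ⊤)
    {V : Type*} [AddCommGroup V] [Module (HeckeAlgebra (Fbar p) (q : Fbar p)) V]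
    (e : V ≃ₗ[HeckeAlgebra (Fbar p) (q : Fbar p)]
      HeckeModule (matrixOps fun g => (A g).map r) (matrixOps_relations (hA.matrix_map r))) :
    IsReductionOfIntegralSimple q r V := by
  -- Finitely many algebraic entries generate a finite extension `E`. The relations descend to `OInt
  -- E` because it embeds in `Zbar p`.
  let S : Set (Qbar p) := Set.range fun t : HeckeGen × Fin n × Fin n => (A t.1 t.2.1 t.2.2 : Qbar p)
  let E : IntermediateField ℚ_[p] (Qbar p) := IntermediateField.adjoin ℚ_[p] S
  have hE : FiniteDimensional ℚ_[p] E := by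
    have : Finite S := Set.finite_range _
    exact IntermediateField.finiteDimensional_adjoin fun x _ => Algebra.IsIntegral.isIntegral x
  have hmem (g i j) : (A g i j : Qbar p) ∈ E :=
    IntermediateField.subset_adjoin _ _ ⟨(g, i, j), rfl⟩
  let φ : OInt E →+* Zbar p := ((E.val.restrictScalars ℤ_[p]).mapIntegralClosure : OInt E →+* Zbar p)
  have hval : Function.Injective (E.val.restrictScalars ℤ_[p]) := Subtype.val_injective
  have hφ : Function.Injective φ := fun a b h =>
    Subtype.ext (hval (congrArg (Subtype.val : Zbar p → Qbar p) h))
  let B (g : HeckeGen) : Matrix (Fin n) (Fin n) (OInt E) := Matrix.of fun i j =>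
    ⟨⟨A g i j, hmem g i j⟩, (isIntegral_algHom_iff (E.val.restrictScalars ℤ_[p]) hval).1 (A g i j).2⟩
  have hB : HeckeRelations (q : Matrix (Fin n) (Fin n) (OInt E)) B :=
    HeckeRelations.matrix_of_map φ hφ hA
  let BE (g : HeckeGen) : Matrix (Fin n) (Fin n) E := (B g).map (algebraMap (OInt E) E)
  have hBE : HeckeRelations (algebraMap E (Matrix (Fin n) (Fin n) E) q) BE := hB.matrix_map _
  let M := HeckeModule (matrixOps BE) (matrixOps_relations hBE)
  let b : Module.Basis (Fin n) E M := Pi.basisFun E (Fin n)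
  have hb (g : HeckeGen) (j : Fin n) : gen E (q : E) g • b j = ∑ i, B g i j • b i := by
    refine (gen_smul (matrixOps BE) (matrixOps_relations hBE) g _).trans ?_
    have hbj (j : Fin n) : b j = (Pi.single j 1 : Fin n → E) := Pi.basisFun_apply E (Fin n) j
    simp only [hbj]
    change BE g *ᵥ Pi.single j 1 = ∑ i, B g i j • (Pi.single i 1 : Fin n → E)
    rw [mulVec_single_one]
    ext i
    simp [Finset.sum_apply, Pi.single_apply, BE, Algebra.smul_def]
    rfl
  have hBE' : HeckeRelations (q : Matrix (Fin n) (Fin n) E) BE := by rwa [map_natCast] at hBE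
  obtain ⟨f⟩ := HeckeBaseChange.nonempty_linearEquiv (R := E) (R' := Qbar p)
    (matrixOps_relations hBE) b (toMatrix_matrixOps BE) (hBE'.matrix_map _)
  have := HeckeModule.isSimpleModule_matrixOps hn (hBE'.matrix_map (algebraMap E (Qbar p)))
    fun N hN x hx hx0 => Zbar.eq_top_of_reduction r A hirr N hN hx hx0
  have := IsSimpleModule.congr f.symm
  exact isReductionOfIntegralSimple_of_basis r E b B hb (hB.matrix_map _) e

end Reduction

end

noncomputable section

open Matrix HeckeAlgebra HeckeModule

/-! ### Lifts of the matrices of the list -/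

/-- Matrices of `S₁` and `T` that satisfy the relations with parameter `q`, where `T³` acts by `z`. -/
structure IsHeckePair {R : Type*} [CommRing R] (q z : R) {n : ℕ} (S T : Matrix (Fin n) (Fin n) R) :
    Prop where
  cube : T * T * T = z • 1
  quadratic : S * S = (q - 1) • S + q • 1
  braid : z • (S * (T * T * S * T) * S) = (T * T * S * T) * S * (T * T * S * T)

namespace IsHeckePair

variable {R : Type*} [CommRing R] {q z c d y w : R}

/-- `T` in the basis `(w, Tw)`, with `T²w = -y²w - yTw`. -/
def cyc2 (y : R) : Matrix (Fin 2) (Fin 2) R := !![0, -y ^ 2; 1, -y]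

/-- `T` in the basis `(v, Tv, T²v)`, with `T³v = zv`. -/
def cyc3 (z : R) : Matrix (Fin 3) (Fin 3) R := !![0, 0, z; 1, 0, 0; 0, 1, 0]

/-- `T` in the basis `(v, Tv, T²v, w, Tw, T²w)`, with `T³v = zv` and `T³w = zw`. -/
def cyc6 (z : R) : Matrix (Fin 6) (Fin 6) R :=
  !![0, 0, z, 0, 0, 0;
     1, 0, 0, 0, 0, 0;
     0, 1, 0, 0, 0, 0;
     0, 0, 0, 0, 0, z;
     0, 0, 0, 1, 0, 0;
     0, 0, 0, 0, 1, 0]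

theorem cyc2_cube (y : R) : cyc2 y * cyc2 y * cyc2 y = y ^ 3 • 1 := by
  ext a b; fin_cases a <;> fin_cases b <;>
    simp [cyc2, Matrix.mul_apply, Fin.sum_univ_succ] <;> ring

theorem cyc3_cube (z : R) : cyc3 z * cyc3 z * cyc3 z = z • 1 := by
  simp [cyc3, Matrix.vecMul_cons]
  ext a b; fin_cases a <;> fin_cases b <;> simp

theorem cyc6_cube (z : R) : cyc6 z * cyc6 z * cyc6 z = z • 1 := by
  simp [cyc6, Matrix.vecMul_cons]
  ext a b; fin_cases a <;> fin_cases b <;> simp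

theorem one_zero (y : R) : IsHeckePair q (y ^ 3) (q • (1 : Matrix (Fin 1) (Fin 1) R)) (y • 1) := by
  constructor <;> ext a b <;> fin_cases a <;> fin_cases b <;> simp <;> ring

theorem one_neg (y : R) : IsHeckePair q (y ^ 3) (-1 : Matrix (Fin 1) (Fin 1) R) (y • 1) := by
  constructor <;> ext a b <;> fin_cases a <;> fin_cases b <;> simp <;> ring

theorem two_first (y : R) : IsHeckePair q (y ^ 3) !![-1, q * y; 0, q] (cyc2 y) := by
  refine ⟨cyc2_cube y, ?_, ?_⟩ <;> ext a b <;> fin_cases a <;> fin_cases b <;>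
    simp [cyc2, Matrix.mul_apply, Fin.sum_univ_succ] <;> ring

theorem two_last (y : R) : IsHeckePair q (y ^ 3) !![q, -(q * y); 0, -1] (cyc2 y) := by
  refine ⟨cyc2_cube y, ?_, ?_⟩ <;> ext a b <;> fin_cases a <;> fin_cases b <;>
    simp [cyc2, Matrix.mul_apply, Fin.sum_univ_succ] <;> ring

/-- In this and the next three lemmas the freedom left is a factorisation of `q`, up to `z`. When
the module has a nonzero parameter, one factor is a prescribed unit and the other carries `q`;
otherwise both are square roots of `q` up to a unit. -/
theorem three_row (h : y * w * z = q) :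
    IsHeckePair q z !![q, 0, 0; 0, q, 0; -w, -y, -1] (cyc3 z) := by
  subst h
  refine ⟨cyc3_cube z, ?_, ?_⟩ <;> ext a b <;> fin_cases a <;> fin_cases b <;>
    simp [cyc3, Matrix.mul_apply, Fin.sum_univ_succ] <;> ring

theorem three_middle (h : y * w = q) :
    IsHeckePair q z !![-1, 0, 0; -w, q, -y; 0, 0, -1] (cyc3 z) := by
  subst h
  refine ⟨cyc3_cube z, ?_, ?_⟩ <;> ext a b <;> fin_cases a <;> fin_cases b <;>
    simp [cyc3, Matrix.mul_apply, Fin.sum_univ_succ] <;> ring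

theorem three_block_pos (h : y * w = q) :
    IsHeckePair q z !![q, 0, 0; 0, 0, y; 0, w, q - 1] (cyc3 z) := by
  subst h
  refine ⟨cyc3_cube z, ?_, ?_⟩ <;> ext a b <;> fin_cases a <;> fin_cases b <;>
    simp [cyc3, Matrix.mul_apply, Fin.sum_univ_succ] <;> ring

theorem three_block_neg (h : y * w = q) :
    IsHeckePair q z !![-1, 0, 0; 0, 0, -y; 0, -w, q - 1] (cyc3 z) := by
  subst h
  refine ⟨cyc3_cube z, ?_, ?_⟩ <;> ext a b <;> fin_cases a <;> fin_cases b <;>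
    simp [cyc3, Matrix.mul_apply, Fin.sum_univ_succ] <;> ring

/-- A lift of `S6 a b c`. -/
def lift6 (q a b c d u : R) : Matrix (Fin 6) (Fin 6) R :=
  !![q, 0, 0, 0, 0, 0;
     0, q, 0, 0, 0, 0;
     0, 0, q - 1, 0, c, 0;
     a, -(q ^ 2 * d), 0, -1, 0, 0;
     0, 0, q * d, 0, 0, 0;
     -(q ^ 2 * d * u), b, 0, 0, 0, -1]

/-- The inverses of `c` and `z` enter as elements `d` and `u`, so the relations are polynomial
identities modulo `c d = 1` and `z u = 1`. -/
theorem six {a b c d u : R} (hc : c * d = 1) (hz : z * u = 1) :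
    IsHeckePair q z (lift6 q a b c d u) (cyc6 z) := by
  refine ⟨cyc6_cube z, ?_, ?_⟩
  · simp [lift6, Matrix.vecMul_cons]
    ext i j; fin_cases i <;> fin_cases j <;> simp <;> grind
  · simp [lift6, cyc6, Matrix.vecMul_cons]
    grind
end IsHeckePair

end

noncomputable section

open Matrix HeckeAlgebra HeckeModule

/-! ### From lifted matrices to integral structures. -/

namespace HeckeMatrices

section

variable {R k : Type*} [CommRing R] [Field k]

/-- The matrices of `X` are the images under `r` of matrices satisfying the relations with
parameter `q`. -/
def HasLift (r : R →+* k) (q : R) (X : HeckeMatrices k) : Prop :=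
  ∃ (z : Rˣ) (S T : Matrix (Fin X.n) (Fin X.n) R),
    IsHeckePair q z S T ∧ r z = X.z ∧ S.map r = X.S ∧ T.map r = X.T

theorem HasLift.exists_relations {r : R →+* k} {m : ℕ} {X : HeckeMatrices k}
    (h : HasLift r m X) :
    ∃ A : HeckeGen → Matrix (Fin X.n) (Fin X.n) R,
      HeckeRelations (m : Matrix (Fin X.n) (Fin X.n) R) A ∧ ∀ g, (A g).map r = X.mat g := by
  obtain ⟨z, S, T, h, hz, hS, hT⟩ := h
  have hm : (m : Matrix (Fin X.n) (Fin X.n) R) = (m : R) • 1 := by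
    rw [← Algebra.algebraMap_eq_smul_one, map_natCast]
  have hr : r ((z⁻¹ : Rˣ) : R) = (X.z : k)⁻¹ :=
    eq_inv_of_mul_eq_one_left (by rw [← hz, ← map_mul, Units.inv_mul, map_one])
  have hT3 : T * (T * T) = (z : R) • 1 := by rw [← mul_assoc, h.cube]
  refine ⟨fun g => match g with
    | .S1 => S
    | .S2 => ((z⁻¹ : Rˣ) : R) • (T * T * S * T)
    | .T => T
    | .Tinv => ((z⁻¹ : Rˣ) : R) • (T * T), ⟨?_, ?_, ?_, ?_, ?_, ?_⟩, ?_⟩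
  · simp only [Matrix.mul_smul, hT3, smul_smul, Units.inv_mul, one_smul]
  · simp only [Matrix.smul_mul, h.cube, smul_smul, Units.inv_mul, one_smul]
  · rw [hm, add_mul, mul_sub, h.quadratic]
    simp only [Matrix.mul_smul, mul_one, one_mul, sub_smul, one_smul]
    abel
  · simp only [pow_succ, pow_zero, one_mul, h.cube, Matrix.smul_mul, Matrix.mul_smul, mul_one]
  · simp only [Matrix.mul_smul, Matrix.smul_mul, ← h.braid, smul_smul, Units.inv_mul, mul_one]
  · simp only [Matrix.mul_smul, ← mul_assoc, h.cube, Matrix.smul_mul, smul_smul, Units.inv_mul,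
      one_smul, one_mul]
  · have hmul (A B : Matrix (Fin X.n) (Fin X.n) R) : (A * B).map r = A.map r * B.map r :=
      Matrix.map_mul
    have hsmul (c : R) (A : Matrix (Fin X.n) (Fin X.n) R) : (c • A).map r = r c • A.map r := by
      ext; simp
    rintro (_ | _ | _ | _)
    · exact hS
    · simp only [hmul, hsmul, hS, hT, hr, mat]
    · exact hT
    · simp only [hmul, hsmul, hT, hr, mat]

end

/-- A module given by irreducible matrices that have a lift is the reduction of an integral simple
module. -/
theorem HasLift.isReductionOfIntegralSimple {p : ℕ} [Fact p.Prime] {r : Zbar p →+* Fbar p} {m : ℕ}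
    {X : HeckeMatrices (Fbar p)} (h : HasLift r m X) (hm : (m : Fbar p) = 0) (hn : X.n ≠ 0)
    (hX : IsIrred X.S X.T) {V : Type*} [AddCommGroup V]
    [Module (HeckeAlgebra (Fbar p) (m : Fbar p)) V]
    (e : V ≃ₗ[HeckeAlgebra (Fbar p) (m : Fbar p)] X.module hm) :
    IsReductionOfIntegralSimple m r V := by
  obtain ⟨A, hA, hr⟩ := h.exists_relations
  refine isReductionOfIntegralSimple_of_matrices r hn hA (fun N hN => hX N ?_ ?_)
    (e.trans (linearEquivOfCommute _ _ (LinearEquiv.refl _ _) fun g x => ?_))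
  · exact fun x hx => by
      have := hN .S1 x hx
      rwa [hr] at this
  · exact fun x hx => by
      have := hN .T x hx
      rwa [hr] at this
  · simp only [matrixOps, hr]
    rfl

end HeckeMatrices

section Reduce

variable {R k : Type*} [CommRing R] [Field k] (r : R →+* k)

theorem map_fin_two (a b c d : R) : (!![a, b; c, d]).map r = !![r a, r b; r c, r d] := by
  ext i j; fin_cases i <;> fin_cases j <;> rfl

theorem map_fin_three (a b c d e f g h i : R) : (!![a, b, c; d, e, f; g, h, i]).map r =
    !![r a, r b, r c; r d, r e, r f; r g, r h, r i] := by
  ext i j; fin_cases i <;> fin_cases j <;> rfl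

theorem IsHeckePair.map_cyc2 {y : R} {y' : kˣ} (h : r y = y') :
    (cyc2 y).map r = HeckeMatrices.cyc2 y' :=
  (map_fin_two r _ _ _ _).trans (by simp [h, HeckeMatrices.cyc2])

theorem IsHeckePair.map_cyc3 {z : R} {z' : kˣ} (h : r z = z') :
    (cyc3 z).map r = HeckeMatrices.cyc3 z' :=
  (map_fin_three r _ _ _ _ _ _ _ _ _).trans (by simp [h, HeckeMatrices.cyc3])

theorem IsHeckePair.map_cyc6 {z : R} {z' : kˣ} (h : r z = z') :
    (cyc6 z).map r = HeckeMatrices.cyc6 z' := by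
  ext i j
  fin_cases i <;> fin_cases j <;> simp [h, HeckeMatrices.cyc6, cyc6]

theorem IsHeckePair.map_lift6 {q a b c d u : R} (hq : r q = 0) :
    (lift6 q a b c d u).map r = HeckeMatrices.S6 (r a) (r b) (r c) := by
  ext i j
  fin_cases i <;> fin_cases j <;> simp [hq, HeckeMatrices.S6, lift6]

end Reduce

/-! ### Lifting each entry of the list. -/

namespace HeckeList

open IsHeckePair

variable {p : ℕ} [Fact p.Prime] (r : Zbar p →+* Fbar p) {m : ℕ}

/-- Only `z` and `c` must lift to units. Since `a` and `b` may vanish, K, L and its tilde variant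
are treated together. -/
theorem exists_lift6 (hm : (m : Fbar p) = 0) (z c : (Fbar p)ˣ) (a b : Fbar p) :
    ∃ (z' : (Zbar p)ˣ) (S T : Matrix (Fin 6) (Fin 6) (Zbar p)), IsHeckePair (m : Zbar p) z' S T ∧
      r z' = z ∧ S.map r = HeckeMatrices.S6 a b c ∧ T.map r = HeckeMatrices.cyc6 z := by
  have hr : r m = 0 := by rw [map_natCast, hm]
  obtain ⟨z', rfl⟩ := Zbar.exists_unit_lift r z
  obtain ⟨c', rfl⟩ := Zbar.exists_unit_lift r c
  obtain ⟨a', rfl⟩ := Zbar.reduction_surjective r a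
  obtain ⟨b', rfl⟩ := Zbar.reduction_surjective r b
  exact ⟨z', _, _, six (a := a') (b := b') c'.mul_inv z'.mul_inv, rfl, map_lift6 r hr,
    map_cyc6 r rfl⟩

/-- The matrices of the list are reductions of integral matrices. -/
theorem hasLift (hm : (m : Fbar p) = 0) (i : HeckeList (Fbar p)) : i.matrices.HasLift r m := by
  have hr : r m = 0 := by rw [map_natCast, hm]
  obtain ⟨c, hc, hc0⟩ := Zbar.exists_sqrt r m hm
  cases i with
  | M1zero y =>
    obtain ⟨y, rfl⟩ := Zbar.exists_unit_lift r y
    refine ⟨y ^ 3, _, _, one_zero (y : Zbar p), ?_, ?_, ?_⟩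
    · simp [matrices, HeckeMatrices.M1zero]
    · ext a b; fin_cases a; fin_cases b; simp [matrices, HeckeMatrices.M1zero, hm]
    · ext a b; fin_cases a; fin_cases b; simp [matrices, HeckeMatrices.M1zero]
  | M1neg y =>
    obtain ⟨y, rfl⟩ := Zbar.exists_unit_lift r y
    refine ⟨y ^ 3, _, _, one_neg (y : Zbar p), ?_, ?_, ?_⟩
    · simp [matrices, HeckeMatrices.M1neg]
    · ext a b; fin_cases a; fin_cases b; simp [matrices, HeckeMatrices.M1neg]
    · ext a b; fin_cases a; fin_cases b; simp [matrices, HeckeMatrices.M1neg]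
  | M2 y =>
    obtain ⟨y, rfl⟩ := Zbar.exists_unit_lift r y
    refine ⟨y ^ 3, _, _, two_first (y : Zbar p), ?_, (map_fin_two r _ _ _ _).trans ?_, map_cyc2 r rfl⟩
    · simp [matrices, HeckeMatrices.M2]
    · simp [matrices, HeckeMatrices.M2, hm]
  | M2t y =>
    obtain ⟨y, rfl⟩ := Zbar.exists_unit_lift r y
    refine ⟨y ^ 3, _, _, two_last (y : Zbar p), ?_, (map_fin_two r _ _ _ _).trans ?_, map_cyc2 r rfl⟩
    · simp [matrices, HeckeMatrices.M2t]
    · simp [matrices, HeckeMatrices.M2t, hm]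
  | K6 z y y' _ _ =>
    have := exists_lift6 r hm z (y' / z) 1 (y / y')
    rwa [Units.val_div_eq_div_val] at this
  | M3 z y _ =>
    obtain ⟨z, rfl⟩ := Zbar.exists_unit_lift r z
    obtain ⟨y, rfl⟩ := Zbar.exists_unit_lift r y
    -- The entry `y⁻¹` of `M3` is lifted to a unit, and `w` absorbs the factor `q`, so it reduces to
    -- zero.
    refine ⟨z, _, _, three_row (R := Zbar p) (y := -(y⁻¹ : (Zbar p)ˣ)) (w := -(m * y * (z⁻¹ : (Zbar p)ˣ))) ?_,
      rfl, (map_fin_three r _ _ _ _ _ _ _ _ _).trans ?_, map_cyc3 r rfl⟩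
    · linear_combination (m : Zbar p) * z * (z⁻¹ : (Zbar p)ˣ) * y.mul_inv + m * z.mul_inv
    · simp [matrices, HeckeMatrices.M3, hm]
  | M3t z y _ =>
    obtain ⟨z, rfl⟩ := Zbar.exists_unit_lift r z
    obtain ⟨y, rfl⟩ := Zbar.exists_unit_lift r y
    refine ⟨z, _, _, three_block_neg (R := Zbar p) (y := m * y) (w := (y⁻¹ : (Zbar p)ˣ)) ?_,
      rfl, (map_fin_three r _ _ _ _ _ _ _ _ _).trans ?_, map_cyc3 r rfl⟩
    · linear_combination (m : Zbar p) * y.mul_inv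
    · simp [matrices, HeckeMatrices.M3t, hm]
  | N3 z y _ =>
    obtain ⟨z, rfl⟩ := Zbar.exists_unit_lift r z
    obtain ⟨y, rfl⟩ := Zbar.exists_unit_lift r y
    refine ⟨z, _, _, three_middle (R := Zbar p) (y := y) (w := m * (y⁻¹ : (Zbar p)ˣ)) ?_,
      rfl, (map_fin_three r _ _ _ _ _ _ _ _ _).trans ?_, map_cyc3 r rfl⟩
    · linear_combination (m : Zbar p) * y.mul_inv
    · simp [matrices, HeckeMatrices.N3, hm]
  | N3t z y _ =>
    obtain ⟨z, rfl⟩ := Zbar.exists_unit_lift r z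
    obtain ⟨y, rfl⟩ := Zbar.exists_unit_lift r y
    refine ⟨z, _, _, three_block_pos (R := Zbar p) (y := y) (w := m * (y⁻¹ : (Zbar p)ˣ)) ?_,
      rfl, (map_fin_three r _ _ _ _ _ _ _ _ _).trans ?_, map_cyc3 r rfl⟩
    · linear_combination (m : Zbar p) * y.mul_inv
    · simp [matrices, HeckeMatrices.N3t, hm]
  | L6 z y =>
    have := exists_lift6 r hm z (y / z) 0 1
    rwa [Units.val_div_eq_div_val] at this
  | L6t z y =>
    have := exists_lift6 r hm z (y / z) 1 0
    rwa [Units.val_div_eq_div_val] at this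
  | P3 z =>
    obtain ⟨z, rfl⟩ := Zbar.exists_unit_lift r z
    -- Both off-diagonal entries must reduce to zero, so `q` is split as `c * c`.
    refine ⟨z, _, _, three_row (R := Zbar p) (y := c * (z⁻¹ : (Zbar p)ˣ)) (w := c) ?_,
      rfl, (map_fin_three r _ _ _ _ _ _ _ _ _).trans ?_, map_cyc3 r rfl⟩
    · linear_combination hc + c * c * z.mul_inv
    · simp [matrices, HeckeMatrices.P3, hm, hc0]
  | P3t z =>
    obtain ⟨z, rfl⟩ := Zbar.exists_unit_lift r z
    refine ⟨z, _, _, three_middle (R := Zbar p) (y := -c) (w := -c) ?_,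
      rfl, (map_fin_three r _ _ _ _ _ _ _ _ _).trans ?_, map_cyc3 r rfl⟩
    · linear_combination hc
    · simp [matrices, HeckeMatrices.P3t, hm, hc0]

/-- A simple module is the reduction of an integral simple module. -/
theorem isReductionOfIntegralSimple (hm : (m : Fbar p) = 0) (V : Type*) [AddCommGroup V]
    [Module (HeckeAlgebra (Fbar p) (m : Fbar p)) V]
    [IsSimpleModule (HeckeAlgebra (Fbar p) (m : Fbar p)) V] :
    IsReductionOfIntegralSimple m r V := by
  obtain ⟨i, ⟨e⟩⟩ := exists_nonempty_linearEquiv hm V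
  exact (hasLift r hm i).isReductionOfIntegralSimple hm i.matrices_n_ne_zero i.isIrred e

end HeckeList

end

theorem mainTheorem1 (p f : ℕ) [Fact p.Prime] (hf : f ≠ 0) :
    -- every module of the list is simple
    (∀ i : HeckeList (Fbar p),
      IsSimpleModule (HeckeAlgebra (Fbar p) ((p ^ f : ℕ) : Fbar p))
        (i.module (Fbar.natCast_prime_pow p f hf))) ∧
    -- the modules of the list are pairwise non-isomorphic
    (∀ i j : HeckeList (Fbar p),
      Nonempty (i.module (Fbar.natCast_prime_pow p f hf)
        ≃ₗ[HeckeAlgebra (Fbar p) ((p ^ f : ℕ) : Fbar p)]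
          j.module (Fbar.natCast_prime_pow p f hf)) → i = j) ∧
    -- every simple module with a central character is in the list
    (∀ (V : Type*) [AddCommGroup V] [Module (HeckeAlgebra (Fbar p) ((p ^ f : ℕ) : Fbar p)) V],
      IsSimpleModule (HeckeAlgebra (Fbar p) ((p ^ f : ℕ) : Fbar p)) V →
      HasCentralCharacter (Fbar p) (HeckeAlgebra (Fbar p) ((p ^ f : ℕ) : Fbar p)) V →
      ∃ i : HeckeList (Fbar p),
        Nonempty (V ≃ₗ[HeckeAlgebra (Fbar p) ((p ^ f : ℕ) : Fbar p)]
          i.module (Fbar.natCast_prime_pow p f hf))) ∧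
    -- every simple module is the reduction of an integral simple module
    (∀ (r : Zbar p →+* Fbar p) (V : Type*) [AddCommGroup V]
      [Module (HeckeAlgebra (Fbar p) ((p ^ f : ℕ) : Fbar p)) V],
      IsSimpleModule (HeckeAlgebra (Fbar p) ((p ^ f : ℕ) : Fbar p)) V →
      IsReductionOfIntegralSimple (p ^ f) r V) := by
  have hq := Fbar.natCast_prime_pow p f hf
  refine ⟨HeckeList.isSimpleModule hq, fun i j ⟨e⟩ => HeckeList.eq_of_linearEquiv hq e,
    fun V _ _ _ _ => HeckeList.exists_nonempty_linearEquiv hq V,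
    fun r V _ _ _ => HeckeList.isReductionOfIntegralSimple r hq V⟩
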